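/- \textbf{Theorem (Unshielded complex source).} Let $y\in\mathbb R^3$, $a=|y|>0$, and let $u\in\mathbb R$ with $|u|>a$. For $x\in\mathbb R^3$ let $\tilde r(x)=\sqrt{|x|^2-a^2-2i\,x\cdot y}$ with $\operatorname{Re}\tilde r\ge0$, and write $\tilde r=p-iq$ with $p,q$ real. Let $g$ be any function holomorphic on $\mathbb C\setminus\mathbb R$; in particular $g$ may be the analytic signal $g(\tau)=\frac1{2\pi i}\int_{\mathbb R}\frac{g_0(s)}{\tau-s}\,ds$ of a driving signal $g_0$ with $\int_{\mathbb R}\frac{|g_0(s)|}{1+|s|}\,ds<\infty$, which is holomorphic there. With $\tau=t-iu$ put $$W(x,t)=\frac{g(\tau-\tilde r)}{4\pi\tilde r};$$ for an analytic signal $g$ of $g_0$ as above this is the wave $\int_{\mathbb R} \frac{g_0(s)\,ds}{8i\pi^2\tilde r(\tau-s-\tilde r)}$. For $\varepsilon>0$ let $W_\varepsilon=W$ where $p>\varepsilon a$ and $W_\varepsilon=0$ elsewhere, and let $S_\varepsilon=-\Box W_\varepsilon$ in the sense of distributions on $\mathbb R^3\times\mathbb R$, where $\Box=\Delta-\partial_t^2$.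 A distribution $T$ on $\mathbb R^3\times\mathbb R$ is called regular in $t$ if $\langle T,\varphi\rangle=\int_{\mathbb R}\langle T(t),\varphi(\cdot,t)\rangle\,dt$ for all test functions $\varphi$, where each $T(t)$ is a distribution on $\mathbb R^3$ and $t\mapsto\langle T(t),f\rangle$ is smooth for every test function $f$ on $\mathbb R^3$. Then $W_\varepsilon$ is locally integrable, $S_\varepsilon$ is regular in $t$ with $S_\varepsilon(t)=-\Delta\big(W_\varepsilon(\cdot,t)\big)+(\partial_t^2W_\varepsilon)(\cdot,t)$ (here $W_\varepsilon(\cdot,t)$ and the classical derivative $(\partial_t^2W_\varepsilon)(\cdot,t)$ are locally integrable), and there is a distribution $S$ on $\mathbb R^3\times\mathbb R$, regular in $t$, such that as $\varepsilon\searrow0$, $\langle S_\varepsilon,\varphi\rangle\to\langle S,\varphi\rangle$ for every test function $\varphi$ on $\mathbb R^3\times\mathbb R$, and $\langle S_\varepsilon(t),f\rangle\to\langle S(t),f\rangle$ for every $t$ and every test function $f$ on $\mathbb R^3$. Let $(\rho,\phi,\xi)$ be cylindrical coordinates with axis $\hat y=y/a$ (so $\xi=\hat y\cdot x$), let $\bar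 f(\rho,\xi)$ be the mean of $f$ over $\phi\in[0,2\pi]$, let $\bar f(p,q)$ be the same mean in the coordinates $(p,q)$, related to $(\rho,\xi)$ by $a\xi=pq$, $a^2\rho^2=(p^2+a^2)(a^2-q^2)$, and let $\tilde g(\tau,q)=\frac12[g(\tau+iq)+g(\tau-iq)]$. Then, for every $t$ and $f$, with $\tau=t-iu$ and with all the integrals absolutely convergent: (i) $\displaystyle\langle S(t),f\rangle=\tilde g(\tau,a)f(0)+ia\int_0^a\frac{dq}{q}\,\tilde g(\tau,q)\left[\bar f_p(0,q)+i\bar f_q(0,q)\right]$; (ii) for $0<q<a$ and $\rho=\sqrt{a^2-q^2}$, $\ \bar f_p(0,q)=\frac qa\,\bar f_\xi(\rho,0)$ and $\bar f_q(0,q)=-\frac q\rho\,\bar f_\rho(\rho,0)$, and both are bounded by $Cq$ on $(0,a)$, with $C$ independent of $q$; (iii) with $q=\sqrt{a^2-\rho^2}$, $\ \displaystyle\langle S(t),f\rangle=\tilde g(\tau,a)f(0)+\int_0^a\frac{d\rho}{q}\,\tilde g(\tau,q)\left[a\bar f_\rho(\rho,0)+i\rho\,\bar f_\xi(\rho,0)\right]$;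 (iv) equivalently, $S$ is a point source at the origin plus a radial flow and a double layer on the disk $D(y)=\{x: x\cdot y=0,\ |x|\le a\}$, modulated by $\tilde g$: with $\rho=|x|$ and $q=\sqrt{a^2-\rho^2}$ on $D(y)$, and $dA$ the area measure on $D(y)$, $$\langle S(t),f\rangle=\tilde g(\tau,a)f(0)+\int_{D(y)}\frac{\tilde g(\tau,q)}{2\pi q\rho}\left(a\,\partial_\rho f+i\rho\,\partial_\xi f\right)dA .$$ -/

import Mathlib

open MeasureTheory Set Filter Topology TopologicalSpace Complex
open scoped ContDiff Distributions LineDeriv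

noncomputable section

namespace ComplexSource

/-- Euclidean space `ℝ³`. -/
abbrev Space : Type := EuclideanSpace ℝ (Fin 3)

/-- Real spacetime, points `(x, t)`; its volume is `d³x dt`. -/
abbrev Spacetime : Type := Space × ℝ

/-- Spatial test functions. -/
abbrev SpaceTest : Type := 𝓓((⊤ : Opens Space), ℝ)

/-- Test functions on spacetime. -/
abbrev SpacetimeTest : Type := 𝓓((⊤ : Opens Spacetime), ℝ)

/-- Complex-valued Schwartz distributions on `ℝ³`. -/
abbrev SpaceDistribution : Type := 𝓓'((⊤ : Opens Space), ℂ)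

/-- Complex-valued Schwartz distributions on spacetime. -/
abbrev SpacetimeDistribution : Type := 𝓓'((⊤ : Opens Spacetime), ℂ)

/-- The distribution `φ ↦ ∫ φ w` on `ℝ³` defined by a locally integrable function `w`. -/
def distOfSpaceFun (w : Space → ℂ) : SpaceDistribution :=
  ContinuousLinearMap.toUniformConvergenceCLM (RingHom.id ℝ) ℂ _
    (TestFunction.integralAgainstBilinCLM (ContinuousLinearMap.lsmul ℝ ℝ) volume w)

/-- The distribution `φ ↦ ∫ φ w` on spacetime defined by a locally integrable function `w`. -/
def distOfSpacetimeFun (w : Spacetime → ℂ) : SpacetimeDistribution :=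
  ContinuousLinearMap.toUniformConvergenceCLM (RingHom.id ℝ) ℂ _
    (TestFunction.integralAgainstBilinCLM (ContinuousLinearMap.lsmul ℝ ℝ) volume w)

/-- The Laplacian of a distribution on `ℝ³`. -/
def distLaplacian (T : SpaceDistribution) : SpaceDistribution :=
  ∑ i : Fin 3, ∂_{EuclideanSpace.single i (1 : ℝ)} (∂_{EuclideanSpace.single i (1 : ℝ)} T)

/-- The wave operator `□ = Δ - ∂ₜ²` on distributions on spacetime. -/
def distBox (T : SpacetimeDistribution) : SpacetimeDistribution :=
  (∑ i : Fin 3, ∂_{((EuclideanSpace.single i (1 : ℝ), 0) : Spacetime)}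
      (∂_{((EuclideanSpace.single i (1 : ℝ), 0) : Spacetime)} T))
    - ∂_{((0, 1) : Spacetime)} (∂_{((0, 1) : Spacetime)} T)

/-- The spatial test function `x ↦ φ (x, t)`. -/
def slice (φ : SpacetimeTest) (t : ℝ) : SpaceTest where
  toFun x := φ (x, t)
  contDiff' := φ.contDiff.comp (contDiff_id.prodMk contDiff_const)
  hasCompactSupport' :=
    φ.hasCompactSupport.comp_isClosedEmbedding
      (g := fun x : Space => ((x, t) : Spacetime)) (by
        refine IsClosedEmbedding.of_continuous_injective_isClosedMap (by fun_prop)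
          (fun x x' h => congrArg Prod.fst h) ?_
        intro s hs
        have : (fun x : Space => ((x, t) : Spacetime)) '' s = s ×ˢ {t} := by
          ext ⟨a, b⟩
          simp [and_comm, eq_comm]
        rw [this]
        exact hs.prod isClosed_singleton)
  tsupport_subset' := fun _ _ => trivial

/-- The distribution `T` on spacetime is regular in `t` (it needs no smearing in time): for each
time `t` it is given by a spatial distribution `σ t`, which depends smoothly on `t`. -/
structure IsRegularInTime (T : SpacetimeDistribution) (σ : ℝ → SpaceDistribution) : Prop where
  smooth : ∀ f : SpaceTest, ContDiff ℝ ∞ (fun t => σ t f)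
  integrable : ∀ φ : SpacetimeTest, Integrable (fun t => σ t (slice φ t))
  eq_integral : ∀ φ : SpacetimeTest, T φ = ∫ t, σ t (slice φ t)

/-- The complex distance `r̃ = √((x - iy)²) = √(|x|² - |y|² - 2i x·y)` from `iy` to `x`,
with the branch `Re r̃ ≥ 0`. -/
def complexDist (y x : Space) : ℂ :=
  (((‖x‖ ^ 2 - ‖y‖ ^ 2 : ℝ) : ℂ) - 2 * I * ((inner ℝ x y : ℝ) : ℂ)) ^ (1 / 2 : ℂ)

/-- The analytic signal of a driving signal `g₀`. -/
def analyticSignal (g₀ : ℝ → ℂ) (τ : ℂ) : ℂ :=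
  1 / (2 * Real.pi * I) * ∫ s : ℝ, g₀ s / (τ - s)

/-- The extended retarded propagator `1 / (8 i π² r̃ (τ - r̃))`. -/
def retardedPropagator (y x : Space) (τ : ℂ) : ℂ :=
  1 / (8 * I * Real.pi ^ 2 * complexDist y x * (τ - complexDist y x))

/-- The beam `W = g(τ - r̃) / (4 π r̃)`. -/
def beam (g : ℂ → ℂ) (y x : Space) (τ : ℂ) : ℂ :=
  g (τ - complexDist y x) / (4 * Real.pi * complexDist y x)

/-- The shielded beam `W_ε = Θ(p - ε a) W` at `(x, t)`, with `p = Re r̃`, `a = |y|` and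
`τ = t - iu`. -/
def shieldedBeam (g : ℂ → ℂ) (y : Space) (u ε : ℝ) (z : Spacetime) : ℂ :=
  open Classical in
  if ε * ‖y‖ < (complexDist y z.1).re then beam g y z.1 (z.2 - u * I) else 0

/-- The shielded source `S_ε = -□ W_ε`, a distribution on spacetime. -/
def shieldedSource (g : ℂ → ℂ) (y : Space) (u ε : ℝ) : SpacetimeDistribution :=
  -distBox (distOfSpacetimeFun (shieldedBeam g y u ε))

/-- The shielded source at a fixed time `t`, as a distribution on space: the time derivatives in
`-□ W_ε` are classical (`W_ε` is smooth in `t`), the spatial ones distributional. -/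
def shieldedSourceAt (g : ℂ → ℂ) (y : Space) (u ε t : ℝ) : SpaceDistribution :=
  -(distLaplacian (distOfSpaceFun fun x => shieldedBeam g y u ε (x, t))
    - distOfSpaceFun fun x => iteratedDeriv 2 (fun s => shieldedBeam g y u ε (x, s)) t)

/-- The average `g̃(τ, q)` of `g(τ + iq)` and `g(τ - iq)`. -/
def avg (g : ℂ → ℂ) (τ : ℂ) (q : ℝ) : ℂ :=
  (1 / 2) * (g (τ + I * q) + g (τ - I * q))

/-- The point with cylindrical coordinates `(ρ, θ, ξ)` with respect to the orthonormal frame `e`,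
whose axis is `e 2`. -/
def cylPoint (e : OrthonormalBasis (Fin 3) ℝ Space) (ρ θ ξ : ℝ) : Space :=
  (ρ * Real.cos θ) • e 0 + (ρ * Real.sin θ) • e 1 + ξ • e 2

/-- The mean of `f` over the azimuthal angle, as a function of `ρ` and `ξ`. -/
def cylMean (e : OrthonormalBasis (Fin 3) ℝ Space) (f : Space → ℝ) (ρ ξ : ℝ) : ℝ :=
  1 / (2 * Real.pi) * ∫ θ in (0 : ℝ)..(2 * Real.pi), f (cylPoint e ρ θ ξ)

/-- `∂_ρ` of the azimuthal mean. -/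
def cylMeanRho (e : OrthonormalBasis (Fin 3) ℝ Space) (f : Space → ℝ) (ρ ξ : ℝ) : ℝ :=
  deriv (fun r => cylMean e f r ξ) ρ

/-- `∂_ξ` of the azimuthal mean. -/
def cylMeanXi (e : OrthonormalBasis (Fin 3) ℝ Space) (f : Space → ℝ) (ρ ξ : ℝ) : ℝ :=
  deriv (fun s => cylMean e f ρ s) ξ

/-- The azimuthal mean in the oblate spheroidal coordinates `(p, q)`, where `r̃ = p - iq`,
`a ξ = p q` and `a² ρ² = (p² + a²) (a² - q²)`. -/
def oblateMean (e : OrthonormalBasis (Fin 3) ℝ Space) (a : ℝ) (f : Space → ℝ) (p q : ℝ) : ℝ :=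
  cylMean e f (√((p ^ 2 + a ^ 2) * (a ^ 2 - q ^ 2)) / a) (p * q / a)

/-- `∂_p` of the azimuthal mean. -/
def oblateMeanP (e : OrthonormalBasis (Fin 3) ℝ Space) (a : ℝ) (f : Space → ℝ) (p q : ℝ) : ℝ :=
  deriv (fun p' => oblateMean e a f p' q) p

/-- `∂_q` of the azimuthal mean. -/
def oblateMeanQ (e : OrthonormalBasis (Fin 3) ℝ Space) (a : ℝ) (f : Space → ℝ) (p q : ℝ) : ℝ :=
  deriv (fun q' => oblateMean e a f p q') q

/-- The point of the plane `ξ = 0` with Cartesian coordinates `v`. -/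
def planePoint (e : OrthonormalBasis (Fin 3) ℝ Space) (v : ℝ × ℝ) : Space :=
  v.1 • e 0 + v.2 • e 1

/-- The distance `ρ` of that point from the axis. -/
def planeRadius (v : ℝ × ℝ) : ℝ := √(v.1 ^ 2 + v.2 ^ 2)

/-- `a ∂_ρ f + i ρ ∂_ξ f` at a point of the plane `ξ = 0`: the radial flow and the double layer. -/
def flowAndLayer (e : OrthonormalBasis (Fin 3) ℝ Space) (a : ℝ) (f : Space → ℝ) (v : ℝ × ℝ) : ℂ :=
  a * (fderiv ℝ f (planePoint e v) ((planeRadius v)⁻¹ • planePoint e v) : ℝ)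
    + I * planeRadius v * (fderiv ℝ f (planePoint e v) (e 2) : ℝ)

end ComplexSource

end

/-!
The beam is a function `h(r̃) = g(τ - r̃) / (4π r̃)` of the complex distance `r̃ = p - iq`, and it
solves the wave equation wherever `p > 0`: the eikonal equation `∇r̃ · ∇r̃ = 1` gives
`Δ h(r̃) = h'' + 2 h' / r̃`, which is the second time derivative of the beam. The branch disk
`p = 0` carries the whole source, and the proof computes the flux which leaves it.

The function `1 / |r̃|` is locally integrable (`locallyIntegrable_inv_norm_complexDist`), because
`r̃²` has imaginary part `-2 x · y`. Multiples of it dominate all shielded beams on bounded sets,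
since `|Im r̃| ≤ a < |u|` keeps `τ - r̃` away from the real axis. Dominated convergence yields the
limit, which is the source `-□ W_0` of the unshielded beam, and its regularity in time: the shield
is independent of time, so that time derivatives only replace `g` by `g'`.

To evaluate the limit on a test function `f`, insert a smooth cutoff `η(p / δ)`. Green's identity
(`green_cutoff`) leaves an integral of the flux of `h ∇f - f ∇h` against `∇η`. In oblate spheroidal
coordinates (`integral_oblate`, `integral_cutoff_flux`) it is the integral over `p` of the
derivative of the cutoff times the flux through the spheroid of oblate radius `p`. That flux
contains `h'`, which is of order `1 / r̃²` and is not integrable in `q` at `p = 0`. But `h'(p - iq)`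
is a derivative in `q`, and an integration by parts in `q` (`oblateFlux_eq_regularFlux`) moves it to
the azimuthal mean of `f`. The gradient of the mean is `O(|p| + |q|)` (`exists_abs_oblateGrad_le`)
and compensates the remaining `1 / r̃`, so that the flux extends continuously to `p = 0`
(`continuousOn_regularFlux`) and the limit is its value there
(`shieldedSourceAt_zero_eq_regularFlux`). The boundary terms `q = ±a` belong to the origin and give
the point source; folding the integral over `-a < q < a` at `q = 0`, the rim where the two faces of
the disk meet, produces the averages of `g` (`shieldedSourceAt_zero_eq_diskDensity`). The other
forms of the result follow by the substitution `ρ = √(a² - q²)` and by polar coordinates on the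
disk.
-/

namespace ComplexSource

/-! ### The complex distance -/

section ComplexDistance

variable (y : Space)

theorem complexDist_sq (x : Space) :
    complexDist y x ^ 2 = ((‖x‖ ^ 2 - ‖y‖ ^ 2 : ℝ) : ℂ) - 2 * I * ((inner ℝ x y : ℝ) : ℂ) := by
  rw [complexDist, one_div]
  exact cpow_ofNat_inv_pow _ 2

/-- A square root with positive real part is the complex distance. -/
theorem complexDist_eq_of_sq_eq {x : Space} {z : ℂ} (hz : 0 < z.re)
    (h : z ^ 2 = ((‖x‖ ^ 2 - ‖y‖ ^ 2 : ℝ) : ℂ) - 2 * I * ((inner ℝ x y : ℝ) : ℂ)) :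
    complexDist y x = z := by
  rw [complexDist, one_div, ← h, sq_cpow_two_inv hz]

theorem complexDist_re_sq_sub_im_sq (x : Space) :
    (complexDist y x).re ^ 2 - (complexDist y x).im ^ 2 = ‖x‖ ^ 2 - ‖y‖ ^ 2 := by
  have h := congrArg Complex.re (complexDist_sq y x)
  simp only [sq, mul_re, sub_re, ofReal_re, re_ofNat, I_re, mul_zero, im_ofNat, I_im,
    ofReal_im, mul_im] at h
  simp only [sq]; linarith

theorem complexDist_re_mul_im (x : Space) :
    (complexDist y x).re * (complexDist y x).im = -inner ℝ x y := by
  have h := congrArg Complex.im (complexDist_sq y x)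
  simp only [sq, mul_re, sub_im, ofReal_re, re_ofNat, I_re, mul_zero, im_ofNat, I_im,
    ofReal_im, mul_im] at h
  linarith

theorem inner_sq_le (x : Space) : (inner ℝ x y : ℝ) ^ 2 ≤ ‖x‖ ^ 2 * ‖y‖ ^ 2 := by
  have := abs_real_inner_le_norm x y
  rw [← mul_pow]
  exact sq_le_sq' (abs_le.1 this).1 (abs_le.1 this).2

/-- The complex distance `p - iq` has `|q| ≤ a`. Hence `τ - r̃` stays off the real axis when
`|Im τ| > a`, and `g (τ - r̃)` makes sense everywhere. -/
theorem abs_complexDist_im_le (x : Space) : |(complexDist y x).im| ≤ ‖y‖ := by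
  have h1 := complexDist_re_sq_sub_im_sq y x
  have h2 := complexDist_re_mul_im y x
  have h3 := inner_sq_le y x
  set p := (complexDist y x).re
  set q := (complexDist y x).im
  rw [← neg_sq, ← h2] at h3
  apply abs_le_of_sq_le_sq _ (norm_nonneg y)
  by_contra! hlt
  -- `(q² - a²)(p² + a²) = (x·y)² - |x|²a² ≤ 0`
  have h4 : (q ^ 2 - ‖y‖ ^ 2) * (p ^ 2 + ‖y‖ ^ 2) ≤ 0 := by nlinarith
  have h5 : p ^ 2 + ‖y‖ ^ 2 = 0 := by
    nlinarith [sq_nonneg p, sq_nonneg ‖y‖]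
  have hp : p = 0 := by nlinarith [sq_nonneg p, sq_nonneg ‖y‖]
  have hy : ‖y‖ = 0 := by nlinarith [sq_nonneg p, sq_nonneg ‖y‖]
  rw [hp, hy] at h1
  rw [hy] at hlt
  nlinarith [sq_nonneg ‖x‖]

theorem norm_complexDist_sq (x : Space) :
    ‖complexDist y x‖ ^ 2 = (complexDist y x).re ^ 2 + (complexDist y x).im ^ 2 := by
  rw [← normSq_eq_norm_sq, normSq_apply]; ring

theorem norm_complexDist_le (x : Space) : ‖complexDist y x‖ ≤ ‖x‖ + ‖y‖ := by
  have h1 := complexDist_re_sq_sub_im_sq y x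
  have h2 := abs_complexDist_im_le y x
  have h3 := norm_complexDist_sq y x
  have h4 : (complexDist y x).im ^ 2 ≤ ‖y‖ ^ 2 := sq_le_sq' (abs_le.1 h2).1 (abs_le.1 h2).2
  apply abs_le_of_sq_le_sq' _ (by positivity) |>.2
  nlinarith [norm_nonneg x, norm_nonneg y, mul_nonneg (norm_nonneg x) (norm_nonneg y)]

theorem measurable_complexDist : Measurable (complexDist y) := by
  unfold complexDist
  apply Measurable.pow_const
  fun_prop

theorem continuous_complexDist_re : Continuous fun x => (complexDist y x).re := by
  unfold complexDist
  simp only [one_div, cpow_inv_two_re]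
  fun_prop

/-- Where it has positive real part, the complex distance is continuous: there the radicand stays
off the branch cut. -/
theorem continuousOn_complexDist : ContinuousOn (complexDist y) {x | 0 < (complexDist y x).re} := by
  intro x hx
  apply ContinuousAt.continuousWithinAt
  refine ContinuousAt.cpow (by fun_prop) continuousAt_const ?_
  rw [← complexDist_sq, mem_slitPlane_iff]
  by_contra! h
  have h1 := h.1
  have h2 := h.2
  simp only [sq, mul_re, mul_im] at h1 h2
  have hx' : 0 < (complexDist y x).re := hx
  have him : (complexDist y x).im = 0 := by
    have : (complexDist y x).re * (complexDist y x).im = 0 := by linarith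
    exact (mul_eq_zero.1 this).resolve_left hx'.ne'
  rw [him] at h1
  nlinarith

theorem isOpen_re_complexDist_pos : IsOpen {x | 0 < (complexDist y x).re} :=
  isOpen_lt continuous_const (continuous_complexDist_re y)

/-- The directional derivative of the complex distance, from `∇r̃ = (x - iy) / r̃`. -/
theorem hasDerivAt_complexDist_line {x v : Space} (hx : 0 < (complexDist y x).re) :
    HasDerivAt (fun s : ℝ => complexDist y (x + s • v))
      (((inner ℝ x v : ℝ) - I * (inner ℝ y v : ℝ)) / complexDist y x) 0 := by
  have hne : complexDist y x ≠ 0 := fun h => by simp [h] at hx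
  -- the square root inverts the square near `r̃`, and the radicand is quadratic in `s`
  have hc : ContinuousAt (fun s : ℝ => complexDist y (x + s • v)) 0 := by
    have h1 : ContinuousAt (complexDist y) (x + (0 : ℝ) • v) := by
      rw [zero_smul, add_zero]
      exact (continuousOn_complexDist y).continuousAt ((isOpen_re_complexDist_pos y).mem_nhds hx)
    exact h1.comp (f := fun s : ℝ => x + s • v) (by fun_prop)
  have hw : HasDerivAt (fun s : ℝ => complexDist y (x + s • v) ^ 2)
      (2 * ((inner ℝ x v : ℝ) - I * (inner ℝ y v : ℝ))) 0 := by
    have e : (fun s : ℝ => complexDist y (x + s • v) ^ 2) = fun s : ℝ =>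
        (((‖x‖ ^ 2 - ‖y‖ ^ 2 + s * (2 * inner ℝ x v) + s ^ 2 * ‖v‖ ^ 2 : ℝ)) : ℂ)
          - 2 * I * ((inner ℝ x y + s * inner ℝ y v : ℝ) : ℂ) := by
      funext s
      rw [complexDist_sq, norm_add_sq_real, inner_add_left, real_inner_smul_left,
        real_inner_smul_right, norm_smul, mul_pow, Real.norm_eq_abs, sq_abs,
        real_inner_comm v y]
      push_cast; ring
    rw [e]
    have h1 : HasDerivAt (fun s : ℝ => ‖x‖ ^ 2 - ‖y‖ ^ 2 + s * (2 * inner ℝ x v)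
        + s ^ 2 * ‖v‖ ^ 2) (2 * inner ℝ x v) 0 := by
      have := (((hasDerivAt_id (0 : ℝ)).mul_const (2 * (inner ℝ x v : ℝ))).const_add
        (‖x‖ ^ 2 - ‖y‖ ^ 2)).add (((hasDerivAt_id (0 : ℝ)).pow 2).mul_const (‖v‖ ^ 2))
      convert! this using 1; simp
    have h2 : HasDerivAt (fun s : ℝ => (inner ℝ x y : ℝ) + s * inner ℝ y v)
        (inner ℝ y v) 0 := by
      have := ((hasDerivAt_id (0 : ℝ)).mul_const (inner ℝ y v : ℝ)).const_add (inner ℝ x y : ℝ)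
      convert! this using 1; simp
    convert! h1.ofReal_comp.sub (h2.ofReal_comp.const_mul (2 * I)) using 1
    push_cast; ring
  rw [hasDerivAt_iff_tendsto_slope] at hw ⊢
  have hsum : Tendsto (fun s : ℝ => complexDist y (x + s • v) + complexDist y x) (𝓝[≠] 0)
      (𝓝 (complexDist y x + complexDist y x)) := by
    have := (hc.tendsto.add_const (complexDist y x)).mono_left
      (nhdsWithin_le_nhds (s := {(0 : ℝ)}ᶜ))
    simpa using this
  have := hw.div hsum (by simpa [← two_mul] using hne)
  have hlim : 2 * ((inner ℝ x v : ℝ) - I * (inner ℝ y v : ℝ))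
      / (complexDist y x + complexDist y x)
      = (((inner ℝ x v : ℝ) : ℂ) - I * (inner ℝ y v : ℝ)) / complexDist y x := by
    field_simp; ring
  rw [hlim] at this
  refine this.congr' ?_
  have hne' : ∀ᶠ s : ℝ in 𝓝[≠] 0, complexDist y (x + s • v) + complexDist y x ≠ 0 :=
    hsum.eventually_ne (by simpa [← two_mul] using hne)
  filter_upwards [hne'] with s hs
  simp only [slope, vsub_eq_sub, sub_zero, zero_smul, add_zero, real_smul, Pi.div_apply]
  rw [sq_sub_sq]
  field_simp

end ComplexDistance

/-! ### Orthonormal frames and local integrability of the inverse complex distance -/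

section Frame

/-- The coordinates `c ↦ ∑ cᵢ eᵢ` of an orthonormal frame, as a measurable equivalence. -/
noncomputable def frameEquiv (e : OrthonormalBasis (Fin 3) ℝ Space) : (Fin 3 → ℝ) ≃ᵐ Space :=
  (MeasurableEquiv.toLp 2 (Fin 3 → ℝ)).trans e.measurableEquiv.symm

variable (e : OrthonormalBasis (Fin 3) ℝ Space)

theorem frameEquiv_apply (c : Fin 3 → ℝ) :
    frameEquiv e c = c 0 • e 0 + c 1 • e 1 + c 2 • e 2 := by
  have : frameEquiv e c = e.repr.symm (WithLp.toLp 2 c) := rfl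
  rw [this, ← e.sum_repr_symm, Fin.sum_univ_three]

theorem measurePreserving_frameEquiv : MeasurePreserving (frameEquiv e) volume volume :=
  (EuclideanSpace.volume_preserving_symm_measurableEquiv_toLp (Fin 3)).symm.trans
    e.measurePreserving_measurableEquiv.symm

theorem inner_frame (i j : Fin 3) : (inner ℝ (e i) (e j) : ℝ) = if i = j then 1 else 0 :=
  orthonormal_iff_ite.1 e.orthonormal i j

theorem norm_sq_frame (c₀ c₁ c₂ : ℝ) :
    ‖c₀ • e 0 + c₁ • e 1 + c₂ • e 2‖ ^ 2 = c₀ ^ 2 + c₁ ^ 2 + c₂ ^ 2 := by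
  rw [← real_inner_self_eq_norm_sq]
  simp only [inner_add_left, inner_add_right, real_inner_smul_left, real_inner_smul_right,
    inner_frame]
  simp; ring

theorem inner_frame_axis (c₀ c₁ c₂ a : ℝ) :
    (inner ℝ (c₀ • e 0 + c₁ • e 1 + c₂ • e 2) (a • e 2) : ℝ) = a * c₂ := by
  simp only [inner_add_left, real_inner_smul_left, real_inner_smul_right, inner_frame]
  simp

theorem exists_frame {y : Space} (hy : y ≠ 0) :
    ∃ e : OrthonormalBasis (Fin 3) ℝ Space, y = ‖y‖ • e 2 := by
  obtain ⟨b, hb⟩ := Orthonormal.exists_orthonormalBasis_extension_of_card_eq (𝕜 := ℝ) (E := Space)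
    (ι := Fin 3) (by simp) (v := fun _ => ‖y‖⁻¹ • y) (s := {2}) (by
      rw [orthonormal_subsingleton_iff]
      intro i
      simp [norm_smul, hy])
  refine ⟨b, ?_⟩
  rw [hb 2 rfl, smul_smul, mul_inv_cancel₀ (norm_ne_zero_iff.2 hy), one_smul]

end Frame

theorem integrableOn_abs_rpow_neg_half (R : ℝ) :
    IntegrableOn (fun s : ℝ => |s| ^ (-(1 / 2) : ℝ)) (Icc (-R) R) := by
  have h0 : ∀ b : ℝ, 0 ≤ b → IntervalIntegrable (fun s : ℝ => |s| ^ (-(1 / 2) : ℝ)) volume 0 b := by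
    intro b hb
    refine (intervalIntegral.intervalIntegrable_rpow' (a := 0) (b := b)
      (r := -(1 / 2)) (by norm_num)).congr ?_
    intro s hs
    rw [uIoc_of_le hb] at hs
    simp only [abs_of_pos hs.1]
  rcases le_or_gt 0 R with hR | hR
  · have h1 := h0 R hR
    have h2 : IntervalIntegrable (fun s : ℝ => |s| ^ (-(1 / 2) : ℝ)) volume 0 (-R) := by
      simpa using (IntervalIntegrable.iff_comp_neg).1 h1
    have h3 := h2.symm.trans h1
    rwa [intervalIntegrable_iff_integrableOn_Icc_of_le (by linarith)] at h3
  · rw [Icc_eq_empty (by linarith)]; exact integrableOn_empty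

/-- The inverse complex distance is bounded by a multiple of `|x · y|^(-1/2)`, because `r̃²` has
imaginary part `-2 x · y`. -/
theorem inv_norm_complexDist_le {y x : Space} (h : inner ℝ x y ≠ (0 : ℝ)) :
    ‖complexDist y x‖⁻¹ ≤ |(inner ℝ x y : ℝ)| ^ (-(1 / 2) : ℝ) := by
  have h1 : |(inner ℝ x y : ℝ)| ≤ ‖complexDist y x‖ ^ 2 := by
    rw [norm_complexDist_sq, ← abs_neg, ← complexDist_re_mul_im, abs_le]
    constructor <;> nlinarith [sq_nonneg ((complexDist y x).re + (complexDist y x).im),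
      sq_nonneg ((complexDist y x).re - (complexDist y x).im), sq_nonneg (complexDist y x).re,
      sq_nonneg (complexDist y x).im]
  have h0 : 0 < |(inner ℝ x y : ℝ)| := abs_pos.2 h
  rw [Real.rpow_neg h0.le, ← Real.sqrt_eq_rpow]
  apply inv_anti₀ (Real.sqrt_pos.2 h0)
  rw [Real.sqrt_le_left (norm_nonneg _)]
  exact h1

/-- The inverse complex distance is locally integrable, across the branch disk and the focal
circle. -/
theorem locallyIntegrable_inv_norm_complexDist {y : Space} (hy : y ≠ 0) :
    LocallyIntegrable fun x => ‖complexDist y x‖⁻¹ := by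
  obtain ⟨e, he⟩ := exists_frame hy
  have ha : 0 < ‖y‖ := norm_pos_iff.2 hy
  rw [locallyIntegrable_iff]
  intro K hK
  obtain ⟨R, hR⟩ := hK.isBounded.subset_closedBall (0 : Space)
  refine IntegrableOn.mono_set ?_ hR
  rw [← integrable_indicator_iff measurableSet_closedBall,
    ← (measurePreserving_frameEquiv e).integrable_comp_emb (frameEquiv e).measurableEmbedding]
  let g : Fin 3 → ℝ → ℝ := fun i => if i = 2 then
      (Icc (-R) R).indicator (fun s => ‖y‖ ^ (-(1 / 2) : ℝ) * |s| ^ (-(1 / 2) : ℝ))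
    else (Icc (-R) R).indicator (fun _ => 1)
  have hg : Integrable (fun c : Fin 3 → ℝ => ∏ i, g i (c i)) := by
    apply Integrable.fintype_prod
    intro i
    by_cases hi : i = 2
    · simp only [g, hi, if_true]
      rw [integrable_indicator_iff measurableSet_Icc]
      exact (integrableOn_abs_rpow_neg_half R).const_mul _
    · simp only [g, hi, if_false]
      rw [integrable_indicator_iff measurableSet_Icc]
      exact integrableOn_const (by simp)
  have hnull : ∀ᵐ c : Fin 3 → ℝ, c 2 ≠ 0 := by
    rw [ae_iff]
    simpa [volume_pi] using Measure.pi_hyperplane (fun _ : Fin 3 => (volume : Measure ℝ)) 2 0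
  refine hg.mono' ?_ ?_
  · apply Measurable.aestronglyMeasurable
    exact (((measurable_complexDist y).norm.inv).indicator measurableSet_closedBall).comp
      (frameEquiv e).measurable
  · filter_upwards [hnull] with c hc
    rw [Function.comp_apply]
    by_cases hmem : frameEquiv e c ∈ Metric.closedBall (0 : Space) R
    · rw [indicator_of_mem hmem, norm_inv, norm_norm]
      rw [mem_closedBall_zero_iff] at hmem
      have hR0 : 0 ≤ R := (norm_nonneg _).trans hmem
      have hsq : c 0 ^ 2 + c 1 ^ 2 + c 2 ^ 2 ≤ R ^ 2 := by
        rw [← norm_sq_frame e, ← frameEquiv_apply]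
        exact pow_le_pow_left₀ (norm_nonneg _) hmem 2
      have hci : ∀ i, c i ∈ Icc (-R) R := by
        intro i
        rw [mem_Icc, ← abs_le]
        apply abs_le_of_sq_le_sq _ hR0
        fin_cases i <;> simp only [Fin.zero_eta, Fin.mk_one, Fin.reduceFinMk] <;>
          nlinarith [sq_nonneg (c 0), sq_nonneg (c 1), sq_nonneg (c 2)]
      have hin : (inner ℝ (frameEquiv e c) y : ℝ) = ‖y‖ * c 2 := by
        rw [frameEquiv_apply]
        conv_lhs => rw [he]
        exact inner_frame_axis e _ _ _ _
      have hb := inv_norm_complexDist_le (y := y) (x := frameEquiv e c)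
        (by rw [hin]; exact mul_ne_zero ha.ne' hc)
      rw [hin, abs_mul, abs_of_pos ha, Real.mul_rpow ha.le (abs_nonneg _)] at hb
      rw [Fin.prod_univ_three]
      simpa [g, hci] using hb
    · rw [indicator_of_notMem hmem, norm_zero]
      apply Finset.prod_nonneg
      intro i _
      simp only [g]
      split_ifs <;> exact indicator_nonneg (fun s _ => by positivity) _

/-! ### Estimates for the shielded beams -/

section Beam

variable {y : Space} {u : ℝ} {g : ℂ → ℂ}

theorem isOpen_im_ne_zero : IsOpen {τ : ℂ | τ.im ≠ 0} :=
  isOpen_ne_fun Complex.continuous_im continuous_const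

theorem differentiableOn_deriv_im_ne_zero (hg : DifferentiableOn ℂ g {τ | τ.im ≠ 0}) :
    DifferentiableOn ℂ (deriv g) {τ | τ.im ≠ 0} :=
  hg.deriv isOpen_im_ne_zero

theorem abs_im_retarded_ge (x : Space) (t : ℝ) :
    |u| - ‖y‖ ≤ |((t : ℂ) - u * I - complexDist y x).im| := by
  have h1 := abs_complexDist_im_le y x
  have h2 : ((t : ℂ) - u * I - complexDist y x).im = -(u + (complexDist y x).im) := by
    simp; ring
  rw [h2, abs_neg]
  have h3 := abs_sub_abs_le_abs_sub u (-(complexDist y x).im)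
  rw [abs_neg, sub_neg_eq_add] at h3
  linarith

theorem im_retarded_ne_zero (hu : ‖y‖ < |u|) (x : Space) (t : ℝ) :
    ((t : ℂ) - u * I - complexDist y x).im ≠ 0 := by
  have := abs_im_retarded_ge (y := y) (u := u) x t
  exact abs_pos.1 (by linarith)

/-- On bounded sets the shielded beams are dominated by the inverse complex distance, uniformly in
the shielding parameter. -/
theorem exists_norm_shieldedBeam_le (hu : ‖y‖ < |u|) (hg : DifferentiableOn ℂ g {τ | τ.im ≠ 0})
    (R : ℝ) : ∃ C : ℝ, 0 ≤ C ∧ ∀ (x : Space) (t ε : ℝ), ‖x‖ ≤ R → |t| ≤ R →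
      ‖shieldedBeam g y u ε (x, t)‖ ≤ C * ‖complexDist y x‖⁻¹ := by
  let K : Set ℂ := Metric.closedBall 0 (R + |u| + (R + ‖y‖)) ∩ {z | |u| - ‖y‖ ≤ |z.im|}
  have hK : IsCompact K := (isCompact_closedBall _ _).inter_right
    (isClosed_le continuous_const (Complex.continuous_im.abs))
  have hKs : K ⊆ {τ | τ.im ≠ 0} := fun z hz => abs_pos.1 (lt_of_lt_of_le (by linarith) hz.2)
  obtain ⟨C, hC⟩ := hK.exists_bound_of_continuousOn (hg.continuousOn.mono hKs)
  refine ⟨max C 0 / (4 * Real.pi), by positivity, fun x t ε hx ht => ?_⟩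
  have hmem : (t : ℂ) - u * I - complexDist y x ∈ K := by
    refine ⟨?_, abs_im_retarded_ge x t⟩
    rw [mem_closedBall_zero_iff]
    have h1 := norm_complexDist_le y x
    have h2 : ‖(t : ℂ) - u * I‖ ≤ |t| + |u| := by
      refine (norm_sub_le _ _).trans ?_
      simp
    have h3 := norm_sub_le ((t : ℂ) - u * I) (complexDist y x)
    linarith
  unfold shieldedBeam
  split_ifs
  · simp only [beam, norm_div, norm_mul, norm_ofNat, norm_real, Real.norm_eq_abs,
      abs_of_pos Real.pi_pos]
    rw [div_mul_eq_mul_div, ← div_eq_mul_inv, div_div, mul_comm ‖complexDist y x‖]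
    gcongr
    exact (hC _ hmem).trans (le_max_left _ _)
  · rw [norm_zero]; positivity

theorem measurable_shieldedBeam (hu : ‖y‖ < |u|) (hg : DifferentiableOn ℂ g {τ | τ.im ≠ 0})
    (ε : ℝ) : Measurable (shieldedBeam g y u ε) := by
  classical
  have hS : MeasurableSet {τ : ℂ | τ.im ≠ 0} := isOpen_im_ne_zero.measurableSet
  have hm : Measurable ({τ : ℂ | τ.im ≠ 0}.piecewise g 0) :=
    hg.continuousOn.measurable_piecewise continuousOn_const hS
  have hr : Measurable fun z : Spacetime => complexDist y z.1 :=
    (measurable_complexDist y).comp measurable_fst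
  have e : shieldedBeam g y u ε = fun z : Spacetime =>
      if ε * ‖y‖ < (complexDist y z.1).re then
        {τ : ℂ | τ.im ≠ 0}.piecewise g 0 ((z.2 : ℂ) - u * I - complexDist y z.1)
          / (4 * Real.pi * complexDist y z.1) else 0 := by
    funext z
    rw [shieldedBeam, beam, piecewise_eq_of_mem _ _ _ (im_retarded_ne_zero hu z.1 z.2)]
  rw [e]
  refine Measurable.ite ?_ ?_ measurable_const
  · exact measurableSet_lt measurable_const (Complex.measurable_re.comp hr)
  · refine (hm.comp ?_).div (hr.const_mul _)
    exact (((Complex.measurable_ofReal.comp measurable_snd).sub_const _).sub hr)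

theorem locallyIntegrable_shieldedBeam (hy : y ≠ 0) (hu : ‖y‖ < |u|)
    (hg : DifferentiableOn ℂ g {τ | τ.im ≠ 0}) (ε : ℝ) :
    LocallyIntegrable (shieldedBeam g y u ε) := by
  rw [locallyIntegrable_iff]
  intro K hK
  obtain ⟨R, hR⟩ := hK.isBounded.subset_closedBall (0 : Spacetime)
  refine IntegrableOn.mono_set ?_ hR
  obtain ⟨C, hC0, hC⟩ := exists_norm_shieldedBeam_le hu hg R
  have hball : Metric.closedBall (0 : Spacetime) R
      = Metric.closedBall (0 : Space) R ×ˢ Metric.closedBall (0 : ℝ) R := by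
    rw [closedBall_prod_same]; rfl
  have hint : IntegrableOn (fun z : Spacetime => C * ‖complexDist y z.1‖⁻¹)
      (Metric.closedBall (0 : Spacetime) R) := by
    rw [hball, IntegrableOn, Measure.volume_eq_prod, ← Measure.prod_restrict]
    have h1 := ((locallyIntegrable_inv_norm_complexDist hy).integrableOn_isCompact
      (isCompact_closedBall 0 R)).const_mul C
    have h2 : IntegrableOn (fun _ : ℝ => (1 : ℝ)) (Metric.closedBall (0 : ℝ) R) :=
      integrableOn_const (measure_closedBall_lt_top).ne
    have := h1.mul_prod h2
    simpa using this
  refine hint.mono' (measurable_shieldedBeam hu hg ε).aestronglyMeasurable ?_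
  refine ae_restrict_of_forall_mem measurableSet_closedBall fun z hz => ?_
  rw [hball] at hz
  exact hC z.1 z.2 ε (by simpa using hz.1) (by simpa using hz.2)

theorem locallyIntegrable_shieldedBeam_slice (hy : y ≠ 0) (hu : ‖y‖ < |u|)
    (hg : DifferentiableOn ℂ g {τ | τ.im ≠ 0}) (ε t : ℝ) :
    LocallyIntegrable fun x => shieldedBeam g y u ε (x, t) := by
  rw [locallyIntegrable_iff]
  intro K hK
  obtain ⟨R, hR⟩ := hK.isBounded.subset_closedBall (0 : Space)
  obtain ⟨C, hC0, hC⟩ := exists_norm_shieldedBeam_le hu hg (max R |t|)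
  have hint := ((locallyIntegrable_inv_norm_complexDist hy).integrableOn_isCompact hK).const_mul C
  refine hint.mono' ((measurable_shieldedBeam hu hg ε).comp
    measurable_prodMk_right).aestronglyMeasurable ?_
  refine ae_restrict_of_forall_mem hK.measurableSet fun x hx => ?_
  exact hC x t ε ((mem_closedBall_zero_iff.1 (hR hx)).trans (le_max_left _ _)) (le_max_right _ _)

theorem hasDerivAt_shieldedBeam (hu : ‖y‖ < |u|) (hg : DifferentiableOn ℂ g {τ | τ.im ≠ 0})
    (ε : ℝ) (x : Space) (t : ℝ) :
    HasDerivAt (fun s : ℝ => shieldedBeam g y u ε (x, s))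
      (shieldedBeam (deriv g) y u ε (x, t)) t := by
  unfold shieldedBeam
  dsimp only
  split_ifs
  · have h1 := (hg.differentiableAt (isOpen_im_ne_zero.mem_nhds
      (im_retarded_ne_zero hu x t))).hasDerivAt
    have h2 : HasDerivAt (fun s : ℝ => (s : ℂ) - u * I - complexDist y x) 1 t :=
      ((hasDerivAt_id (t : ℂ)).comp_ofReal.sub_const _).sub_const _
    have h3 := h1.comp t h2
    simp only [mul_one] at h3
    exact h3.div_const _
  · exact hasDerivAt_const _ _

theorem iteratedDeriv_two_shieldedBeam (hu : ‖y‖ < |u|)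
    (hg : DifferentiableOn ℂ g {τ | τ.im ≠ 0}) (ε : ℝ) (x : Space) (t : ℝ) :
    iteratedDeriv 2 (fun s => shieldedBeam g y u ε (x, s)) t
      = shieldedBeam (deriv (deriv g)) y u ε (x, t) := by
  rw [iteratedDeriv_succ, iteratedDeriv_one]
  have : deriv (fun s => shieldedBeam g y u ε (x, s))
      = fun s => shieldedBeam (deriv g) y u ε (x, s) :=
    funext fun s => (hasDerivAt_shieldedBeam hu hg ε x s).deriv
  rw [this]
  exact (hasDerivAt_shieldedBeam hu (differentiableOn_deriv_im_ne_zero hg) ε x t).deriv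

theorem integrable_test_smul_slice (hy : y ≠ 0) (hu : ‖y‖ < |u|)
    (hg : DifferentiableOn ℂ g {τ | τ.im ≠ 0}) (ε t : ℝ) (f : SpaceTest) :
    Integrable fun x => f x • shieldedBeam g y u ε (x, t) :=
  f.integrable_bilin (ContinuousLinearMap.lsmul ℝ ℝ)
    ((locallyIntegrable_shieldedBeam_slice hy hu hg ε t).locallyIntegrableOn _)

theorem integrable_test_smul (hy : y ≠ 0) (hu : ‖y‖ < |u|)
    (hg : DifferentiableOn ℂ g {τ | τ.im ≠ 0}) (ε : ℝ) (φ : SpacetimeTest) :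
    Integrable fun z => φ z • shieldedBeam g y u ε z :=
  φ.integrable_bilin (ContinuousLinearMap.lsmul ℝ ℝ)
    ((locallyIntegrable_shieldedBeam hy hu hg ε).locallyIntegrableOn _)

/-- A test function times the inverse complex distance is integrable. -/
theorem integrable_norm_mul_inv_norm_complexDist (hy : y ≠ 0) (f : SpaceTest) :
    Integrable fun x => ‖f x‖ * ‖complexDist y x‖⁻¹ := by
  have := (f.integrable_bilin (ContinuousLinearMap.lsmul ℝ ℝ) (μ := volume)
    ((locallyIntegrable_inv_norm_complexDist hy).locallyIntegrableOn _)).norm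
  refine this.congr (Eventually.of_forall fun x => ?_)
  simp

theorem exists_norm_le_of_test (f : SpaceTest) : ∃ R : ℝ, 0 ≤ R ∧ ∀ x, f x ≠ 0 → ‖x‖ ≤ R := by
  obtain ⟨R, hR⟩ := f.hasCompactSupport.isBounded.subset_closedBall (0 : Space)
  refine ⟨max R 0, le_max_right _ _, fun x hx => ?_⟩
  exact (mem_closedBall_zero_iff.1 (hR (subset_tsupport _ hx))).trans (le_max_left _ _)

/-- Near any time, the smeared beams are dominated by an integrable function of the position. -/
theorem exists_bound_test_smul_slice (hu : ‖y‖ < |u|)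
    (hg : DifferentiableOn ℂ g {τ | τ.im ≠ 0}) (f : SpaceTest) (T : ℝ) :
    ∃ C : ℝ, ∀ (x : Space) (t ε : ℝ), |t| ≤ T →
      ‖f x • shieldedBeam g y u ε (x, t)‖ ≤ C * (‖f x‖ * ‖complexDist y x‖⁻¹) := by
  obtain ⟨R, hR0, hR⟩ := exists_norm_le_of_test f
  obtain ⟨C, hC0, hC⟩ := exists_norm_shieldedBeam_le hu hg (max R T)
  refine ⟨C, fun x t ε ht => ?_⟩
  by_cases hx : f x = 0
  · simp [hx]
  · rw [norm_smul, mul_left_comm]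
    gcongr
    exact hC x t ε ((hR x hx).trans (le_max_left _ _)) (ht.trans (le_max_right _ _))

theorem hasDerivAt_integral_test_smul_slice (hy : y ≠ 0) (hu : ‖y‖ < |u|)
    (hg : DifferentiableOn ℂ g {τ | τ.im ≠ 0}) (ε : ℝ) (f : SpaceTest) (t : ℝ) :
    HasDerivAt (fun s => ∫ x, f x • shieldedBeam g y u ε (x, s))
      (∫ x, f x • shieldedBeam (deriv g) y u ε (x, t)) t := by
  have hg' := differentiableOn_deriv_im_ne_zero hg
  obtain ⟨C, hC⟩ := exists_bound_test_smul_slice hu hg' f (|t| + 1)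
  refine (hasDerivAt_integral_of_dominated_loc_of_deriv_le (Metric.ball_mem_nhds t one_pos)
    (Eventually.of_forall fun s => (integrable_test_smul_slice hy hu hg ε s f).1)
    (integrable_test_smul_slice hy hu hg ε t f)
    (F' := fun s x => f x • shieldedBeam (deriv g) y u ε (x, s))
    (integrable_test_smul_slice hy hu hg' ε t f).1
    (bound := fun x => C * (‖f x‖ * ‖complexDist y x‖⁻¹)) ?_ ?_ ?_).2
  · refine Eventually.of_forall fun x s hs => hC x s ε ?_
    have h1 : |s - t| < 1 := by simpa [Real.dist_eq] using hs
    have h2 := abs_sub_abs_le_abs_sub s t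
    linarith
  · exact (integrable_norm_mul_inv_norm_complexDist hy f).const_mul C
  · exact Eventually.of_forall fun x s _ => (hasDerivAt_shieldedBeam hu hg ε x s).const_smul (f x)

theorem contDiff_integral_test_smul_slice (hy : y ≠ 0) (hu : ‖y‖ < |u|)
    (hg : DifferentiableOn ℂ g {τ | τ.im ≠ 0}) (ε : ℝ) (f : SpaceTest) :
    ContDiff ℝ ∞ fun t => ∫ x, f x • shieldedBeam g y u ε (x, t) := by
  rw [contDiff_infty]
  intro n
  induction n generalizing g with
  | zero =>
    exact contDiff_zero.2 (continuous_iff_continuousAt.2 fun t =>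
      (hasDerivAt_integral_test_smul_slice hy hu hg ε f t).continuousAt)
  | succ n ih =>
    rw [Nat.cast_succ, contDiff_succ_iff_deriv]
    refine ⟨fun t => (hasDerivAt_integral_test_smul_slice hy hu hg ε f t).differentiableAt,
      by simp, ?_⟩
    rw [funext fun t => (hasDerivAt_integral_test_smul_slice hy hu hg ε f t).deriv]
    exact ih (differentiableOn_deriv_im_ne_zero hg)

theorem tendsto_shieldedBeam (hy : y ≠ 0) (z : Spacetime) :
    Tendsto (fun ε => shieldedBeam g y u ε z) (𝓝[>] 0) (𝓝 (shieldedBeam g y u 0 z)) := by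
  have ha : 0 < ‖y‖ := norm_pos_iff.2 hy
  refine tendsto_const_nhds.congr' ?_
  by_cases hp : 0 < (complexDist y z.1).re
  · filter_upwards [Ioo_mem_nhdsGT (div_pos hp ha)] with ε hε
    have : ε * ‖y‖ < (complexDist y z.1).re := (lt_div_iff₀ ha).1 hε.2
    simp [shieldedBeam, hp, this]
  · filter_upwards [self_mem_nhdsWithin] with ε hε
    have h0 : 0 < ε * ‖y‖ := mul_pos hε ha
    have : ¬ ε * ‖y‖ < (complexDist y z.1).re := by linarith
    simp [shieldedBeam, hp, this]

theorem tendsto_integral_test_smul_slice (hy : y ≠ 0) (hu : ‖y‖ < |u|)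
    (hg : DifferentiableOn ℂ g {τ | τ.im ≠ 0}) (t : ℝ) (f : SpaceTest) :
    Tendsto (fun ε => ∫ x, f x • shieldedBeam g y u ε (x, t)) (𝓝[>] 0)
      (𝓝 (∫ x, f x • shieldedBeam g y u 0 (x, t))) := by
  obtain ⟨C, hC⟩ := exists_bound_test_smul_slice hu hg f |t|
  refine tendsto_integral_filter_of_dominated_convergence
    (fun x => C * (‖f x‖ * ‖complexDist y x‖⁻¹))
    (Eventually.of_forall fun ε => (integrable_test_smul_slice hy hu hg ε t f).1)
    (Eventually.of_forall fun ε => Eventually.of_forall fun x => hC x t ε le_rfl)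
    ((integrable_norm_mul_inv_norm_complexDist hy f).const_mul C)
    (Eventually.of_forall fun x => (tendsto_shieldedBeam hy (x, t)).const_smul (f x))

theorem tendsto_integral_test_smul (hy : y ≠ 0) (hu : ‖y‖ < |u|)
    (hg : DifferentiableOn ℂ g {τ | τ.im ≠ 0}) (φ : SpacetimeTest) :
    Tendsto (fun ε => ∫ z, φ z • shieldedBeam g y u ε z) (𝓝[>] 0)
      (𝓝 (∫ z, φ z • shieldedBeam g y u 0 z)) := by
  -- the unshielded beam itself dominates all the shielded ones
  refine tendsto_integral_filter_of_dominated_convergence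
    (fun z => ‖φ z • shieldedBeam g y u 0 z‖)
    (Eventually.of_forall fun ε => (integrable_test_smul hy hu hg ε φ).1)
    ?_ (integrable_test_smul hy hu hg 0 φ).norm
    (Eventually.of_forall fun z => (tendsto_shieldedBeam hy z).const_smul (φ z))
  filter_upwards [self_mem_nhdsWithin] with ε hε
  refine Eventually.of_forall fun z => ?_
  rw [norm_smul, norm_smul]
  gcongr
  have h0 : 0 ≤ ε * ‖y‖ := mul_nonneg (le_of_lt hε) (norm_nonneg y)
  by_cases h : ε * ‖y‖ < (complexDist y z.1).re
  · have : 0 < (complexDist y z.1).re := h0.trans_lt h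
    simp [shieldedBeam, h, this]
  · simp [shieldedBeam, h]

end Beam

/-! ### The shielded sources as distributions -/

section Source

variable {y : Space} {u : ℝ} {g : ℂ → ℂ}

/-- Local integrability matters: the distribution of a function which is not locally integrable is
zero by convention. -/
theorem distOfSpaceFun_apply {w : Space → ℂ} (hw : LocallyIntegrable w) (f : SpaceTest) :
    distOfSpaceFun w f = ∫ x, f x • w x :=
  TestFunction.integralAgainstBilinCLM_eq_integral (hw.locallyIntegrableOn _)

theorem distOfSpacetimeFun_apply {w : Spacetime → ℂ} (hw : LocallyIntegrable w)
    (φ : SpacetimeTest) : distOfSpacetimeFun w φ = ∫ z, φ z • w z :=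
  TestFunction.integralAgainstBilinCLM_eq_integral (hw.locallyIntegrableOn _)

/-- The Laplacian of a spatial test function. -/
noncomputable def testLaplacian (f : SpaceTest) : SpaceTest :=
  ∑ i : Fin 3, ∂_{EuclideanSpace.single i (1 : ℝ)} (∂_{EuclideanSpace.single i (1 : ℝ)} f)

/-- The spatial Laplacian of a test function on spacetime. -/
noncomputable def testSpatialLaplacian (φ : SpacetimeTest) : SpacetimeTest :=
  ∑ i : Fin 3, ∂_{((EuclideanSpace.single i (1 : ℝ), 0) : Spacetime)}
      (∂_{((EuclideanSpace.single i (1 : ℝ), 0) : Spacetime)} φ)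

theorem test_lineDeriv_apply {E : Type*} [NormedAddCommGroup E] [NormedSpace ℝ E]
    (f : 𝓓((⊤ : Opens E), ℝ)) (v x : E) : (∂_{v} f : 𝓓((⊤ : Opens E), ℝ)) x = fderiv ℝ f x v := by
  rw [TestFunction.lineDerivOp_eq_lineDerivCLM ℝ, TestFunction.lineDerivCLM_apply_of_le (by simp)]
  exact ((f.contDiff.differentiable (by simp)) x).lineDeriv_eq_fderiv

theorem slice_lineDeriv (φ : SpacetimeTest) (v : Space) (t : ℝ) :
    (∂_{v} (slice φ t) : SpaceTest) = slice (∂_{((v, 0) : Spacetime)} φ) t := by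
  ext x
  rw [test_lineDeriv_apply]
  change _ = (∂_{((v, 0) : Spacetime)} φ : SpacetimeTest) (x, t)
  rw [test_lineDeriv_apply]
  have h1 : HasFDerivAt (fun x : Space => φ (x, t))
      ((fderiv ℝ φ (x, t)).comp (ContinuousLinearMap.inl ℝ Space ℝ)) x :=
    ((φ.contDiff.differentiable (by simp)) (x, t)).hasFDerivAt.comp x (hasFDerivAt_prodMk_left x t)
  change fderiv ℝ (fun x : Space => φ (x, t)) x v = _
  rw [h1.fderiv]
  simp

theorem testLaplacian_slice_apply (φ : SpacetimeTest) (t : ℝ) (x : Space) :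
    testLaplacian (slice φ t) x = testSpatialLaplacian φ (x, t) := by
  simp only [testLaplacian, testSpatialLaplacian, slice_lineDeriv, Fin.sum_univ_three]
  rfl

theorem distLaplacian_apply (T : SpaceDistribution) (f : SpaceTest) :
    distLaplacian T f = T (testLaplacian f) := by
  simp only [distLaplacian, testLaplacian, Fin.sum_univ_three, map_add, _root_.add_apply,
    Distribution.lineDerivOp_apply_apply]
  simp [LineDeriv.lineDerivOp_neg]

theorem distBox_apply (T : SpacetimeDistribution) (φ : SpacetimeTest) :
    distBox T φ = T (testSpatialLaplacian φ)
      - T (∂_{((0, 1) : Spacetime)} (∂_{((0, 1) : Spacetime)} φ)) := by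
  simp only [distBox, testSpatialLaplacian, Fin.sum_univ_three, map_add, _root_.add_apply,
    _root_.sub_apply, Distribution.lineDerivOp_apply_apply]
  simp [LineDeriv.lineDerivOp_neg]

theorem shieldedSourceAt_apply (hy : y ≠ 0) (hu : ‖y‖ < |u|)
    (hg : DifferentiableOn ℂ g {τ | τ.im ≠ 0}) (ε t : ℝ) (f : SpaceTest) :
    shieldedSourceAt g y u ε t f =
      -(∫ x, testLaplacian f x • shieldedBeam g y u ε (x, t))
        + ∫ x, f x • shieldedBeam (deriv (deriv g)) y u ε (x, t) := by
  have hg' := differentiableOn_deriv_im_ne_zero (differentiableOn_deriv_im_ne_zero hg)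
  simp only [shieldedSourceAt, iteratedDeriv_two_shieldedBeam hu hg, _root_.neg_apply,
    _root_.sub_apply, distLaplacian_apply]
  rw [distOfSpaceFun_apply (locallyIntegrable_shieldedBeam_slice hy hu hg ε t),
    distOfSpaceFun_apply (locallyIntegrable_shieldedBeam_slice hy hu hg' ε t)]
  ring

theorem shieldedSource_apply (hy : y ≠ 0) (hu : ‖y‖ < |u|)
    (hg : DifferentiableOn ℂ g {τ | τ.im ≠ 0}) (ε : ℝ) (φ : SpacetimeTest) :
    shieldedSource g y u ε φ =
      -(∫ z, testSpatialLaplacian φ z • shieldedBeam g y u ε z)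
        + ∫ z, (∂_{((0, 1) : Spacetime)} (∂_{((0, 1) : Spacetime)} φ) : SpacetimeTest) z
            • shieldedBeam g y u ε z := by
  simp only [shieldedSource, _root_.neg_apply, distBox_apply]
  rw [distOfSpacetimeFun_apply (locallyIntegrable_shieldedBeam hy hu hg ε),
    distOfSpacetimeFun_apply (locallyIntegrable_shieldedBeam hy hu hg ε)]
  ring

/-- Time derivatives fall on the driving function `g`, because the shield does not depend on
time. -/
theorem integral_timeDeriv_smul (hy : y ≠ 0) (hu : ‖y‖ < |u|)
    (hg : DifferentiableOn ℂ g {τ | τ.im ≠ 0}) (ε : ℝ) (φ : SpacetimeTest) :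
    ∫ z, (∂_{((0, 1) : Spacetime)} φ : SpacetimeTest) z • shieldedBeam g y u ε z
      = -∫ z, φ z • shieldedBeam (deriv g) y u ε z := by
  have hg' := differentiableOn_deriv_im_ne_zero hg
  have : (volume : Measure Spacetime).IsAddHaarMeasure := by
    rw [Measure.volume_eq_prod]; infer_instance
  have key := integral_bilinear_hasLineDerivAt_right_eq_neg_left_of_integrable (μ := volume)
    (B := ContinuousLinearMap.lsmul ℝ ℝ) (v := ((0, 1) : Spacetime))
    (f := φ) (f' := (∂_{((0, 1) : Spacetime)} φ : SpacetimeTest))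
    (g := shieldedBeam g y u ε) (g' := shieldedBeam (deriv g) y u ε)
    (integrable_test_smul hy hu hg ε _) (integrable_test_smul hy hu hg' ε _)
    (integrable_test_smul hy hu hg ε _) (fun z _ => ?_) (fun z _ => ?_)
  · simp only [ContinuousLinearMap.lsmul_apply] at key
    rw [key, neg_neg]
  · rw [test_lineDeriv_apply]
    exact ((φ.contDiff.differentiable (by simp)) z).hasFDerivAt.hasLineDerivAt _
  · obtain ⟨x, t⟩ := z
    have h := hasDerivAt_shieldedBeam hu hg ε x t
    rw [← add_zero t] at h
    have := HasDerivAt.comp_const_add t 0 h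
    simpa [HasLineDerivAt] using this

/-- The time derivatives in `□` are integrated by parts onto the smooth time dependence of the beam,
which leaves an integral over the time slices. -/
theorem isRegularInTime_shieldedSource (hy : y ≠ 0) (hu : ‖y‖ < |u|)
    (hg : DifferentiableOn ℂ g {τ | τ.im ≠ 0}) (ε : ℝ) :
    IsRegularInTime (shieldedSource g y u ε) (shieldedSourceAt g y u ε) := by
  have hg' := differentiableOn_deriv_im_ne_zero hg
  have hg'' := differentiableOn_deriv_im_ne_zero hg'
  have hslice : ∀ (φ : SpacetimeTest) (t : ℝ), shieldedSourceAt g y u ε t (slice φ t)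
      = -(∫ x, testSpatialLaplacian φ (x, t) • shieldedBeam g y u ε (x, t))
        + ∫ x, φ (x, t) • shieldedBeam (deriv (deriv g)) y u ε (x, t) := by
    intro φ t
    rw [shieldedSourceAt_apply hy hu hg]
    simp only [testLaplacian_slice_apply]
    rfl
  have hint : ∀ (φ : SpacetimeTest) (h : ℂ → ℂ), DifferentiableOn ℂ h {τ | τ.im ≠ 0} →
      Integrable (fun t => ∫ x, φ (x, t) • shieldedBeam h y u ε (x, t)) ∧
      ∫ t, ∫ x, φ (x, t) • shieldedBeam h y u ε (x, t) = ∫ z, φ z • shieldedBeam h y u ε z := by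
    intro φ h hh
    have := integrable_test_smul hy hu hh ε φ
    rw [Measure.volume_eq_prod] at this
    refine ⟨this.integral_prod_right, ?_⟩
    rw [Measure.volume_eq_prod, integral_prod_symm _ this]
  refine ⟨fun f => ?_, fun φ => ?_, fun φ => ?_⟩
  · simp only [shieldedSourceAt_apply hy hu hg]
    exact (contDiff_integral_test_smul_slice hy hu hg ε _).neg.add
      (contDiff_integral_test_smul_slice hy hu hg'' ε _)
  · simp only [hslice]
    exact (hint _ g hg).1.neg.add (hint _ _ hg'').1
  · simp only [hslice]
    have h1 := integral_add (hint (testSpatialLaplacian φ) g hg).1.neg (hint φ _ hg'').1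
    simp only [Pi.neg_apply] at h1
    rw [h1, integral_neg, (hint _ g hg).2, (hint _ _ hg'').2, shieldedSource_apply hy hu hg,
      integral_timeDeriv_smul hy hu hg, integral_timeDeriv_smul hy hu hg', neg_neg]

/-- As the shield shrinks the shielded beams converge to the unshielded one with an integrable
majorant, so that `S_ε` tends to `-□ W_0`. -/
theorem tendsto_shieldedSource (hy : y ≠ 0) (hu : ‖y‖ < |u|)
    (hg : DifferentiableOn ℂ g {τ | τ.im ≠ 0}) (φ : SpacetimeTest) :
    Tendsto (fun ε => shieldedSource g y u ε φ) (𝓝[>] 0) (𝓝 (shieldedSource g y u 0 φ)) := by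
  simp only [shieldedSource_apply hy hu hg]
  exact (tendsto_integral_test_smul hy hu hg _).neg.add (tendsto_integral_test_smul hy hu hg _)

theorem tendsto_shieldedSourceAt (hy : y ≠ 0) (hu : ‖y‖ < |u|)
    (hg : DifferentiableOn ℂ g {τ | τ.im ≠ 0}) (t : ℝ) (f : SpaceTest) :
    Tendsto (fun ε => shieldedSourceAt g y u ε t f) (𝓝[>] 0)
      (𝓝 (shieldedSourceAt g y u 0 t f)) := by
  have hg'' := differentiableOn_deriv_im_ne_zero (differentiableOn_deriv_im_ne_zero hg)
  simp only [shieldedSourceAt_apply hy hu hg]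
  exact (tendsto_integral_test_smul_slice hy hu hg t _).neg.add
    (tendsto_integral_test_smul_slice hy hu hg'' t f)

end Source

/-! ### Green's identity with a cutoff in the oblate radius -/

section Green

variable {y : Space}

theorem test_lineDeriv_eq_zero (f : SpaceTest) (v : Space) {x : Space} (hx : x ∉ tsupport f) :
    (∂_{v} f : SpaceTest) x = 0 := by
  rw [test_lineDeriv_apply]
  have : fderiv ℝ f x = 0 :=
    image_eq_zero_of_notMem_tsupport fun h => hx (tsupport_fderiv_subset ℝ h)
  rw [this]; rfl

theorem tsupport_lineDeriv_subset (f : SpaceTest) (v : Space) :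
    tsupport (∂_{v} f : SpaceTest) ⊆ tsupport f :=
  closure_minimal (fun _ hx => by_contra fun h => hx (test_lineDeriv_eq_zero f v h))
    (isClosed_tsupport f)

theorem hasDerivAt_test_line (f : SpaceTest) (x v : Space) :
    HasDerivAt (fun s : ℝ => f (x + s • v)) ((∂_{v} f : SpaceTest) x) 0 := by
  rw [test_lineDeriv_apply]
  exact ((f.contDiff.differentiable (by simp)) x).hasFDerivAt.hasLineDerivAt v

theorem continuous_of_continuousOn_re_complexDist_pos {F : Space → ℂ} {δ : ℝ} (hδ : 0 < δ)
    (hF : ContinuousOn F {x | 0 < (complexDist y x).re})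
    (h0 : ∀ x, (complexDist y x).re < δ → F x = 0) : Continuous F := by
  rw [continuous_iff_continuousAt]
  intro x
  by_cases hx : 0 < (complexDist y x).re
  · exact hF.continuousAt ((isOpen_re_complexDist_pos y).mem_nhds hx)
  · have hev : ∀ᶠ x' in 𝓝 x, (complexDist y x').re < δ :=
      (continuous_complexDist_re y).continuousAt.eventually_lt continuousAt_const (by linarith)
    exact continuousAt_const.congr (f := fun _ => (0 : ℂ))
      (hev.mono fun x' hx' => (h0 x' hx').symm)

/-- The integral of a directional derivative of an integrable function vanishes. -/
theorem integral_eq_zero_of_hasLineDerivAt {X D : Space → ℂ} {v : Space}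
    (hX : Integrable X) (hD : Integrable D) (h : ∀ x, HasLineDerivAt ℝ X (D x) x v) :
    ∫ x, D x = 0 := by
  have key := integral_bilinear_hasLineDerivAt_right_eq_neg_left_of_integrable
    (μ := (volume : Measure Space)) (B := ContinuousLinearMap.lsmul ℝ ℝ) (v := v)
    (f := fun _ => (1 : ℝ)) (f' := fun _ => 0) (g := X) (g' := D)
    (by simp) (by simpa using hD) (by simpa using hX)
    (fun x _ => (hasFDerivAt_const (1 : ℝ) x).hasLineDerivAt v) (fun x _ => h x)
  simpa using key

/-- The gradient `(p x + q y) / (p² + q²)` of the oblate radius `p = Re r̃`, where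
`q = -Im r̃`. -/
noncomputable def gradRadius (y x : Space) : Space :=
  (‖complexDist y x‖ ^ 2)⁻¹ • ((complexDist y x).re • x - (complexDist y x).im • y)

/-- The derivative `(x - iy) · v / r̃` of the complex distance in the direction `v`. -/
noncomputable def lineDerivDist (y v x : Space) : ℂ :=
  ((inner ℝ x v : ℝ) - I * (inner ℝ y v : ℝ)) / complexDist y x

theorem lineDerivDist_single (x : Space) (i : Fin 3) :
    lineDerivDist y (EuclideanSpace.single i 1) x = (x i - I * y i) / complexDist y x := by
  simp [lineDerivDist, EuclideanSpace.inner_single_right]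

theorem re_lineDerivDist (x v : Space) :
    (lineDerivDist y v x).re = inner ℝ (gradRadius y x) v := by
  rw [lineDerivDist, gradRadius, real_inner_smul_left, inner_sub_left, real_inner_smul_left,
    real_inner_smul_left, div_re, normSq_eq_norm_sq]
  simp
  ring

theorem norm_sq_eq_coords (x : Space) : ‖x‖ ^ 2 = x 0 ^ 2 + x 1 ^ 2 + x 2 ^ 2 := by
  rw [EuclideanSpace.norm_sq_eq, Fin.sum_univ_three]; simp

theorem inner_eq_coords (x z : Space) : (inner ℝ x z : ℝ) = x 0 * z 0 + x 1 * z 1 + x 2 * z 2 := by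
  rw [PiLp.inner_apply, Fin.sum_univ_three]; simp; ring

/-- The eikonal equation `∇r̃ · ∇r̃ = 1`, without complex conjugation. -/
theorem sum_lineDerivDist_sq {x : Space} (hx : complexDist y x ≠ 0) :
    ∑ i : Fin 3, lineDerivDist y (EuclideanSpace.single i 1) x ^ 2 = 1 := by
  simp only [lineDerivDist_single, Fin.sum_univ_three, div_pow]
  rw [← add_div, ← add_div, div_eq_one_iff_eq (pow_ne_zero 2 hx), complexDist_sq,
    norm_sq_eq_coords, norm_sq_eq_coords, inner_eq_coords]
  push_cast
  linear_combination (-(y 0 : ℂ) ^ 2 - (y 1 : ℂ) ^ 2 - (y 2 : ℂ) ^ 2) * (-I_sq)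

theorem sum_re_lineDerivDist_mul_lineDeriv (f : SpaceTest) (x : Space) :
    ∑ i : Fin 3, (lineDerivDist y (EuclideanSpace.single i 1) x).re
        * (∂_{(EuclideanSpace.single i (1 : ℝ) : Space)} f : SpaceTest) x
      = fderiv ℝ f x (gradRadius y x) := by
  have h : gradRadius y x = ∑ i : Fin 3, (gradRadius y x) i • EuclideanSpace.single i (1 : ℝ) := by
    have := (EuclideanSpace.basisFun (Fin 3) ℝ).sum_repr (gradRadius y x)
    simpa using this.symm
  conv_rhs => rw [h]
  rw [map_sum]
  refine Finset.sum_congr rfl fun i _ => ?_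
  rw [map_smul, test_lineDeriv_apply, re_lineDerivDist, EuclideanSpace.inner_single_right]
  simp

theorem re_lineDerivDist_single (x : Space) (i : Fin 3) :
    (lineDerivDist y (EuclideanSpace.single i 1) x).re = (‖complexDist y x‖ ^ 2)⁻¹
      * ((complexDist y x).re * x i - (complexDist y x).im * y i) := by
  rw [re_lineDerivDist, EuclideanSpace.inner_single_right]
  simp [gradRadius]

/-- `∇p · ∇r̃ = (p² + a²) / (p² + q²)`. -/
theorem sum_re_lineDerivDist_mul_self {x : Space} (hx : complexDist y x ≠ 0) :
    ∑ i : Fin 3, ((lineDerivDist y (EuclideanSpace.single i 1) x).re : ℂ)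
        * lineDerivDist y (EuclideanSpace.single i 1) x
      = (((complexDist y x).re ^ 2 + ‖y‖ ^ 2) / ‖complexDist y x‖ ^ 2 : ℝ) := by
  have hN : (‖complexDist y x‖ : ℂ) ≠ 0 := by simpa using hx
  have h1 := complexDist_re_sq_sub_im_sq y x
  have h2 := complexDist_re_mul_im y x
  rw [norm_sq_eq_coords x] at h1
  rw [inner_eq_coords] at h2
  have h3 := norm_sq_eq_coords y
  have h1c := congrArg (fun r : ℝ => (r : ℂ)) h1
  have h2c := congrArg (fun r : ℝ => (r : ℂ)) h2
  have h3c := congrArg (fun r : ℝ => (r : ℂ)) h3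
  have hre := re_add_im (complexDist y x)
  push_cast at h1c h2c h3c
  simp only [re_lineDerivDist_single, Fin.sum_univ_three]
  simp only [lineDerivDist_single]
  push_cast
  rw [mul_div_assoc', mul_div_assoc', mul_div_assoc', ← add_div, ← add_div, div_eq_iff hx]
  set p : ℂ := ((complexDist y x).re : ℂ)
  set m : ℂ := ((complexDist y x).im : ℂ)
  set N : ℂ := (‖complexDist y x‖ : ℂ)
  rw [← hre]
  field_simp
  linear_combination (-p) * h1c - (m + I * p) * h2c - I * m * h3c

end Green

section GreenIdentity

variable {y : Space} {h h₁ h₂ : ℂ → ℂ} {η : ℝ → ℝ} {δ : ℝ}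

/-- The component along `v` of the flux `χ (h(r̃) ∇f - f ∇h(r̃))`, with the cutoff
`χ = η(Re r̃)`. -/
noncomputable def cutoffFlux (y : Space) (η : ℝ → ℝ) (h h₁ : ℂ → ℂ) (f : SpaceTest)
    (v x : Space) : ℂ :=
  η (complexDist y x).re * (h (complexDist y x) * (∂_{v} f : SpaceTest) x
    - f x * (h₁ (complexDist y x) * lineDerivDist y v x))

/-- The part of the derivative of `cutoffFlux` along `v` in which the cutoff is differentiated. -/
noncomputable def cutoffFluxBoundary (y : Space) (η : ℝ → ℝ) (h h₁ : ℂ → ℂ) (f : SpaceTest)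
    (v x : Space) : ℂ :=
  ((deriv η (complexDist y x).re : ℝ) : ℂ) * (lineDerivDist y v x).re
    * (h (complexDist y x) * (∂_{v} f : SpaceTest) x
      - f x * (h₁ (complexDist y x) * lineDerivDist y v x))

/-- The part of the derivative of `cutoffFlux` along `v` in which the cutoff is not
differentiated. -/
noncomputable def cutoffFluxInterior (y : Space) (η : ℝ → ℝ) (h h₁ h₂ : ℂ → ℂ) (f : SpaceTest)
    (v x : Space) : ℂ :=
  η (complexDist y x).re * (h (complexDist y x) * (∂_{v} (∂_{v} f) : SpaceTest) x
    - f x * (h₂ (complexDist y x) * lineDerivDist y v x ^ 2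
      + h₁ (complexDist y x) * (((‖v‖ ^ 2 : ℝ) - lineDerivDist y v x ^ 2) / complexDist y x)))

theorem hasDerivAt_lineDerivDist_line {x : Space} (v : Space) (hx : 0 < (complexDist y x).re) :
    HasDerivAt (fun s : ℝ => lineDerivDist y v (x + s • v))
      (((‖v‖ ^ 2 : ℝ) - lineDerivDist y v x ^ 2) / complexDist y x) 0 := by
  have hne : complexDist y x ≠ 0 := fun h => by simp [h] at hx
  have h1 : HasDerivAt (fun s : ℝ => (inner ℝ (x + s • v) v : ℝ)) (‖v‖ ^ 2) 0 := by
    have := ((hasDerivAt_id (0 : ℝ)).mul_const (‖v‖ ^ 2)).const_add (inner ℝ x v : ℝ)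
    simp only [one_mul] at this
    refine this.congr_of_eventuallyEq (Eventually.of_forall fun s => ?_)
    simp [inner_add_left, real_inner_smul_left]
  have h2 := (h1.ofReal_comp.sub_const (I * (inner ℝ y v : ℝ))).div
    (hasDerivAt_complexDist_line y (v := v) hx) (by simpa using hne)
  refine h2.congr_deriv ?_
  simp only [zero_smul, add_zero, lineDerivDist]
  field_simp

/-- The product rule for `cutoffFlux`, where the cutoff is supported. -/
theorem hasLineDerivAt_cutoffFlux (hη : ContDiff ℝ ∞ η)
    (hh : ∀ z : ℂ, 0 < z.re → |z.im| ≤ ‖y‖ → HasDerivAt h (h₁ z) z)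
    (hh₁ : ∀ z : ℂ, 0 < z.re → |z.im| ≤ ‖y‖ → HasDerivAt h₁ (h₂ z) z)
    (f : SpaceTest) (v : Space) {x : Space} (hx : 0 < (complexDist y x).re) :
    HasLineDerivAt ℝ (cutoffFlux y η h h₁ f v)
      (cutoffFluxBoundary y η h h₁ f v x + cutoffFluxInterior y η h h₁ h₂ f v x) x v := by
  have hne : complexDist y x ≠ 0 := fun h => by simp [h] at hx
  have hr := hasDerivAt_complexDist_line y (v := v) hx
  have e0 : complexDist y x = complexDist y (x + (0 : ℝ) • v) := by simp
  have hη' : HasDerivAt (fun s : ℝ => ((η (complexDist y (x + s • v)).re : ℝ) : ℂ))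
      (deriv η (complexDist y x).re * (lineDerivDist y v x).re : ℝ) 0 := by
    have h1 : HasDerivAt (fun s : ℝ => (complexDist y (x + s • v)).re)
        (lineDerivDist y v x).re 0 := reCLM.hasFDerivAt.comp_hasDerivAt (0 : ℝ) hr
    have h2 : HasDerivAt η (deriv η (complexDist y x).re) (complexDist y x).re :=
      (hη.differentiable (by simp) _).hasDerivAt
    exact (h2.comp_of_eq (0 : ℝ) h1 (by simp)).ofReal_comp
  have hH : HasDerivAt (fun s : ℝ => h (complexDist y (x + s • v)))
      (h₁ (complexDist y x) * lineDerivDist y v x) 0 :=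
    (hh _ hx (abs_complexDist_im_le y x)).comp_of_eq (0 : ℝ) hr (by simp)
  have hH₁ : HasDerivAt (fun s : ℝ => h₁ (complexDist y (x + s • v)))
      (h₂ (complexDist y x) * lineDerivDist y v x) 0 :=
    (hh₁ _ hx (abs_complexDist_im_le y x)).comp_of_eq (0 : ℝ) hr (by simp)
  have hf := (hasDerivAt_test_line f x v).ofReal_comp
  have hf' := (hasDerivAt_test_line (∂_{v} f) x v).ofReal_comp
  have hl := hasDerivAt_lineDerivDist_line v hx
  have key := hη'.mul ((hH.mul hf').sub (hf.mul (hH₁.mul hl)))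
  unfold HasLineDerivAt
  refine key.congr_deriv ?_
  simp only [zero_smul, add_zero, cutoffFluxBoundary, cutoffFluxInterior, Pi.mul_apply,
    Pi.sub_apply]
  push_cast
  ring

theorem continuousOn_comp_complexDist {k : ℂ → ℂ}
    (hk : ∀ z : ℂ, 0 < z.re → |z.im| ≤ ‖y‖ → ContinuousAt k z) :
    ContinuousOn (fun x => k (complexDist y x)) {x | 0 < (complexDist y x).re} := fun x hx =>
  (hk _ hx (abs_complexDist_im_le y x)).comp_continuousWithinAt (continuousOn_complexDist y x hx)

theorem continuousOn_lineDerivDist (v : Space) :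
    ContinuousOn (lineDerivDist y v) {x | 0 < (complexDist y x).re} := by
  refine ContinuousOn.div (by fun_prop) (continuousOn_complexDist y) fun x hx h => ?_
  have hx' : 0 < (complexDist y x).re := hx
  simp [h] at hx'

theorem integrable_of_continuousOn_re_complexDist_pos (hδ : 0 < δ) {F : Space → ℂ} (f : SpaceTest)
    (h1 : ContinuousOn F {x | 0 < (complexDist y x).re})
    (h2 : ∀ x, (complexDist y x).re < δ → F x = 0) (h3 : ∀ x ∉ tsupport f, F x = 0) :
    Integrable F :=
  (continuous_of_continuousOn_re_complexDist_pos hδ h1 h2).integrable_of_hasCompactSupport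
    (HasCompactSupport.intro f.hasCompactSupport h3)

theorem deriv_eq_zero_of_eq_zero_of_le (hη0 : ∀ s ≤ δ, η s = 0) : ∀ s < δ, deriv η s = 0 :=
  fun s hs => by
    have : η =ᶠ[𝓝 s] fun _ => 0 :=
      (eventually_lt_nhds hs).mono fun s' hs' => hη0 s' hs'.le
    rw [this.deriv_eq, deriv_const]

/-- **Green's identity** for a function `h(r̃)` of the complex distance and a test function `f`,
with a cutoff `η(Re r̃)` which vanishes near the branch disk; `Δ(h(r̃)) = h'' + 2 h' / r̃`. -/
theorem green_cutoff (hδ : 0 < δ) (hη : ContDiff ℝ ∞ η) (hη0 : ∀ s ≤ δ, η s = 0)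
    (hh : ∀ z : ℂ, 0 < z.re → |z.im| ≤ ‖y‖ → HasDerivAt h (h₁ z) z)
    (hh₁ : ∀ z : ℂ, 0 < z.re → |z.im| ≤ ‖y‖ → HasDerivAt h₁ (h₂ z) z)
    (hh₂ : ∀ z : ℂ, 0 < z.re → |z.im| ≤ ‖y‖ → ContinuousAt h₂ z) (f : SpaceTest) :
    ∫ x, (η (complexDist y x).re : ℂ) * (h (complexDist y x) * testLaplacian f x
        - f x * (h₂ (complexDist y x) + 2 * h₁ (complexDist y x) / complexDist y x))
      = -∫ x, ((deriv η (complexDist y x).re : ℝ) : ℂ)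
          * (h (complexDist y x) * (fderiv ℝ f x (gradRadius y x) : ℝ)
            - f x * h₁ (complexDist y x)
              * (((complexDist y x).re ^ 2 + ‖y‖ ^ 2) / ‖complexDist y x‖ ^ 2 : ℝ)) := by
  have hη0' := deriv_eq_zero_of_eq_zero_of_le hη0
  have hdη : Continuous (deriv η) := hη.continuous_deriv (by simp)
  have hcη : ContinuousOn (fun x : Space => ((η (complexDist y x).re : ℝ) : ℂ))
      {x | 0 < (complexDist y x).re} :=
    (continuous_ofReal.comp (hη.continuous.comp (continuous_complexDist_re y))).continuousOn
  have hcη' : ContinuousOn (fun x : Space => ((deriv η (complexDist y x).re : ℝ) : ℂ))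
      {x | 0 < (complexDist y x).re} :=
    (continuous_ofReal.comp (hdη.comp (continuous_complexDist_re y))).continuousOn
  have hch := continuousOn_comp_complexDist fun z hz hz' => (hh z hz hz').continuousAt
  have hch₁ := continuousOn_comp_complexDist fun z hz hz' => (hh₁ z hz hz').continuousAt
  have hch₂ := continuousOn_comp_complexDist hh₂
  have hcf : ∀ k : SpaceTest, ContinuousOn (fun x => ((k x : ℝ) : ℂ))
      {x | 0 < (complexDist y x).re} := fun k =>
    (continuous_ofReal.comp k.continuous).continuousOn
  have hcl := fun v => continuousOn_lineDerivDist (y := y) v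
  have hclr : ∀ v, ContinuousOn (fun x => (((lineDerivDist y v x).re : ℝ) : ℂ))
      {x | 0 < (complexDist y x).re} := fun v =>
    (continuous_ofReal.comp Complex.continuous_re).comp_continuousOn (hcl v)
  have hne : ∀ x, 0 < (complexDist y x).re → complexDist y x ≠ 0 := fun x hx h => by
    simp [h] at hx
  have hint := fun F : Space → ℂ =>
    integrable_of_continuousOn_re_complexDist_pos (y := y) hδ (F := F) f
  have hf0 : ∀ x ∉ tsupport f, f x = 0 := fun x hx => image_eq_zero_of_notMem_tsupport hx
  have hf1 : ∀ v, ∀ x ∉ tsupport f, (∂_{v} f : SpaceTest) x = 0 := fun v x hx =>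
    test_lineDeriv_eq_zero f v hx
  have hf2 : ∀ v, ∀ x ∉ tsupport f, (∂_{v} (∂_{v} f) : SpaceTest) x = 0 := fun v x hx =>
    test_lineDeriv_eq_zero _ v fun h => hx (tsupport_lineDeriv_subset f v h)
  have hX : ∀ v, Integrable (cutoffFlux y η h h₁ f v) := fun v => by
    refine hint _ ?_ (fun x hx => ?_) fun x hx => ?_
    · exact hcη.mul ((hch.mul (hcf _)).sub ((hcf f).mul (hch₁.mul (hcl v))))
    · simp [cutoffFlux, hη0 _ hx.le]
    · simp [cutoffFlux, hf0 x hx, hf1 v x hx]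
  have hB : ∀ v, Integrable (cutoffFluxBoundary y η h h₁ f v) := fun v => by
    refine hint _ ?_ (fun x hx => ?_) fun x hx => ?_
    · exact (hcη'.mul (hclr v)).mul ((hch.mul (hcf _)).sub ((hcf f).mul (hch₁.mul (hcl v))))
    · simp [cutoffFluxBoundary, hη0' _ hx]
    · simp [cutoffFluxBoundary, hf0 x hx, hf1 v x hx]
  have hI : ∀ v, Integrable (cutoffFluxInterior y η h h₁ h₂ f v) := fun v => by
    refine hint _ ?_ (fun x hx => ?_) fun x hx => ?_
    · exact hcη.mul ((hch.mul (hcf _)).sub ((hcf f).mul ((hch₂.mul ((hcl v).pow 2)).add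
        (hch₁.mul ((continuousOn_const.sub ((hcl v).pow 2)).div (continuousOn_complexDist y)
          hne)))))
    · simp [cutoffFluxInterior, hη0 _ hx.le]
    · simp [cutoffFluxInterior, hf0 x hx, hf2 v x hx]
  have hzero : ∀ v, (∫ x, cutoffFluxBoundary y η h h₁ f v x)
      + ∫ x, cutoffFluxInterior y η h h₁ h₂ f v x = 0 := fun v => by
    rw [← integral_add (hB v) (hI v)]
    refine integral_eq_zero_of_hasLineDerivAt (v := v) (hX v) ((hB v).add (hI v)) fun x => ?_
    by_cases hx : 0 < (complexDist y x).re
    · exact hasLineDerivAt_cutoffFlux hη hh hh₁ f v hx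
    · -- near such a point the cutoff vanishes identically
      have hev : ∀ᶠ x' in 𝓝 x, (complexDist y x').re < δ :=
        (continuous_complexDist_re y).continuousAt.eventually_lt continuousAt_const (by linarith)
      have h1 : cutoffFlux y η h h₁ f v =ᶠ[𝓝 x] fun _ => 0 :=
        hev.mono fun x' hx' => by simp [cutoffFlux, hη0 _ hx'.le]
      have h2 := hev.self_of_nhds
      have h3 : cutoffFluxBoundary y η h h₁ f v x + cutoffFluxInterior y η h h₁ h₂ f v x = 0 := by
        simp [cutoffFluxBoundary, cutoffFluxInterior, hη0 _ h2.le, hη0' _ h2]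
      rw [h3]
      exact ((hasFDerivAt_const (0 : ℂ) x).hasLineDerivAt v).congr_of_eventuallyEq h1
  rw [eq_neg_iff_add_eq_zero]
  -- `∑ᵢ (∂ᵢr̃)² = 1` turns the sum over the axes into the radial operator `h'' + 2 h' / r̃`
  have hsumI : ∀ x, (η (complexDist y x).re : ℂ) * (h (complexDist y x) * testLaplacian f x
        - f x * (h₂ (complexDist y x) + 2 * h₁ (complexDist y x) / complexDist y x))
      = ∑ i : Fin 3, cutoffFluxInterior y η h h₁ h₂ f (EuclideanSpace.single i 1) x := by
    intro x
    by_cases hx : 0 < (complexDist y x).re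
    · have hs := sum_lineDerivDist_sq (hne x hx)
      simp only [Fin.sum_univ_three] at hs
      have hlap : ((testLaplacian f x : ℝ) : ℂ) = ∑ i : Fin 3,
          (((∂_{(EuclideanSpace.single i (1 : ℝ) : Space)}
            (∂_{(EuclideanSpace.single i (1 : ℝ) : Space)} f) : SpaceTest) x : ℝ) : ℂ) := by
        rw [← ofReal_sum]
        simp [testLaplacian, Fin.sum_univ_three]
      rw [hlap]
      simp only [cutoffFluxInterior, Fin.sum_univ_three, PiLp.norm_single, norm_one,
        one_pow, ofReal_one]
      have := hne x hx
      field_simp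
      linear_combination (-(η (complexDist y x).re : ℂ) * f x * (h₁ (complexDist y x)
        - complexDist y x * h₂ (complexDist y x))) * hs
    · have : (η (complexDist y x).re : ℂ) = 0 := by rw [hη0 _ (by linarith), ofReal_zero]
      simp [cutoffFluxInterior, this]
  have hsumB : ∀ x, ((deriv η (complexDist y x).re : ℝ) : ℂ)
          * (h (complexDist y x) * (fderiv ℝ f x (gradRadius y x) : ℝ)
            - f x * h₁ (complexDist y x)
              * (((complexDist y x).re ^ 2 + ‖y‖ ^ 2) / ‖complexDist y x‖ ^ 2 : ℝ))
      = ∑ i : Fin 3, cutoffFluxBoundary y η h h₁ f (EuclideanSpace.single i 1) x := by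
    intro x
    by_cases hx : 0 < (complexDist y x).re
    · rw [← sum_re_lineDerivDist_mul_self (hne x hx), ← sum_re_lineDerivDist_mul_lineDeriv]
      simp only [cutoffFluxBoundary, Fin.sum_univ_three]
      push_cast
      ring
    · have : ((deriv η (complexDist y x).re : ℝ) : ℂ) = 0 := by
        rw [hη0' _ (by linarith), ofReal_zero]
      simp [cutoffFluxBoundary, this]
  simp only [hsumI, hsumB]
  rw [integral_finsetSum _ fun i _ => hI _, integral_finsetSum _ fun i _ => hB _,
    ← Finset.sum_add_distrib]
  refine Finset.sum_eq_zero fun i _ => ?_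
  rw [add_comm]
  exact hzero _

end GreenIdentity

/-! ### Integration in oblate spheroidal coordinates -/

section Oblate

/-- The distance from the axis at the oblate spheroidal coordinates `(p, q)`. -/
noncomputable def oblateRho (a p q : ℝ) : ℝ := √((p ^ 2 + a ^ 2) * (a ^ 2 - q ^ 2)) / a

/-- The point with oblate spheroidal coordinates `(p, q)` and azimuth `θ`. -/
noncomputable def oblatePoint (e : OrthonormalBasis (Fin 3) ℝ Space) (a p q θ : ℝ) : Space :=
  cylPoint e (oblateRho a p q) θ (p * q / a)

variable {a p q : ℝ}

theorem oblateRho_sq (ha : 0 < a) (hq : |q| ≤ a) :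
    oblateRho a p q ^ 2 = (p ^ 2 + a ^ 2) * (a ^ 2 - q ^ 2) / a ^ 2 := by
  have : q ^ 2 ≤ a ^ 2 := sq_le_sq' (abs_le.1 hq).1 (abs_le.1 hq).2
  rw [oblateRho, div_pow, Real.sq_sqrt (mul_nonneg (by positivity) (by linarith))]

theorem sq_lt_sq_of_abs_lt (hq : |q| < a) : q ^ 2 < a ^ 2 :=
  sq_lt_sq' (abs_lt.1 hq).1 (abs_lt.1 hq).2

theorem oblateRho_pos (ha : 0 < a) (hq : |q| < a) : 0 < oblateRho a p q := by
  have := sq_lt_sq_of_abs_lt hq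
  exact div_pos (Real.sqrt_pos.2 (mul_pos (by positivity) (by linarith))) ha

theorem hasDerivAt_oblateRho_fst (ha : 0 < a) (hq : |q| < a) :
    HasDerivAt (fun s => oblateRho a s q)
      (p * (a ^ 2 - q ^ 2) / (a ^ 2 * oblateRho a p q)) p := by
  have hq' := sq_lt_sq_of_abs_lt hq
  have hpos : 0 < (p ^ 2 + a ^ 2) * (a ^ 2 - q ^ 2) := mul_pos (by positivity) (by linarith)
  have h1 : HasDerivAt (fun s : ℝ => (s ^ 2 + a ^ 2) * (a ^ 2 - q ^ 2))
      (2 * p * (a ^ 2 - q ^ 2)) p := by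
    have := (((hasDerivAt_id p).pow 2).add_const (a ^ 2)).mul_const (a ^ 2 - q ^ 2)
    simpa using this
  refine ((h1.sqrt hpos.ne').div_const a).congr_deriv ?_
  have := Real.sqrt_pos.2 hpos
  rw [oblateRho]
  field_simp

theorem hasDerivAt_oblateRho_snd (ha : 0 < a) (hq : |q| < a) :
    HasDerivAt (fun s => oblateRho a p s)
      (-(q * (p ^ 2 + a ^ 2) / (a ^ 2 * oblateRho a p q))) q := by
  have hq' := sq_lt_sq_of_abs_lt hq
  have hpos : 0 < (p ^ 2 + a ^ 2) * (a ^ 2 - q ^ 2) := mul_pos (by positivity) (by linarith)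
  have h1 : HasDerivAt (fun s : ℝ => (p ^ 2 + a ^ 2) * (a ^ 2 - s ^ 2))
      ((p ^ 2 + a ^ 2) * (-(2 * q))) q := by
    have := (((hasDerivAt_id q).pow 2).const_sub (a ^ 2)).const_mul (p ^ 2 + a ^ 2)
    simpa using this
  refine ((h1.sqrt hpos.ne').div_const a).congr_deriv ?_
  have := Real.sqrt_pos.2 hpos
  rw [oblateRho]
  field_simp

variable {y : Space} (e : OrthonormalBasis (Fin 3) ℝ Space)

theorem norm_cylPoint_sq (ρ θ ξ : ℝ) : ‖cylPoint e ρ θ ξ‖ ^ 2 = ρ ^ 2 + ξ ^ 2 := by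
  rw [cylPoint, norm_sq_frame]
  linear_combination ρ ^ 2 * Real.cos_sq_add_sin_sq θ

theorem inner_cylPoint (he : y = ‖y‖ • e 2) (ρ θ ξ : ℝ) :
    (inner ℝ (cylPoint e ρ θ ξ) y : ℝ) = ‖y‖ * ξ := by
  conv_lhs => rw [he]
  exact inner_frame_axis e _ _ _ _

/-- In oblate spheroidal coordinates the complex distance is `p - iq`. -/
theorem complexDist_oblatePoint (hy : y ≠ 0) (he : y = ‖y‖ • e 2) (hp : 0 < p) (hq : |q| ≤ ‖y‖)
    (θ : ℝ) : complexDist y (oblatePoint e ‖y‖ p q θ) = p - q * I := by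
  have ha : 0 < ‖y‖ := norm_pos_iff.2 hy
  apply complexDist_eq_of_sq_eq
  · simpa using hp
  · rw [oblatePoint, norm_cylPoint_sq, inner_cylPoint e he, oblateRho_sq ha hq,
      mul_div_cancel₀ _ ha.ne']
    have h : (p ^ 2 + ‖y‖ ^ 2) * (‖y‖ ^ 2 - q ^ 2) / ‖y‖ ^ 2 + (p * q / ‖y‖) ^ 2 - ‖y‖ ^ 2
        = p ^ 2 - q ^ 2 := by
      field_simp; ring
    rw [h]
    push_cast
    linear_combination (q : ℂ) ^ 2 * I_sq

/-- The map from oblate spheroidal coordinates `(p, q, θ)` to the coordinates of a frame. -/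
noncomputable def oblateMap (a : ℝ) (c : Fin 3 → ℝ) : Fin 3 → ℝ :=
  ![oblateRho a (c 0) (c 1) * Real.cos (c 2), oblateRho a (c 0) (c 1) * Real.sin (c 2),
    c 0 * c 1 / a]

theorem frameEquiv_oblateMap (c : Fin 3 → ℝ) :
    frameEquiv e (oblateMap a c) = oblatePoint e a (c 0) (c 1) (c 2) := by
  rw [frameEquiv_apply]; rfl

/-- The Jacobian matrix of `oblateMap`. -/
noncomputable def oblateJacobian (a : ℝ) (c : Fin 3 → ℝ) : Matrix (Fin 3) (Fin 3) ℝ :=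
  let ρp := c 0 * (a ^ 2 - c 1 ^ 2) / (a ^ 2 * oblateRho a (c 0) (c 1))
  let ρq := -(c 1 * (c 0 ^ 2 + a ^ 2) / (a ^ 2 * oblateRho a (c 0) (c 1)))
  !![ρp * Real.cos (c 2), ρq * Real.cos (c 2), -(oblateRho a (c 0) (c 1) * Real.sin (c 2));
     ρp * Real.sin (c 2), ρq * Real.sin (c 2), oblateRho a (c 0) (c 1) * Real.cos (c 2);
     c 1 / a, c 0 / a, 0]

theorem det_oblateJacobian (ha : 0 < a) {c : Fin 3 → ℝ} (hq : |c 1| < a) :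
    (oblateJacobian a c).det = -((c 0 ^ 2 + c 1 ^ 2) / a) := by
  have hρ := oblateRho_pos (p := c 0) ha hq
  rw [oblateJacobian, Matrix.det_fin_three]
  simp only [Matrix.of_apply, Matrix.cons_val', Matrix.cons_val_zero, Matrix.cons_val_one,
    Matrix.cons_val, Matrix.cons_val_fin_one]
  field_simp
  have := Real.cos_sq_add_sin_sq (c 2)
  linear_combination (-(a ^ 3 * oblateRho a (c 0) (c 1) ^ 2 * (c 0 ^ 2 + c 1 ^ 2))) * this

theorem hasFDerivAt_oblateRho (ha : 0 < a) {c : Fin 3 → ℝ} (hq : |c 1| < a) :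
    HasFDerivAt (fun c : Fin 3 → ℝ => oblateRho a (c 0) (c 1))
      ((c 0 * (a ^ 2 - c 1 ^ 2) / (a ^ 2 * oblateRho a (c 0) (c 1))) •
          (ContinuousLinearMap.proj 0 : (Fin 3 → ℝ) →L[ℝ] ℝ)
        + (-(c 1 * (c 0 ^ 2 + a ^ 2) / (a ^ 2 * oblateRho a (c 0) (c 1)))) •
          (ContinuousLinearMap.proj 1 : (Fin 3 → ℝ) →L[ℝ] ℝ)) c := by
  have hq' := sq_lt_sq_of_abs_lt hq
  have hpos : 0 < (c 0 ^ 2 + a ^ 2) * (a ^ 2 - c 1 ^ 2) := mul_pos (by positivity) (by linarith)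
  have h0 : HasFDerivAt (fun c : Fin 3 → ℝ => c 0) (ContinuousLinearMap.proj 0) c :=
    (ContinuousLinearMap.proj (R := ℝ) (φ := fun _ : Fin 3 => ℝ) 0).hasFDerivAt
  have h1 : HasFDerivAt (fun c : Fin 3 → ℝ => c 1) (ContinuousLinearMap.proj 1) c :=
    (ContinuousLinearMap.proj (R := ℝ) (φ := fun _ : Fin 3 => ℝ) 1).hasFDerivAt
  have h := ((((h0.pow 2).add_const (a ^ 2)).mul ((h1.pow 2).const_sub (a ^ 2))).sqrt
    hpos.ne').mul_const a⁻¹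
  refine (h.congr_of_eventuallyEq (Eventually.of_forall fun c => ?_)).congr_fderiv ?_
  · simp [oblateRho, div_eq_mul_inv]
  · have := Real.sqrt_pos.2 hpos
    ext v
    simp [oblateRho]
    field_simp
    ring

theorem hasFDerivAt_oblateMap (ha : 0 < a) {c : Fin 3 → ℝ} (hq : |c 1| < a) :
    HasFDerivAt (oblateMap a)
      (LinearMap.toContinuousLinearMap (Matrix.toLin' (oblateJacobian a c))) c := by
  have hρ := hasFDerivAt_oblateRho ha hq
  have h0 : HasFDerivAt (fun c : Fin 3 → ℝ => c 0) (ContinuousLinearMap.proj 0) c :=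
    (ContinuousLinearMap.proj (R := ℝ) (φ := fun _ : Fin 3 => ℝ) 0).hasFDerivAt
  have h1 : HasFDerivAt (fun c : Fin 3 → ℝ => c 1) (ContinuousLinearMap.proj 1) c :=
    (ContinuousLinearMap.proj (R := ℝ) (φ := fun _ : Fin 3 => ℝ) 1).hasFDerivAt
  have h2 : HasFDerivAt (fun c : Fin 3 → ℝ => c 2) (ContinuousLinearMap.proj 2) c :=
    (ContinuousLinearMap.proj (R := ℝ) (φ := fun _ : Fin 3 => ℝ) 2).hasFDerivAt
  rw [hasFDerivAt_pi']
  intro i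
  fin_cases i
  · refine (hρ.mul h2.cos).congr_fderiv ?_
    ext v
    simp [oblateJacobian, Matrix.toLin'_apply, dotProduct, Fin.sum_univ_three]
    ring
  · refine (hρ.mul h2.sin).congr_fderiv ?_
    ext v
    simp [oblateJacobian, Matrix.toLin'_apply, dotProduct, Fin.sum_univ_three]
    ring
  · refine ((h0.mul h1).mul_const a⁻¹).congr_fderiv ?_
    ext v
    simp [oblateJacobian, Matrix.toLin'_apply, dotProduct, Fin.sum_univ_three]
    ring

/-- The domain of the oblate spheroidal coordinates `(p, q, θ)`. -/
def oblateDomain (a : ℝ) : Set (Fin 3 → ℝ) :=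
  {c | 0 < c 0 ∧ c 1 ∈ Ioo (-a) a ∧ c 2 ∈ Ioo (-Real.pi) Real.pi}

theorem measurableSet_oblateDomain (a : ℝ) : MeasurableSet (oblateDomain a) :=
  (measurableSet_lt measurable_const (measurable_pi_apply 0)).inter
    ((measurable_pi_apply 1 measurableSet_Ioo).inter (measurable_pi_apply 2 measurableSet_Ioo))

/-- The complex distance `p - iq` determines `p` and `q`; planar polar coordinates determine `θ`. -/
theorem injOn_oblateMap (hy : y ≠ 0) : InjOn (oblateMap ‖y‖) (oblateDomain ‖y‖) := by
  obtain ⟨e, he⟩ := exists_frame hy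
  have ha : 0 < ‖y‖ := norm_pos_iff.2 hy
  intro c hc c' hc' h
  have hq := abs_lt.2 hc.2.1
  have hq' := abs_lt.2 hc'.2.1
  have hd := congrArg (fun v => complexDist y (frameEquiv e v)) h
  simp only [frameEquiv_oblateMap] at hd
  rw [complexDist_oblatePoint e hy he hc.1 hq.le,
    complexDist_oblatePoint e hy he hc'.1 hq'.le] at hd
  have h0 : c 0 = c' 0 := by simpa using congrArg Complex.re hd
  have h1 : c 1 = c' 1 := by simpa using congrArg Complex.im hd
  have hρ := oblateRho_pos (p := c 0) ha hq
  have hm : (oblateRho ‖y‖ (c 0) (c 1), c 2) ∈ polarCoord.target := ⟨hρ, hc.2.2⟩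
  have hm' : (oblateRho ‖y‖ (c 0) (c 1), c' 2) ∈ polarCoord.target := ⟨hρ, hc'.2.2⟩
  have hp : polarCoord.symm (oblateRho ‖y‖ (c 0) (c 1), c 2)
      = polarCoord.symm (oblateRho ‖y‖ (c 0) (c 1), c' 2) := by
    have e0 := congrFun h 0
    have e1 := congrFun h 1
    simp only [oblateMap, Matrix.cons_val_zero, Matrix.cons_val_one] at e0 e1
    rw [← h0, ← h1] at e0 e1
    rw [polarCoord_symm_apply, polarCoord_symm_apply]
    exact Prod.ext e0 e1
  have h2 : c 2 = c' 2 := congrArg Prod.snd (polarCoord.symm.injOn hm hm' hp)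
  funext i
  fin_cases i
  exacts [h0, h1, h2]

/-- Oblate spheroidal coordinates reach every point off the branch disk and the plane `c 1 = 0`
through the axis. -/
theorem mem_image_oblateMap (hy : y ≠ 0) (he : y = ‖y‖ • e 2) {c : Fin 3 → ℝ} (hc : c 1 ≠ 0)
    (hp : 0 < (complexDist y (frameEquiv e c)).re) :
    c ∈ oblateMap ‖y‖ '' oblateDomain ‖y‖ := by
  have ha : 0 < ‖y‖ := norm_pos_iff.2 hy
  have hs : (c 0, c 1) ∈ polarCoord.source := Or.inr hc
  obtain ⟨ρ, θ, hpol⟩ : ∃ ρ θ, polarCoord (c 0, c 1) = (ρ, θ) := ⟨_, _, rfl⟩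
  have ht : (ρ, θ) ∈ polarCoord.target := hpol ▸ polarCoord.map_source hs
  have hinv := polarCoord.left_inv hs
  rw [hpol, polarCoord_symm_apply] at hinv
  have e0 : ρ * Real.cos θ = c 0 := congrArg Prod.fst hinv
  have e1 : ρ * Real.sin θ = c 1 := congrArg Prod.snd hinv
  have hρ : 0 < ρ := ht.1
  have hx : frameEquiv e c = cylPoint e ρ θ (c 2) := by
    rw [frameEquiv_apply, cylPoint, e0, e1]
  have h1 := complexDist_re_sq_sub_im_sq y (frameEquiv e c)
  have h2 := complexDist_re_mul_im y (frameEquiv e c)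
  rw [hx, norm_cylPoint_sq, ← hx] at h1
  rw [hx, inner_cylPoint e he, ← hx] at h2
  set p := (complexDist y (frameEquiv e c)).re
  set m := (complexDist y (frameEquiv e c)).im
  have h3 : ‖y‖ ^ 2 * ρ ^ 2 = (p ^ 2 + ‖y‖ ^ 2) * (‖y‖ ^ 2 - (-m) ^ 2) := by
    linear_combination (‖y‖ ^ 2) * (-h1) + (p * m - ‖y‖ * c 2) * h2
  have h4 : 0 < (p ^ 2 + ‖y‖ ^ 2) * (‖y‖ ^ 2 - (-m) ^ 2) := by rw [← h3]; positivity
  have h5 : 0 < ‖y‖ ^ 2 - (-m) ^ 2 := pos_of_mul_pos_right h4 (by positivity)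
  have hm : |-m| < ‖y‖ := abs_lt_of_sq_lt_sq (by linarith) ha.le
  refine ⟨![p, -m, θ], ⟨hp, abs_lt.1 hm, ht.2⟩, ?_⟩
  have hr : oblateRho ‖y‖ p (-m) = ρ := by
    rw [oblateRho, ← h3, ← mul_pow, Real.sqrt_sq (by positivity), mul_div_cancel_left₀ _ ha.ne']
  funext i
  fin_cases i
  · simp only [oblateMap, Fin.zero_eta, Matrix.cons_val_zero, Matrix.cons_val_one, Matrix.cons_val]
    rw [hr, e0]
  · simp only [oblateMap, Fin.mk_one, Matrix.cons_val_zero, Matrix.cons_val_one, Matrix.cons_val]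
    rw [hr, e1]
  · simp only [oblateMap, Fin.reduceFinMk, Matrix.cons_val_zero, Matrix.cons_val_one,
      Matrix.cons_val]
    rw [div_eq_iff ha.ne']
    linarith

/-- Coordinates on `ℝ³` as a product. -/
noncomputable def tripleEquiv : (Fin 3 → ℝ) ≃ᵐ ℝ × ℝ × ℝ :=
  (MeasurableEquiv.piFinSuccAbove (fun _ : Fin 3 => ℝ) 0).trans
    ((MeasurableEquiv.refl ℝ).prodCongr MeasurableEquiv.finTwoArrow)

theorem measurePreserving_tripleEquiv : MeasurePreserving tripleEquiv volume volume :=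
  (volume_preserving_piFinSuccAbove (fun _ : Fin 3 => ℝ) 0).trans
    ((MeasurePreserving.id volume).prod (volume_preserving_finTwoArrow ℝ))

/-- Integration in oblate spheroidal coordinates of a function vanishing on the branch disk. -/
theorem integral_oblate (hy : y ≠ 0) (he : y = ‖y‖ • e 2) {H : Space → ℂ} (hH : Integrable H)
    (h0 : ∀ x, ¬ 0 < (complexDist y x).re → H x = 0) :
    ∫ x, H x = ∫ p in Ioi (0 : ℝ), ∫ q in Ioo (-‖y‖) ‖y‖, ∫ θ in Ioo (-Real.pi) Real.pi,
      ((p ^ 2 + q ^ 2) / ‖y‖) • H (oblatePoint e ‖y‖ p q θ) := by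
  have ha : 0 < ‖y‖ := norm_pos_iff.2 hy
  have hd : ∀ c ∈ oblateDomain ‖y‖, HasFDerivWithinAt (oblateMap ‖y‖)
      (LinearMap.toContinuousLinearMap (Matrix.toLin' (oblateJacobian ‖y‖ c)))
      (oblateDomain ‖y‖) c := fun c hc =>
    (hasFDerivAt_oblateMap ha (abs_lt.2 hc.2.1)).hasFDerivWithinAt
  have hdet : ∀ c ∈ oblateDomain ‖y‖, |(LinearMap.toContinuousLinearMap
      (Matrix.toLin' (oblateJacobian ‖y‖ c))).det| = (c 0 ^ 2 + c 1 ^ 2) / ‖y‖ := fun c hc => by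
    rw [ContinuousLinearMap.det, LinearMap.coe_toContinuousLinearMap, LinearMap.det_toLin',
      det_oblateJacobian ha (abs_lt.2 hc.2.1), abs_neg, abs_of_nonneg (by positivity)]
  have hnull : ∀ᵐ c : Fin 3 → ℝ, c 1 ≠ 0 := by
    rw [ae_iff]
    simpa [volume_pi] using Measure.pi_hyperplane (fun _ : Fin 3 => (volume : Measure ℝ)) 1 0
  have hfr : Integrable (fun c => H (frameEquiv e c)) :=
    ((measurePreserving_frameEquiv e).integrable_comp_emb (frameEquiv e).measurableEmbedding).2 hH
  let F : ℝ × ℝ × ℝ → ℂ := fun c =>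
    ((c.1 ^ 2 + c.2.1 ^ 2) / ‖y‖) • H (oblatePoint e ‖y‖ c.1 c.2.1 c.2.2)
  let D : Set (ℝ × ℝ × ℝ) := Ioi 0 ×ˢ (Ioo (-‖y‖) ‖y‖ ×ˢ Ioo (-Real.pi) Real.pi)
  have hpre : tripleEquiv ⁻¹' D = oblateDomain ‖y‖ := rfl
  have hcongr : EqOn (fun c => |(LinearMap.toContinuousLinearMap
      (Matrix.toLin' (oblateJacobian ‖y‖ c))).det| • H (frameEquiv e (oblateMap ‖y‖ c)))
      (fun c => F (tripleEquiv c)) (oblateDomain ‖y‖) := fun c hc => by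
    simp only [hdet c hc, frameEquiv_oblateMap]; rfl
  have hF : IntegrableOn F D := by
    rw [← measurePreserving_tripleEquiv.integrableOn_comp_preimage tripleEquiv.measurableEmbedding,
      hpre]
    refine IntegrableOn.congr_fun ?_ hcongr (measurableSet_oblateDomain _)
    exact (integrableOn_image_iff_integrableOn_abs_det_fderiv_smul volume
      (measurableSet_oblateDomain _) hd (injOn_oblateMap hy) _).1 hfr.integrableOn
  have e1 : ∫ x, H x = ∫ c, H (frameEquiv e c) :=
    ((measurePreserving_frameEquiv e).integral_comp (frameEquiv e).measurableEmbedding H).symm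
  have e2 : ∫ c in oblateMap ‖y‖ '' oblateDomain ‖y‖, H (frameEquiv e c)
      = ∫ c, H (frameEquiv e c) := by
    apply setIntegral_eq_integral_of_ae_compl_eq_zero
    filter_upwards [hnull] with c hc hc'
    exact h0 _ fun hp => hc' (mem_image_oblateMap e hy he hc hp)
  rw [e1, ← e2, integral_image_eq_integral_abs_det_fderiv_smul volume
    (measurableSet_oblateDomain _) hd (injOn_oblateMap hy),
    setIntegral_congr_fun (measurableSet_oblateDomain _) hcongr, ← hpre,
    measurePreserving_tripleEquiv.setIntegral_preimage_emb tripleEquiv.measurableEmbedding]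
  rw [Measure.volume_eq_prod] at hF ⊢
  rw [setIntegral_prod _ hF]
  have hF' := hF
  rw [IntegrableOn, ← Measure.prod_restrict] at hF'
  refine integral_congr_ae ?_
  filter_upwards [hF'.prod_right_ae] with p hp
  rw [Measure.volume_eq_prod] at hp ⊢
  exact setIntegral_prod (fun c : ℝ × ℝ => F (p, c)) hp

end Oblate

/-! ### Azimuthal means -/

section Means

variable (e : OrthonormalBasis (Fin 3) ℝ Space) (f : SpaceTest)

/-- The radial unit vector `∂x/∂ρ` at azimuth `θ`. -/
noncomputable def cylNormal (θ : ℝ) : Space := Real.cos θ • e 0 + Real.sin θ • e 1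

/-- The azimuthal mean of the radial derivative of `f`. -/
noncomputable def meanRadialDeriv (ρ ξ : ℝ) : ℝ :=
  1 / (2 * Real.pi) * ∫ θ in (0 : ℝ)..(2 * Real.pi), fderiv ℝ f (cylPoint e ρ θ ξ) (cylNormal e θ)

/-- The azimuthal mean of the axial derivative of `f`. -/
noncomputable def meanAxialDeriv (ρ ξ : ℝ) : ℝ :=
  1 / (2 * Real.pi) * ∫ θ in (0 : ℝ)..(2 * Real.pi), fderiv ℝ f (cylPoint e ρ θ ξ) (e 2)

theorem cylPoint_eq (ρ θ ξ : ℝ) : cylPoint e ρ θ ξ = ρ • cylNormal e θ + ξ • e 2 := by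
  simp [cylPoint, cylNormal, smul_add, smul_smul]

theorem norm_cylNormal (θ : ℝ) : ‖cylNormal e θ‖ = 1 := by
  have h := norm_sq_frame e (Real.cos θ) (Real.sin θ) 0
  rw [zero_smul, add_zero, Real.cos_sq_add_sin_sq] at h
  have h' : ‖cylNormal e θ‖ ^ 2 = 1 := by rw [cylNormal]; simpa using h
  exact (pow_eq_one_iff_of_nonneg (norm_nonneg _) two_ne_zero).1 h'

@[fun_prop]
theorem continuous_cylNormal : Continuous (cylNormal e) := by
  unfold cylNormal; fun_prop

theorem continuous_cylPoint :
    Continuous fun z : (ℝ × ℝ) × ℝ => cylPoint e z.1.1 z.2 z.1.2 := by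
  simp only [cylPoint_eq]
  fun_prop

theorem continuous_fderiv_test : Continuous (fderiv ℝ f) :=
  f.contDiff.continuous_fderiv (by simp)

theorem exists_norm_fderiv_test_le : ∃ C : ℝ, 0 ≤ C ∧ ∀ x, ‖fderiv ℝ f x‖ ≤ C := by
  obtain ⟨C, hC⟩ := (f.hasCompactSupport.fderiv ℝ).exists_bound_of_continuous
    (continuous_fderiv_test f)
  exact ⟨C, (norm_nonneg _).trans (hC 0), hC⟩

theorem continuous_meanRadialDeriv : Continuous fun z : ℝ × ℝ => meanRadialDeriv e f z.1 z.2 := by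
  refine continuous_const.mul
    (intervalIntegral.continuous_parametric_intervalIntegral_of_continuous' ?_ _ _)
  exact ((continuous_fderiv_test f).comp (continuous_cylPoint e)).clm_apply (by fun_prop)

theorem continuous_meanAxialDeriv : Continuous fun z : ℝ × ℝ => meanAxialDeriv e f z.1 z.2 := by
  refine continuous_const.mul
    (intervalIntegral.continuous_parametric_intervalIntegral_of_continuous' ?_ _ _)
  exact ((continuous_fderiv_test f).comp (continuous_cylPoint e)).clm_apply continuous_const

theorem continuous_cylMean : Continuous fun z : ℝ × ℝ => cylMean e f z.1 z.2 := by
  refine continuous_const.mul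
    (intervalIntegral.continuous_parametric_intervalIntegral_of_continuous' ?_ _ _)
  exact f.continuous.comp (continuous_cylPoint e)

theorem cylMean_zero_zero : cylMean e f 0 0 = f 0 := by
  have : ∀ θ, cylPoint e 0 θ 0 = 0 := fun θ => by simp [cylPoint]
  simp only [cylMean, this, intervalIntegral.integral_const, sub_zero, smul_eq_mul]
  field_simp

theorem abs_mean_le {C : ℝ} {k : ℝ → ℝ} (hk : ∀ θ, |k θ| ≤ C) :
    |1 / (2 * Real.pi) * ∫ θ in (0 : ℝ)..(2 * Real.pi), k θ| ≤ C := by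
  have h := intervalIntegral.norm_integral_le_of_norm_le_const (a := 0) (b := 2 * Real.pi)
    (f := k) (C := C) fun θ _ => hk θ
  rw [sub_zero, abs_of_pos Real.two_pi_pos] at h
  rw [abs_mul, abs_of_pos (by positivity : 0 < 1 / (2 * Real.pi)), one_div,
    inv_mul_le_iff₀ Real.two_pi_pos]
  rw [Real.norm_eq_abs] at h
  linarith

theorem exists_abs_meanAxialDeriv_le : ∃ C : ℝ, 0 ≤ C ∧ ∀ ρ ξ, |meanAxialDeriv e f ρ ξ| ≤ C := by
  obtain ⟨C, hC0, hC⟩ := exists_norm_fderiv_test_le f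
  refine ⟨C, hC0, fun ρ ξ => abs_mean_le fun θ => ?_⟩
  have := (fderiv ℝ f (cylPoint e ρ θ ξ)).le_of_opNorm_le (hC _) (e 2)
  simpa using this

/-- The mean of the radial derivative vanishes to first order on the axis, since the radial unit
vectors average to zero. -/
theorem exists_abs_meanRadialDeriv_le :
    ∃ C : ℝ, 0 ≤ C ∧ ∀ ρ ξ, |meanRadialDeriv e f ρ ξ| ≤ C * |ρ| := by
  have h11 : (1 : ℕ∞ω) + 1 ≤ ((⊤ : ℕ∞) : ℕ∞ω) := by
    rw [one_add_one_eq_two]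
    exact WithTop.coe_le_coe.2 (le_top : (2 : ℕ∞) ≤ ⊤)
  obtain ⟨K, hK⟩ := (f.contDiff.fderiv_right (m := 1) h11).lipschitzWith_of_hasCompactSupport
    (f.hasCompactSupport.fderiv ℝ) (by simp)
  refine ⟨K, K.2, fun ρ ξ => ?_⟩
  have hc : ∀ ρ, Continuous fun θ => fderiv ℝ f (cylPoint e ρ θ ξ) (cylNormal e θ) := fun ρ =>
    ((continuous_fderiv_test f).comp ((continuous_cylPoint e).comp
      (continuous_const.prodMk continuous_id : Continuous fun θ : ℝ => ((ρ, ξ), θ)))).clm_apply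
      (continuous_cylNormal e)
  have h0 : ∫ θ in (0 : ℝ)..(2 * Real.pi), fderiv ℝ f (cylPoint e 0 θ ξ) (cylNormal e θ) = 0 := by
    have : ∀ θ, fderiv ℝ f (cylPoint e 0 θ ξ) (cylNormal e θ)
        = Real.cos θ * fderiv ℝ f (ξ • e 2) (e 0) + Real.sin θ * fderiv ℝ f (ξ • e 2) (e 1) := by
      intro θ
      rw [cylPoint_eq, zero_smul, zero_add, cylNormal]
      simp
    simp only [this]
    rw [intervalIntegral.integral_add (Continuous.intervalIntegrable (by fun_prop) _ _)
      (Continuous.intervalIntegrable (by fun_prop) _ _), intervalIntegral.integral_mul_const,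
      intervalIntegral.integral_mul_const, integral_cos, integral_sin]
    simp
  have h1 : meanRadialDeriv e f ρ ξ = 1 / (2 * Real.pi) * ∫ θ in (0 : ℝ)..(2 * Real.pi),
      (fderiv ℝ f (cylPoint e ρ θ ξ) (cylNormal e θ)
        - fderiv ℝ f (cylPoint e 0 θ ξ) (cylNormal e θ)) := by
    rw [intervalIntegral.integral_sub ((hc ρ).intervalIntegrable _ _)
      ((hc 0).intervalIntegrable _ _), h0, sub_zero]
    rfl
  rw [h1]
  refine abs_mean_le fun θ => ?_
  have h2 := hK.dist_le_mul (cylPoint e ρ θ ξ) (cylPoint e 0 θ ξ)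
  rw [dist_eq_norm, dist_eq_norm] at h2
  have h3 : cylPoint e ρ θ ξ - cylPoint e 0 θ ξ = ρ • cylNormal e θ := by
    simp [cylPoint_eq]
  rw [h3, norm_smul, norm_cylNormal, mul_one, Real.norm_eq_abs] at h2
  have h4 := (fderiv ℝ f (cylPoint e ρ θ ξ)
    - fderiv ℝ f (cylPoint e 0 θ ξ)).le_of_opNorm_le h2 (cylNormal e θ)
  rwa [norm_cylNormal, mul_one] at h4

theorem hasFDerivAt_cylMean (z : ℝ × ℝ) :
    HasFDerivAt (fun z : ℝ × ℝ => cylMean e f z.1 z.2)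
      (meanRadialDeriv e f z.1 z.2 • ContinuousLinearMap.fst ℝ ℝ ℝ
        + meanAxialDeriv e f z.1 z.2 • ContinuousLinearMap.snd ℝ ℝ ℝ) z := by
  let L : ℝ → (ℝ × ℝ →L[ℝ] Space) := fun θ =>
    (ContinuousLinearMap.fst ℝ ℝ ℝ).smulRight (cylNormal e θ)
      + (ContinuousLinearMap.snd ℝ ℝ ℝ).smulRight (e 2)
  have hL : Continuous L := by
    refine Continuous.add ?_ continuous_const
    exact (ContinuousLinearMap.smulRightL ℝ (ℝ × ℝ) Space
      (ContinuousLinearMap.fst ℝ ℝ ℝ)).continuous.comp (continuous_cylNormal e)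
  have hpt : ∀ (z : ℝ × ℝ) (θ : ℝ),
      HasFDerivAt (fun z : ℝ × ℝ => cylPoint e z.1 θ z.2) (L θ) z := by
    intro z θ
    have : (fun z : ℝ × ℝ => cylPoint e z.1 θ z.2) = L θ := by
      funext z
      simp [cylPoint_eq, L]
    rw [this]
    exact (L θ).hasFDerivAt
  have hcont : ∀ z : ℝ × ℝ, Continuous fun θ => cylPoint e z.1 θ z.2 := fun z =>
    (continuous_cylPoint e).comp
      (continuous_const.prodMk continuous_id : Continuous fun θ : ℝ => (z, θ))
  have hF' : ∀ z : ℝ × ℝ, Continuous fun θ => (fderiv ℝ f (cylPoint e z.1 θ z.2)).comp (L θ) :=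
    fun z => ((continuous_fderiv_test f).comp (hcont z)).clm_comp hL
  obtain ⟨C, hC0, hC⟩ := exists_norm_fderiv_test_le f
  have key := intervalIntegral.hasFDerivAt_integral_of_dominated_of_fderiv_le (𝕜 := ℝ)
    (μ := volume) (a := 0)
    (b := 2 * Real.pi) (F := fun (z : ℝ × ℝ) θ => f (cylPoint e z.1 θ z.2))
    (F' := fun z θ => (fderiv ℝ f (cylPoint e z.1 θ z.2)).comp (L θ)) (x₀ := z)
    (bound := fun θ => C * ‖L θ‖) univ_mem
    (Eventually.of_forall fun z => (f.continuous.comp (hcont z)).aestronglyMeasurable)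
    ((f.continuous.comp (hcont z)).intervalIntegrable _ _)
    (hF' z).aestronglyMeasurable
    (Eventually.of_forall fun θ _ z _ => (ContinuousLinearMap.opNorm_comp_le _ _).trans
      (mul_le_mul_of_nonneg_right (hC _) (norm_nonneg _)))
    ((continuous_const.mul hL.norm).intervalIntegrable _ _)
    (Eventually.of_forall fun θ _ z _ =>
      ((f.contDiff.differentiable (by simp)) _).hasFDerivAt.comp z (hpt z θ))
  refine (key.const_mul (1 / (2 * Real.pi))).congr_fderiv ?_
  have happ : ∀ v : ℝ × ℝ,
      (∫ θ in (0 : ℝ)..(2 * Real.pi), (fderiv ℝ f (cylPoint e z.1 θ z.2)).comp (L θ)) v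
        = ∫ θ in (0 : ℝ)..(2 * Real.pi), fderiv ℝ f (cylPoint e z.1 θ z.2) (L θ v) := fun v => by
    rw [ContinuousLinearMap.intervalIntegral_apply ((hF' z).intervalIntegrable _ _)]
    rfl
  ext
  · simp only [ContinuousLinearMap.comp_apply, _root_.smul_apply, happ]
    simp [L, meanRadialDeriv]
  · simp only [ContinuousLinearMap.comp_apply, _root_.smul_apply, happ]
    simp [L, meanAxialDeriv]

theorem hasDerivAt_cylMean_comp {ρ ξ : ℝ → ℝ} {ρ' ξ' s : ℝ} (hρ : HasDerivAt ρ ρ' s)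
    (hξ : HasDerivAt ξ ξ' s) :
    HasDerivAt (fun s => cylMean e f (ρ s) (ξ s))
      (ρ' * meanRadialDeriv e f (ρ s) (ξ s) + ξ' * meanAxialDeriv e f (ρ s) (ξ s)) s := by
  have := (hasFDerivAt_cylMean e f (ρ s, ξ s)).comp_hasDerivAt s (hρ.prodMk hξ)
  refine this.congr_deriv ?_
  simp [mul_comm]

theorem cylMeanRho_eq (ρ ξ : ℝ) : cylMeanRho e f ρ ξ = meanRadialDeriv e f ρ ξ := by
  have := hasDerivAt_cylMean_comp e f (hasDerivAt_id ρ) (hasDerivAt_const ρ ξ)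
  simpa [cylMeanRho] using this.deriv

theorem cylMeanXi_eq (ρ ξ : ℝ) : cylMeanXi e f ρ ξ = meanAxialDeriv e f ρ ξ := by
  have := hasDerivAt_cylMean_comp e f (hasDerivAt_const ξ ρ) (hasDerivAt_id ξ)
  simpa [cylMeanXi] using this.deriv

/-! ### Azimuthal means in oblate spheroidal coordinates -/

/-- The `p`-derivative of the azimuthal mean in oblate spheroidal coordinates. -/
noncomputable def oblateGradP (a p q : ℝ) : ℝ :=
  p * (a ^ 2 - q ^ 2) / (a ^ 2 * oblateRho a p q)
      * meanRadialDeriv e f (oblateRho a p q) (p * q / a)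
    + q / a * meanAxialDeriv e f (oblateRho a p q) (p * q / a)

/-- The `q`-derivative of the azimuthal mean in oblate spheroidal coordinates. -/
noncomputable def oblateGradQ (a p q : ℝ) : ℝ :=
  -(q * (p ^ 2 + a ^ 2) / (a ^ 2 * oblateRho a p q))
      * meanRadialDeriv e f (oblateRho a p q) (p * q / a)
    + p / a * meanAxialDeriv e f (oblateRho a p q) (p * q / a)

variable {a p q : ℝ}

theorem hasDerivAt_oblateMean_fst (ha : 0 < a) (hq : |q| < a) :
    HasDerivAt (fun s => oblateMean e a f s q) (oblateGradP e f a p q) p := by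
  have h : HasDerivAt (fun s : ℝ => s * q / a) (q / a) p := by
    simpa using ((hasDerivAt_id p).mul_const q).div_const a
  exact hasDerivAt_cylMean_comp e f (hasDerivAt_oblateRho_fst ha hq) h

theorem hasDerivAt_oblateMean_snd (ha : 0 < a) (hq : |q| < a) :
    HasDerivAt (fun s => oblateMean e a f p s) (oblateGradQ e f a p q) q := by
  have h : HasDerivAt (fun s : ℝ => p * s / a) (p / a) q := by
    simpa using ((hasDerivAt_id q).const_mul p).div_const a
  exact hasDerivAt_cylMean_comp e f (hasDerivAt_oblateRho_snd ha hq) h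

theorem oblateRho_zero (ha : 0 < a) (q : ℝ) : oblateRho a 0 q = √(a ^ 2 - q ^ 2) := by
  rw [oblateRho, zero_pow two_ne_zero, zero_add, Real.sqrt_mul (by positivity),
    Real.sqrt_sq ha.le, mul_div_cancel_left₀ _ ha.ne']

theorem oblateGradP_zero (ha : 0 < a) (q : ℝ) :
    oblateGradP e f a 0 q = q / a * meanAxialDeriv e f √(a ^ 2 - q ^ 2) 0 := by
  simp [oblateGradP, oblateRho_zero ha]

theorem oblateGradQ_zero (ha : 0 < a) (q : ℝ) :
    oblateGradQ e f a 0 q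
      = -(q / √(a ^ 2 - q ^ 2)) * meanRadialDeriv e f √(a ^ 2 - q ^ 2) 0 := by
  simp only [oblateGradQ, oblateRho_zero ha]
  have : q * a ^ 2 / (a ^ 2 * √(a ^ 2 - q ^ 2)) = q / √(a ^ 2 - q ^ 2) := by
    rw [mul_comm q, mul_div_mul_left _ _ (by positivity)]
  simp [this]

theorem continuous_oblateRho : Continuous fun z : ℝ × ℝ => oblateRho a z.1 z.2 := by
  unfold oblateRho; fun_prop

theorem continuous_oblateCoords :
    Continuous fun z : ℝ × ℝ => (oblateRho a z.1 z.2, z.1 * z.2 / a) :=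
  continuous_oblateRho.prodMk ((continuous_fst.mul continuous_snd).div_const a)

theorem continuous_oblateMean : Continuous fun z : ℝ × ℝ => oblateMean e a f z.1 z.2 := by
  have := (continuous_cylMean e f).comp (continuous_oblateCoords (a := a))
  exact this

theorem continuousOn_oblateGradP (ha : 0 < a) :
    ContinuousOn (fun z : ℝ × ℝ => oblateGradP e f a z.1 z.2) {z | |z.2| < a} := by
  have hc := continuous_oblateCoords (a := a)
  have hρ := continuous_oblateRho (a := a)
  have h1 := (continuous_meanRadialDeriv e f).comp hc
  have h2 := (continuous_meanAxialDeriv e f).comp hc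
  refine ContinuousOn.add (ContinuousOn.mul (ContinuousOn.div (by fun_prop) (by fun_prop) ?_)
    h1.continuousOn) (ContinuousOn.mul (by fun_prop) h2.continuousOn)
  exact fun z hz => (mul_pos (by positivity) (oblateRho_pos ha hz)).ne'

theorem continuousOn_oblateGradQ (ha : 0 < a) :
    ContinuousOn (fun z : ℝ × ℝ => oblateGradQ e f a z.1 z.2) {z | |z.2| < a} := by
  have hc := continuous_oblateCoords (a := a)
  have hρ := continuous_oblateRho (a := a)
  have h1 := (continuous_meanRadialDeriv e f).comp hc
  have h2 := (continuous_meanAxialDeriv e f).comp hc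
  refine ContinuousOn.add (ContinuousOn.mul (ContinuousOn.neg (ContinuousOn.div (by fun_prop)
    (by fun_prop) ?_)) h1.continuousOn) (ContinuousOn.mul (by fun_prop) h2.continuousOn)
  exact fun z hz => (mul_pos (by positivity) (oblateRho_pos ha hz)).ne'

/-- Both derivatives of the azimuthal mean are `O(|p| + |q|)`: this compensates the singularity of
the beam on the focal circle `p = q = 0`. -/
theorem exists_abs_oblateGrad_le (ha : 0 < a) (R : ℝ) :
    ∃ C : ℝ, 0 ≤ C ∧ ∀ p q : ℝ, |p| ≤ R → |q| < a →
      |oblateGradP e f a p q| ≤ C * (|p| + |q|) ∧ |oblateGradQ e f a p q| ≤ C * (|p| + |q|) := by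
  obtain ⟨C, hC0, hC⟩ := exists_abs_meanRadialDeriv_le e f
  obtain ⟨C', hC0', hC'⟩ := exists_abs_meanAxialDeriv_le e f
  let M := max ((R ^ 2 + a ^ 2) / a ^ 2 * C) (1 / a * C')
  refine ⟨M, le_max_of_le_right (by positivity), fun p q hp hq => ?_⟩
  have hρ := oblateRho_pos (p := p) ha hq
  have hq' := sq_lt_sq_of_abs_lt hq
  have hp' : p ^ 2 ≤ R ^ 2 := sq_le_sq' (by linarith [abs_le.1 hp]) (abs_le.1 hp).2
  have hM1 : (R ^ 2 + a ^ 2) / a ^ 2 * C ≤ M := le_max_left _ _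
  have hM2 : 1 / a * C' ≤ M := le_max_right _ _
  have hrad : ∀ s : ℝ, |s| ≤ (R ^ 2 + a ^ 2) → ∀ r : ℝ,
      |r * s / (a ^ 2 * oblateRho a p q)
        * meanRadialDeriv e f (oblateRho a p q) (p * q / a)| ≤ M * |r| := by
    intro s hs r
    have h1 := hC (oblateRho a p q) (p * q / a)
    rw [abs_of_pos hρ] at h1
    rw [abs_mul, abs_div, abs_mul, abs_of_pos (mul_pos (by positivity : 0 < a ^ 2) hρ)]
    calc |r| * |s| / (a ^ 2 * oblateRho a p q)
          * |meanRadialDeriv e f (oblateRho a p q) (p * q / a)|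
        ≤ |r| * (R ^ 2 + a ^ 2) / (a ^ 2 * oblateRho a p q) * (C * oblateRho a p q) := by gcongr
      _ = (R ^ 2 + a ^ 2) / a ^ 2 * C * |r| := by field_simp
      _ ≤ M * |r| := by gcongr
  have haxi : ∀ r : ℝ, |r / a * meanAxialDeriv e f (oblateRho a p q) (p * q / a)| ≤ M * |r| := by
    intro r
    rw [abs_mul, abs_div, abs_of_pos ha]
    calc |r| / a * |meanAxialDeriv e f (oblateRho a p q) (p * q / a)|
        ≤ |r| / a * C' := by gcongr; exact hC' _ _
      _ = 1 / a * C' * |r| := by ring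
      _ ≤ M * |r| := by gcongr
  constructor
  · refine (abs_add_le _ _).trans ?_
    rw [mul_add M]
    refine add_le_add (hrad _ ?_ p) (haxi q)
    rw [abs_of_pos (by linarith)]
    nlinarith [sq_nonneg q, sq_nonneg R]
  · refine (abs_add_le _ _).trans ?_
    rw [neg_mul, abs_neg, mul_add M, add_comm]
    refine add_le_add (haxi p) (hrad _ ?_ q)
    rw [abs_of_nonneg (by positivity)]
    linarith

end Means

/-! ### The flux through the shielding spheroids -/

section Flux

theorem integral_Ioo_neg_pi_pi {k : ℝ → ℝ} (hk : Function.Periodic k (2 * Real.pi)) :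
    ∫ θ in Ioo (-Real.pi) Real.pi, k θ = ∫ θ in (0 : ℝ)..(2 * Real.pi), k θ := by
  rw [← integral_Ioc_eq_integral_Ioo, ← intervalIntegral.integral_of_le (by linarith [Real.pi_pos])]
  have := hk.intervalIntegral_add_eq (-Real.pi) 0
  rw [zero_add] at this
  rw [← this]
  congr 1
  ring

theorem periodic_cylNormal (e : OrthonormalBasis (Fin 3) ℝ Space) :
    Function.Periodic (cylNormal e) (2 * Real.pi) := fun θ => by
  simp [cylNormal]

theorem periodic_oblatePoint (e : OrthonormalBasis (Fin 3) ℝ Space) (a p q : ℝ) :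
    Function.Periodic (oblatePoint e a p q) (2 * Real.pi) := fun θ => by
  simp [oblatePoint, cylPoint]

theorem continuous_oblatePoint (e : OrthonormalBasis (Fin 3) ℝ Space) (a p q : ℝ) :
    Continuous (oblatePoint e a p q) :=
  (continuous_cylPoint e).comp (continuous_const.prodMk continuous_id :
    Continuous fun θ : ℝ => ((oblateRho a p q, p * q / a), θ))

theorem integral_test_oblatePoint (e : OrthonormalBasis (Fin 3) ℝ Space) (f : SpaceTest)
    (a p q : ℝ) :
    ∫ θ in Ioo (-Real.pi) Real.pi, f (oblatePoint e a p q θ)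
      = 2 * Real.pi * oblateMean e a f p q := by
  rw [integral_Ioo_neg_pi_pi fun θ => by simp only [periodic_oblatePoint e a p q θ]]
  change _ = 2 * Real.pi * (1 / (2 * Real.pi) * _)
  rw [← mul_assoc, mul_one_div_cancel Real.two_pi_pos.ne', one_mul]
  rfl

/-- The derivative `∂x/∂p` in oblate spheroidal coordinates. -/
noncomputable def oblateTangent (e : OrthonormalBasis (Fin 3) ℝ Space) (a p q θ : ℝ) : Space :=
  (p * (a ^ 2 - q ^ 2) / (a ^ 2 * oblateRho a p q)) • cylNormal e θ + (q / a) • e 2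

theorem continuous_oblateTangent (e : OrthonormalBasis (Fin 3) ℝ Space) (a p q : ℝ) :
    Continuous (oblateTangent e a p q) := by
  have : Continuous fun θ => (p * (a ^ 2 - q ^ 2) / (a ^ 2 * oblateRho a p q)) • cylNormal e θ
      + (q / a) • e 2 := by fun_prop
  exact this

theorem continuous_fderiv_oblateTangent (e : OrthonormalBasis (Fin 3) ℝ Space) (f : SpaceTest)
    (a p q : ℝ) :
    Continuous fun θ => fderiv ℝ f (oblatePoint e a p q θ) (oblateTangent e a p q θ) :=
  ((continuous_fderiv_test f).comp (continuous_oblatePoint e a p q)).clm_apply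
    (continuous_oblateTangent e a p q)

theorem integral_fderiv_oblateTangent (e : OrthonormalBasis (Fin 3) ℝ Space) (f : SpaceTest)
    (a p q : ℝ) :
    ∫ θ in Ioo (-Real.pi) Real.pi, fderiv ℝ f (oblatePoint e a p q θ) (oblateTangent e a p q θ)
      = 2 * Real.pi * oblateGradP e f a p q := by
  have hc := (continuous_fderiv_test f).comp (continuous_oblatePoint e a p q)
  rw [integral_Ioo_neg_pi_pi fun θ => by
    simp only [periodic_oblatePoint e a p q θ, oblateTangent, periodic_cylNormal e θ]]
  simp only [oblateTangent, map_add, map_smul, smul_eq_mul]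
  rw [intervalIntegral.integral_add, intervalIntegral.integral_const_mul,
    intervalIntegral.integral_const_mul]
  · simp only [oblateGradP, meanRadialDeriv, meanAxialDeriv]
    change _ * (∫ θ in (0 : ℝ)..(2 * Real.pi), fderiv ℝ f
        (cylPoint e (oblateRho a p q) θ (p * q / a)) (cylNormal e θ))
      + _ * (∫ θ in (0 : ℝ)..(2 * Real.pi), fderiv ℝ f
        (cylPoint e (oblateRho a p q) θ (p * q / a)) (e 2)) = _
    have := Real.two_pi_pos.ne'
    field_simp
  · exact (continuous_const.mul (hc.clm_apply (continuous_cylNormal e))).intervalIntegrable _ _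
  · exact (continuous_const.mul (hc.clm_apply continuous_const)).intervalIntegrable _ _

variable {y : Space} {h h₁ : ℂ → ℂ} {η : ℝ → ℝ} {δ : ℝ}

/-- The gradient of the oblate radius `p` is `(p² + a²) / (p² + q²)` times `∂x/∂p`. -/
theorem gradRadius_oblatePoint (e : OrthonormalBasis (Fin 3) ℝ Space) (hy : y ≠ 0)
    (he : y = ‖y‖ • e 2) {p q : ℝ} (hp : 0 < p) (hq : |q| < ‖y‖) (θ : ℝ) :
    gradRadius y (oblatePoint e ‖y‖ p q θ)
      = ((p ^ 2 + ‖y‖ ^ 2) / (p ^ 2 + q ^ 2)) • oblateTangent e ‖y‖ p q θ := by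
  have ha : 0 < ‖y‖ := norm_pos_iff.2 hy
  have hρ := oblateRho_pos (p := p) ha hq
  have hρ2 := oblateRho_sq (p := p) ha hq.le
  have hpq : 0 < p ^ 2 + q ^ 2 := by positivity
  have hd := complexDist_oblatePoint e hy he hp hq.le θ
  have hN : ‖complexDist y (oblatePoint e ‖y‖ p q θ)‖ ^ 2 = p ^ 2 + q ^ 2 := by
    rw [norm_complexDist_sq, hd]; simp
  rw [gradRadius, hN, hd, oblatePoint, cylPoint_eq, oblateTangent]
  generalize hA : ‖y‖ = a at *
  rw [he]
  have hre : ((p : ℂ) - q * I).re = p := by simp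
  have him : ((p : ℂ) - q * I).im = -q := by simp
  rw [hre, him]
  match_scalars
  · field_simp
    rw [hρ2]
    field_simp
  · field_simp
    ring

/-- The flux of `h ∇f - f ∇h` through the spheroid of oblate radius `p`, per unit azimuth and up to
the factor `p² + a²`. -/
noncomputable def oblateFlux (e : OrthonormalBasis (Fin 3) ℝ Space) (a : ℝ) (h h₁ : ℂ → ℂ)
    (f : SpaceTest) (p : ℝ) : ℂ :=
  ∫ q in (-a)..a, (h (p - q * I) * oblateGradP e f a p q - oblateMean e a f p q * h₁ (p - q * I))

theorem integral_cutoff_flux (e : OrthonormalBasis (Fin 3) ℝ Space) (hy : y ≠ 0)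
    (he : y = ‖y‖ • e 2) (hδ : 0 < δ) (hη : ContDiff ℝ ∞ η) (hη0 : ∀ s ≤ δ, η s = 0)
    (hh : ∀ z : ℂ, 0 < z.re → |z.im| ≤ ‖y‖ → ContinuousAt h z)
    (hh₁ : ∀ z : ℂ, 0 < z.re → |z.im| ≤ ‖y‖ → ContinuousAt h₁ z) (f : SpaceTest) :
    ∫ x, ((deriv η (complexDist y x).re : ℝ) : ℂ)
          * (h (complexDist y x) * (fderiv ℝ f x (gradRadius y x) : ℝ)
            - f x * h₁ (complexDist y x)
              * (((complexDist y x).re ^ 2 + ‖y‖ ^ 2) / ‖complexDist y x‖ ^ 2 : ℝ))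
      = 2 * Real.pi / ‖y‖ * ∫ p in Ioi (0 : ℝ), ((deriv η p : ℝ) : ℂ) * (p ^ 2 + ‖y‖ ^ 2 : ℝ)
          * oblateFlux e ‖y‖ h h₁ f p := by
  have ha : 0 < ‖y‖ := norm_pos_iff.2 hy
  have hη0' := deriv_eq_zero_of_eq_zero_of_le hη0
  have hdη : Continuous (deriv η) := hη.continuous_deriv (by simp)
  have hne : ∀ x, 0 < (complexDist y x).re → complexDist y x ≠ 0 := fun x hx h => by
    simp [h] at hx
  have hcd := continuousOn_complexDist y
  have hint : Integrable fun x => ((deriv η (complexDist y x).re : ℝ) : ℂ)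
          * (h (complexDist y x) * (fderiv ℝ f x (gradRadius y x) : ℝ)
            - f x * h₁ (complexDist y x)
              * (((complexDist y x).re ^ 2 + ‖y‖ ^ 2) / ‖complexDist y x‖ ^ 2 : ℝ)) := by
    refine integrable_of_continuousOn_re_complexDist_pos (y := y) hδ f ?_ (fun x hx => ?_)
      fun x hx => ?_
    · refine ContinuousOn.mul ?_ (ContinuousOn.sub (ContinuousOn.mul ?_ ?_)
        (ContinuousOn.mul (ContinuousOn.mul ?_ ?_) ?_))
      · exact (continuous_ofReal.comp
          (hdη.comp (continuous_complexDist_re y))).continuousOn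
      · exact continuousOn_comp_complexDist hh
      · refine continuous_ofReal.comp_continuousOn
          ((continuous_fderiv_test f).continuousOn.clm_apply ?_)
        refine ContinuousOn.smul (ContinuousOn.inv₀ (hcd.norm.pow 2) fun x hx =>
          pow_ne_zero 2 (norm_ne_zero_iff.2 (hne x hx))) (ContinuousOn.sub
            (ContinuousOn.smul (continuous_complexDist_re y).continuousOn continuousOn_id)
            (ContinuousOn.smul (Complex.continuous_im.comp_continuousOn hcd) continuousOn_const))
      · exact (continuous_ofReal.comp f.continuous).continuousOn
      · exact continuousOn_comp_complexDist hh₁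
      · refine continuous_ofReal.comp_continuousOn (ContinuousOn.div
          (((continuous_complexDist_re y).pow 2).add continuous_const).continuousOn
          (hcd.norm.pow 2) fun x hx => pow_ne_zero 2 (norm_ne_zero_iff.2 (hne x hx)))
    · simp [hη0' _ hx]
    · have h1 : fderiv ℝ f x = 0 :=
        image_eq_zero_of_notMem_tsupport fun h => hx (tsupport_fderiv_subset ℝ h)
      simp [h1, image_eq_zero_of_notMem_tsupport hx]
  rw [integral_oblate e hy he hint fun x hx => by simp [hη0' _ (by linarith : _ < δ)],
    ← integral_const_mul]
  refine setIntegral_congr_fun measurableSet_Ioi fun p hp => ?_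
  have hp : 0 < p := hp
  simp only [oblateFlux]
  rw [intervalIntegral.integral_of_le (by linarith), integral_Ioc_eq_integral_Ioo,
    ← integral_const_mul, ← integral_const_mul]
  refine setIntegral_congr_fun measurableSet_Ioo fun q hq => ?_
  have hq : |q| < ‖y‖ := abs_lt.2 hq
  have hpq : (0 : ℝ) < p ^ 2 + q ^ 2 := by positivity
  have hpt : ∀ θ, ((p ^ 2 + q ^ 2) / ‖y‖) •
      (((deriv η (complexDist y (oblatePoint e ‖y‖ p q θ)).re : ℝ) : ℂ)
          * (h (complexDist y (oblatePoint e ‖y‖ p q θ))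
              * (fderiv ℝ f (oblatePoint e ‖y‖ p q θ)
                  (gradRadius y (oblatePoint e ‖y‖ p q θ)) : ℝ)
            - f (oblatePoint e ‖y‖ p q θ) * h₁ (complexDist y (oblatePoint e ‖y‖ p q θ))
              * (((complexDist y (oblatePoint e ‖y‖ p q θ)).re ^ 2 + ‖y‖ ^ 2)
                / ‖complexDist y (oblatePoint e ‖y‖ p q θ)‖ ^ 2 : ℝ)))
      = (deriv η p * (p ^ 2 + ‖y‖ ^ 2) / ‖y‖ : ℝ) * h (p - q * I)
          * (fderiv ℝ f (oblatePoint e ‖y‖ p q θ) (oblateTangent e ‖y‖ p q θ) : ℝ)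
        - (deriv η p * (p ^ 2 + ‖y‖ ^ 2) / ‖y‖ : ℝ) * h₁ (p - q * I)
          * (f (oblatePoint e ‖y‖ p q θ) : ℝ) := by
    intro θ
    rw [gradRadius_oblatePoint e hy he hp hq, norm_complexDist_sq,
      complexDist_oblatePoint e hy he hp hq.le, map_smul, smul_eq_mul, real_smul]
    have hre : ((p : ℂ) - q * I).re = p := by simp
    have him : ((p : ℂ) - q * I).im = -q := by simp
    rw [hre, him, neg_sq]
    have hpq' : (p : ℂ) ^ 2 + (q : ℂ) ^ 2 ≠ 0 := by exact_mod_cast hpq.ne'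
    have ha' : (‖y‖ : ℂ) ≠ 0 := by exact_mod_cast ha.ne'
    push_cast
    field_simp
  simp only [hpt]
  have hI1 : IntegrableOn (fun θ => (((fderiv ℝ f (oblatePoint e ‖y‖ p q θ)
      (oblateTangent e ‖y‖ p q θ) : ℝ)) : ℂ)) (Ioo (-Real.pi) Real.pi) :=
    ((continuous_ofReal.comp (continuous_fderiv_oblateTangent e f ‖y‖ p q)).integrableOn_Icc
      (a := -Real.pi) (b := Real.pi)).mono_set Ioo_subset_Icc_self
  have hI2 : IntegrableOn (fun θ => ((f (oblatePoint e ‖y‖ p q θ) : ℝ) : ℂ))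
      (Ioo (-Real.pi) Real.pi) :=
    ((continuous_ofReal.comp (f.continuous.comp
      (continuous_oblatePoint e ‖y‖ p q))).integrableOn_Icc
      (a := -Real.pi) (b := Real.pi)).mono_set Ioo_subset_Icc_self
  rw [integral_sub (hI1.const_mul _) (hI2.const_mul _), integral_const_mul, integral_const_mul,
    integral_complex_ofReal, integral_complex_ofReal, integral_fderiv_oblateTangent,
    integral_test_oblatePoint]
  push_cast
  ring

end Flux

/-! ### The limit of the flux at the branch disk -/

section FluxLimit

/-- The beam, up to the factor `4π`, as a function `g(τ - z) / z` of the complex distance `z`. -/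
noncomputable def beamKernel (g : ℂ → ℂ) (τ z : ℂ) : ℂ := g (τ - z) / z

/-- The first derivative of `beamKernel` in `z`. -/
noncomputable def beamKernelDeriv (g : ℂ → ℂ) (τ z : ℂ) : ℂ :=
  -deriv g (τ - z) / z - g (τ - z) / z ^ 2

/-- The second derivative of `beamKernel` in `z`. -/
noncomputable def beamKernelDeriv₂ (g : ℂ → ℂ) (τ z : ℂ) : ℂ :=
  deriv (deriv g) (τ - z) / z + 2 * deriv g (τ - z) / z ^ 2 + 2 * g (τ - z) / z ^ 3

variable {g : ℂ → ℂ} {τ z : ℂ}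

theorem hasDerivAt_comp_const_sub (hg : DifferentiableOn ℂ g {τ | τ.im ≠ 0})
    (hz : (τ - z).im ≠ 0) : HasDerivAt (fun z => g (τ - z)) (-deriv g (τ - z)) z := by
  have h1 := (hg.differentiableAt (isOpen_im_ne_zero.mem_nhds hz)).hasDerivAt
  exact (h1.comp z ((hasDerivAt_id z).const_sub τ)).congr_deriv (by ring)

theorem hasDerivAt_beamKernel (hg : DifferentiableOn ℂ g {τ | τ.im ≠ 0}) (hz : (τ - z).im ≠ 0)
    (hz0 : z ≠ 0) : HasDerivAt (beamKernel g τ) (beamKernelDeriv g τ z) z := by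
  refine ((hasDerivAt_comp_const_sub hg hz).div (hasDerivAt_id z) hz0).congr_deriv ?_
  simp only [beamKernelDeriv, id_eq]
  field_simp

theorem hasDerivAt_beamKernelDeriv (hg : DifferentiableOn ℂ g {τ | τ.im ≠ 0})
    (hz : (τ - z).im ≠ 0) (hz0 : z ≠ 0) :
    HasDerivAt (beamKernelDeriv g τ) (beamKernelDeriv₂ g τ z) z := by
  have hg' := differentiableOn_deriv_im_ne_zero hg
  have h1 := (hasDerivAt_comp_const_sub hg' hz).neg.div (hasDerivAt_id z) hz0
  have h2 := (hasDerivAt_comp_const_sub hg hz).div ((hasDerivAt_id z).pow 2) (pow_ne_zero 2 hz0)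
  refine (h1.sub h2).congr_deriv ?_
  simp only [beamKernelDeriv₂, id_eq, Pi.neg_apply, Pi.pow_apply]
  field_simp
  ring

theorem continuousAt_beamKernelDeriv₂ (hg : DifferentiableOn ℂ g {τ | τ.im ≠ 0})
    (hz : (τ - z).im ≠ 0) (hz0 : z ≠ 0) : ContinuousAt (beamKernelDeriv₂ g τ) z := by
  have hg' := differentiableOn_deriv_im_ne_zero hg
  have hg'' := differentiableOn_deriv_im_ne_zero hg'
  have h0 := (hasDerivAt_comp_const_sub hg hz).continuousAt
  have h1 := (hasDerivAt_comp_const_sub hg' hz).continuousAt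
  have h2 := (hasDerivAt_comp_const_sub hg'' hz).continuousAt
  exact ((h2.div continuousAt_id hz0).add ((h1.const_mul 2).div (continuousAt_id.pow 2)
    (pow_ne_zero 2 hz0))).add ((h0.const_mul 2).div (continuousAt_id.pow 3) (pow_ne_zero 3 hz0))

/-- The radial part of the wave equation for the beam. -/
theorem beamKernelDeriv₂_add (hz0 : z ≠ 0) :
    beamKernelDeriv₂ g τ z + 2 * beamKernelDeriv g τ z / z = beamKernel (deriv (deriv g)) τ z := by
  simp only [beamKernelDeriv₂, beamKernelDeriv, beamKernel]
  field_simp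
  ring

variable {a : ℝ} (e : OrthonormalBasis (Fin 3) ℝ Space) (f : SpaceTest)

/-- The integrand left by the flux after an integration by parts in `q`; it is bounded. -/
noncomputable def regularFluxDensity (g : ℂ → ℂ) (τ : ℂ) (a : ℝ) (p q : ℝ) : ℂ :=
  beamKernel g τ (p - q * I) * (oblateGradP e f a p q + I * oblateGradQ e f a p q)

/-- The flux after an integration by parts in `q`, in a form which extends continuously to the
branch disk `p = 0`. -/
noncomputable def regularFlux (g : ℂ → ℂ) (τ : ℂ) (a : ℝ) (p : ℝ) : ℂ :=
  -I * (oblateMean e a f p a * beamKernel g τ (p - a * I)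
      - oblateMean e a f p (-a) * beamKernel g τ (p + a * I))
    + ∫ q in (-a)..a, regularFluxDensity e f g τ a p q

theorem im_sub_ne_zero_of_abs_le (hτ : a < |τ.im|) {z : ℂ} (hz : |z.im| ≤ a) : (τ - z).im ≠ 0 := by
  have := abs_sub_abs_le_abs_sub τ.im z.im
  rw [sub_im]
  exact abs_pos.1 (by linarith)

theorem abs_add_abs_le_two_mul_norm (p q : ℝ) : |p| + |q| ≤ 2 * ‖(p : ℂ) - q * I‖ := by
  have h1 := abs_re_le_norm ((p : ℂ) - q * I)
  have h2 := abs_im_le_norm ((p : ℂ) - q * I)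
  have hre : ((p : ℂ) - q * I).re = p := by simp
  have him : ((p : ℂ) - q * I).im = -q := by simp
  rw [hre] at h1
  rw [him, abs_neg] at h2
  linarith

theorem abs_im_ofReal_sub (p q : ℝ) : |((p : ℂ) - q * I).im| = |q| := by simp

/-- The kernel is `O(1 / |p - iq|)` and the gradient of the mean is `O(|p - iq|)`. -/
theorem exists_norm_regularFluxDensity_le (ha : 0 < a)
    (hg : DifferentiableOn ℂ g {τ | τ.im ≠ 0}) (hτ : a < |τ.im|) (R : ℝ) :
    ∃ C : ℝ, ∀ p q : ℝ, 0 ≤ p → p ≤ R → |q| < a → ‖regularFluxDensity e f g τ a p q‖ ≤ C := by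
  obtain ⟨C, hC0, hC⟩ := exists_abs_oblateGrad_le e f ha R
  have hK : IsCompact (Icc (0 : ℝ) R ×ℂ Icc (-a) a) := isCompact_Icc.reProdIm isCompact_Icc
  obtain ⟨M, hM⟩ := hK.exists_bound_of_continuousOn (f := fun z => g (τ - z)) fun z hz =>
    (hasDerivAt_comp_const_sub hg (im_sub_ne_zero_of_abs_le hτ (abs_le.2 hz.2))
      ).continuousAt.continuousWithinAt
  refine ⟨max M 0 * (4 * C), fun p q hp0 hpR hq => ?_⟩
  obtain ⟨hP, hQ⟩ := hC p q (by rwa [abs_of_nonneg hp0]) hq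
  have hmem : (p : ℂ) - q * I ∈ Icc (0 : ℝ) R ×ℂ Icc (-a) a := by
    refine ⟨by simpa using ⟨hp0, hpR⟩, abs_le.1 ?_⟩
    rw [abs_im_ofReal_sub]
    exact hq.le
  have hg1 : ‖g (τ - (p - q * I))‖ ≤ max M 0 := (hM _ hmem).trans (le_max_left _ _)
  have h2 : ‖(oblateGradP e f a p q : ℂ) + I * oblateGradQ e f a p q‖
      ≤ 4 * C * ‖(p : ℂ) - q * I‖ := by
    refine (norm_add_le _ _).trans ?_
    rw [norm_mul, norm_I, one_mul, norm_real, norm_real, Real.norm_eq_abs, Real.norm_eq_abs]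
    have := abs_add_abs_le_two_mul_norm p q
    nlinarith
  rw [regularFluxDensity, beamKernel, norm_mul, norm_div]
  by_cases hz : ‖(p : ℂ) - q * I‖ = 0
  · rw [hz, div_zero, zero_mul]; positivity
  · have hz' : 0 < ‖(p : ℂ) - q * I‖ := lt_of_le_of_ne (norm_nonneg _) (Ne.symm hz)
    calc ‖g (τ - (p - q * I))‖ / ‖(p : ℂ) - q * I‖
          * ‖(oblateGradP e f a p q : ℂ) + I * oblateGradQ e f a p q‖
        ≤ max M 0 / ‖(p : ℂ) - q * I‖ * (4 * C * ‖(p : ℂ) - q * I‖) := by gcongr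
      _ = max M 0 * (4 * C) := by field_simp

theorem continuousOn_oblateGradP_snd (ha : 0 < a) (p : ℝ) :
    ContinuousOn (fun q => oblateGradP e f a p q) (Ioo (-a) a) :=
  (continuousOn_oblateGradP e f ha).comp (f := fun q : ℝ => (p, q)) (by fun_prop)
    fun _ hq => abs_lt.2 hq

theorem continuousOn_oblateGradQ_snd (ha : 0 < a) (p : ℝ) :
    ContinuousOn (fun q => oblateGradQ e f a p q) (Ioo (-a) a) :=
  (continuousOn_oblateGradQ e f ha).comp (f := fun q : ℝ => (p, q)) (by fun_prop)
    fun _ hq => abs_lt.2 hq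

theorem uIoc_neg_self (ha : 0 < a) : uIoc (-a) a = Ioc (-a) a := uIoc_of_le (by linarith)

theorem aestronglyMeasurable_restrict_uIoc {k : ℝ → ℂ} (ha : 0 < a)
    (hk : AEStronglyMeasurable k (volume.restrict (Ioo (-a) a))) :
    AEStronglyMeasurable k (volume.restrict (uIoc (-a) a)) := by
  rwa [uIoc_neg_self ha, ← Measure.restrict_congr_set Ioo_ae_eq_Ioc]

theorem aestronglyMeasurable_regularFluxDensity (ha : 0 < a)
    (hg : DifferentiableOn ℂ g {τ | τ.im ≠ 0}) (hτ : a < |τ.im|) (p : ℝ) :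
    AEStronglyMeasurable (fun q => regularFluxDensity e f g τ a p q)
      (volume.restrict (uIoc (-a) a)) := by
  refine aestronglyMeasurable_restrict_uIoc ha ?_
  have h1 : ContinuousOn (fun q : ℝ => g (τ - (p - q * I))) (Ioo (-a) a) := fun q hq => by
    have hc := (hasDerivAt_comp_const_sub hg (im_sub_ne_zero_of_abs_le (z := p - q * I) hτ
      (by rw [abs_im_ofReal_sub]; exact (abs_lt.2 hq).le))).continuousAt
    exact (hc.comp (f := fun q : ℝ => (p : ℂ) - q * I) (by fun_prop)).continuousWithinAt
  have h2 : Measurable fun q : ℝ => (p : ℂ) - q * I := by fun_prop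
  have h3 := continuous_ofReal.comp_continuousOn (continuousOn_oblateGradP_snd e f ha p)
  have h4 := continuous_ofReal.comp_continuousOn (continuousOn_oblateGradQ_snd e f ha p)
  have h5 := (h3.add (h4.const_mul I)).aestronglyMeasurable (μ := volume) measurableSet_Ioo
  simp only [regularFluxDensity, beamKernel, div_eq_mul_inv]
  exact ((h1.aestronglyMeasurable measurableSet_Ioo).mul h2.inv.aestronglyMeasurable).mul h5

theorem ae_mem_uIoc_imp {P : ℝ → Prop} (ha : 0 < a) (h : ∀ q, |q| < a → q ≠ 0 → P q) :
    ∀ᵐ q : ℝ, q ∈ uIoc (-a) a → P q := by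
  have h1 : ∀ᵐ q : ℝ, q ≠ a := by simp [ae_iff, measure_singleton]
  have h2 : ∀ᵐ q : ℝ, q ≠ 0 := by simp [ae_iff, measure_singleton]
  filter_upwards [h1, h2] with q hq1 hq2 hq
  rw [uIoc_neg_self ha] at hq
  exact h q (abs_lt.2 ⟨hq.1, lt_of_le_of_ne hq.2 hq1⟩) hq2

theorem intervalIntegrable_of_bounded {k : ℝ → ℂ} {C : ℝ} (ha : 0 < a)
    (hk : AEStronglyMeasurable k (volume.restrict (uIoc (-a) a))) (hC : ∀ q, |q| < a → ‖k q‖ ≤ C) :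
    IntervalIntegrable k volume (-a) a := by
  rw [intervalIntegrable_iff]
  refine Integrable.mono' (g := fun _ => C) (integrableOn_const (by simp [uIoc_neg_self ha])) hk ?_
  rw [ae_restrict_iff' measurableSet_uIoc]
  exact ae_mem_uIoc_imp ha fun q hq _ => hC q hq

theorem intervalIntegrable_regularFluxDensity (ha : 0 < a)
    (hg : DifferentiableOn ℂ g {τ | τ.im ≠ 0}) (hτ : a < |τ.im|) {p : ℝ} (hp : 0 ≤ p) :
    IntervalIntegrable (fun q => regularFluxDensity e f g τ a p q) volume (-a) a := by
  obtain ⟨C, hC⟩ := exists_norm_regularFluxDensity_le e f ha hg hτ p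
  exact intervalIntegrable_of_bounded ha (aestronglyMeasurable_regularFluxDensity e f ha hg hτ p)
    fun q hq => hC p q hp le_rfl hq

theorem continuousAt_beamKernel_line (hg : DifferentiableOn ℂ g {τ | τ.im ≠ 0}) (hτ : a < |τ.im|)
    {p q : ℝ} (hq : |q| ≤ a) (hpq : (p : ℂ) - q * I ≠ 0) :
    ContinuousAt (fun p : ℝ => beamKernel g τ (p - q * I)) p := by
  have hc := (hasDerivAt_beamKernel hg (im_sub_ne_zero_of_abs_le (z := p - q * I) hτ
    (by rwa [abs_im_ofReal_sub])) hpq).continuousAt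
  exact hc.comp (f := fun p : ℝ => (p : ℂ) - q * I) (by fun_prop)

theorem ofReal_sub_ne_zero_of_right {p q : ℝ} (hq : q ≠ 0) : (p : ℂ) - q * I ≠ 0 := fun h =>
  hq (by simpa using congrArg Complex.im h)

theorem ofReal_sub_ne_zero_of_left {p q : ℝ} (hp : p ≠ 0) : (p : ℂ) - q * I ≠ 0 := fun h =>
  hp (by simpa using congrArg Complex.re h)

/-- Dominated convergence in `q`; the integrand is continuous in `p` up to `p = 0` except for
`q = 0`. -/
theorem continuousOn_regularFlux (ha : 0 < a) (hg : DifferentiableOn ℂ g {τ | τ.im ≠ 0})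
    (hτ : a < |τ.im|) : ContinuousOn (regularFlux e f g τ a) (Ici 0) := by
  intro p₀ hp₀
  have hmean : ∀ q, ContinuousAt (fun p : ℝ => ((oblateMean e a f p q : ℝ) : ℂ)) p₀ := fun q =>
    (continuous_ofReal.comp ((continuous_oblateMean e f).comp
      (continuous_id.prodMk continuous_const : Continuous fun p : ℝ => (p, q)))).continuousAt
  have hb1 := continuousAt_beamKernel_line (p := p₀) (q := a) hg hτ (abs_of_pos ha).le
    (ofReal_sub_ne_zero_of_right ha.ne')
  have hb2 := continuousAt_beamKernel_line (p := p₀) (q := -a) hg hτ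
    (by rw [abs_neg, abs_of_pos ha]) (ofReal_sub_ne_zero_of_right (neg_ne_zero.2 ha.ne'))
  have hb2' : ContinuousAt (fun p : ℝ => beamKernel g τ (p + a * I)) p₀ := by
    simpa [sub_neg_eq_add] using hb2
  refine ContinuousWithinAt.add
    (((((hmean a).mul hb1).sub ((hmean (-a)).mul hb2')).const_mul (-I)).continuousWithinAt) ?_
  obtain ⟨C, hC⟩ := exists_norm_regularFluxDensity_le e f ha hg hτ (p₀ + 1)
  refine intervalIntegral.continuousWithinAt_of_dominated_interval (bound := fun _ => C)
    (Eventually.of_forall fun p => aestronglyMeasurable_regularFluxDensity e f ha hg hτ p) ?_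
    intervalIntegrable_const ?_
  · have h1 : ∀ᶠ p in 𝓝[Ici 0] p₀, p ≤ p₀ + 1 :=
      mem_nhdsWithin_of_mem_nhds (Iic_mem_nhds (by linarith))
    filter_upwards [h1, self_mem_nhdsWithin] with p hp hp0
    exact ae_mem_uIoc_imp ha fun q hq _ => hC p q hp0 hp hq
  · refine ae_mem_uIoc_imp ha fun q hq hq0 => ContinuousAt.continuousWithinAt ?_
    have hopen : {z : ℝ × ℝ | |z.2| < a} ∈ 𝓝 (p₀, q) :=
      (isOpen_lt (continuous_snd.abs) continuous_const).mem_nhds hq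
    have hP : ContinuousAt (fun p => oblateGradP e f a p q) p₀ :=
      ((continuousOn_oblateGradP e f ha).continuousAt hopen).comp (f := fun p : ℝ => (p, q))
        (by fun_prop)
    have hQ : ContinuousAt (fun p => oblateGradQ e f a p q) p₀ :=
      ((continuousOn_oblateGradQ e f ha).continuousAt hopen).comp (f := fun p : ℝ => (p, q))
        (by fun_prop)
    exact (continuousAt_beamKernel_line hg hτ hq.le (ofReal_sub_ne_zero_of_right hq0)).mul
      ((continuous_ofReal.continuousAt.comp hP).add
        ((continuous_ofReal.continuousAt.comp hQ).const_mul I))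

end FluxLimit

section FluxParts

variable {g : ℂ → ℂ} {τ : ℂ} {a : ℝ} (e : OrthonormalBasis (Fin 3) ℝ Space) (f : SpaceTest)

theorem hasDerivAt_beamKernel_snd (hg : DifferentiableOn ℂ g {τ | τ.im ≠ 0})
    (hτ : a < |τ.im|) {p q : ℝ} (hp : p ≠ 0) (hq : |q| ≤ a) :
    HasDerivAt (fun q : ℝ => beamKernel g τ (p - q * I))
      (beamKernelDeriv g τ (p - q * I) * -I) q := by
  have h1 := hasDerivAt_beamKernel hg (im_sub_ne_zero_of_abs_le (z := p - q * I) hτ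
    (by rwa [abs_im_ofReal_sub])) (ofReal_sub_ne_zero_of_left hp)
  have h0 : HasDerivAt (fun q : ℝ => (q : ℂ)) 1 q := (hasDerivAt_id q).ofReal_comp
  have h2 : HasDerivAt (fun q : ℝ => (p : ℂ) - q * I) (-I) q :=
    ((h0.mul_const I).const_sub (p : ℂ)).congr_deriv (by rw [one_mul])
  exact HasDerivAt.comp (h := fun q : ℝ => (p : ℂ) - q * I) q h1 h2

theorem continuousOn_beamKernelDeriv_snd (hg : DifferentiableOn ℂ g {τ | τ.im ≠ 0})
    (hτ : a < |τ.im|) {p : ℝ} (hp : p ≠ 0) :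
    ContinuousOn (fun q : ℝ => beamKernelDeriv g τ (p - q * I)) (Icc (-a) a) := fun q hq => by
  have h1 := (hasDerivAt_beamKernelDeriv hg (im_sub_ne_zero_of_abs_le (z := p - q * I) hτ
    (by rw [abs_im_ofReal_sub]; exact abs_le.2 hq)) (ofReal_sub_ne_zero_of_left hp)).continuousAt
  exact (h1.comp (f := fun q : ℝ => (p : ℂ) - q * I) (by fun_prop)).continuousWithinAt

theorem continuousOn_beamKernel_snd (hg : DifferentiableOn ℂ g {τ | τ.im ≠ 0})
    (hτ : a < |τ.im|) {p : ℝ} (hp : p ≠ 0) :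
    ContinuousOn (fun q : ℝ => beamKernel g τ (p - q * I)) (Icc (-a) a) := fun _ hq =>
  (hasDerivAt_beamKernel_snd hg hτ hp (abs_le.2 hq)).continuousAt.continuousWithinAt

theorem continuous_oblateMean_snd (p : ℝ) :
    Continuous fun q : ℝ => ((oblateMean e a f p q : ℝ) : ℂ) := by
  have h := (continuous_oblateMean (a := a) e f).comp
    (continuous_const.prodMk continuous_id : Continuous fun q : ℝ => (p, q))
  exact continuous_ofReal.comp h

theorem intervalIntegrable_oblateGradP (ha : 0 < a) (p : ℝ) :
    IntervalIntegrable (fun q : ℝ => ((oblateGradP e f a p q : ℝ) : ℂ)) volume (-a) a := by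
  obtain ⟨C, hC0, hC⟩ := exists_abs_oblateGrad_le e f ha |p|
  refine intervalIntegrable_of_bounded (C := C * (|p| + a)) ha
    (aestronglyMeasurable_restrict_uIoc ha ((continuous_ofReal.comp_continuousOn
      (continuousOn_oblateGradP_snd e f ha p)).aestronglyMeasurable measurableSet_Ioo)) fun q hq => ?_
  rw [norm_real]
  exact ((hC p q le_rfl hq).1).trans (by gcongr)

theorem intervalIntegrable_oblateGradQ (ha : 0 < a) (p : ℝ) :
    IntervalIntegrable (fun q : ℝ => ((oblateGradQ e f a p q : ℝ) : ℂ)) volume (-a) a := by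
  obtain ⟨C, hC0, hC⟩ := exists_abs_oblateGrad_le e f ha |p|
  refine intervalIntegrable_of_bounded (C := C * (|p| + a)) ha
    (aestronglyMeasurable_restrict_uIoc ha ((continuous_ofReal.comp_continuousOn
      (continuousOn_oblateGradQ_snd e f ha p)).aestronglyMeasurable measurableSet_Ioo)) fun q hq => ?_
  rw [norm_real]
  exact ((hC p q le_rfl hq).2).trans (by gcongr)

theorem integral_oblateMean_mul_beamKernelDeriv (ha : 0 < a)
    (hg : DifferentiableOn ℂ g {τ | τ.im ≠ 0}) (hτ : a < |τ.im|) {p : ℝ} (hp : 0 < p) :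
    ∫ q in (-a)..a, (oblateMean e a f p q : ℂ) * (beamKernelDeriv g τ (p - q * I) * -I)
      = oblateMean e a f p a * beamKernel g τ (p - a * I)
        - oblateMean e a f p (-a) * beamKernel g τ (p + a * I)
        - ∫ q in (-a)..a, (oblateGradQ e f a p q : ℂ) * beamKernel g τ (p - q * I) := by
  have hle : -a ≤ a := by linarith
  have hU : uIcc (-a) a = Icc (-a) a := uIcc_of_le hle
  have hparts := intervalIntegral.integral_mul_deriv_eq_deriv_mul_of_hasDerivAt
    (u := fun q : ℝ => ((oblateMean e a f p q : ℝ) : ℂ))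
    (u' := fun q : ℝ => ((oblateGradQ e f a p q : ℝ) : ℂ))
    (v := fun q : ℝ => beamKernel g τ (p - q * I))
    (v' := fun q : ℝ => beamKernelDeriv g τ (p - q * I) * -I) (a := -a) (b := a)
    (continuous_oblateMean_snd e f p).continuousOn
    (by rw [hU]; exact continuousOn_beamKernel_snd hg hτ hp.ne') (fun q hq => by
      rw [min_eq_left hle, max_eq_right hle] at hq
      exact (hasDerivAt_oblateMean_snd e f ha (abs_lt.2 hq)).ofReal_comp) (fun q hq => by
      rw [min_eq_left hle, max_eq_right hle] at hq
      exact hasDerivAt_beamKernel_snd hg hτ hp.ne' (abs_lt.2 hq).le)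
    (intervalIntegrable_oblateGradQ e f ha p)
    (((continuousOn_beamKernelDeriv_snd hg hτ hp.ne').mul continuousOn_const).mono
      hU.le).intervalIntegrable
  rw [hparts]
  have hneg : (p : ℂ) - ((-a : ℝ) : ℂ) * I = p + a * I := by push_cast; ring
  simp only [hneg]

/-- Integration by parts in `q`: the kernel depends on `p - iq` only, so that its derivative can be
moved to the mean of the test function. -/
theorem oblateFlux_eq_regularFlux (ha : 0 < a) (hg : DifferentiableOn ℂ g {τ | τ.im ≠ 0})
    (hτ : a < |τ.im|) {p : ℝ} (hp : 0 < p) :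
    oblateFlux e a (beamKernel g τ) (beamKernelDeriv g τ) f p = regularFlux e f g τ a p := by
  have hU : uIcc (-a) a = Icc (-a) a := uIcc_of_le (by linarith)
  have hch : ContinuousOn (fun q : ℝ => beamKernel g τ (p - q * I)) (uIcc (-a) a) := by
    rw [hU]; exact continuousOn_beamKernel_snd hg hτ hp.ne'
  have hm1 : IntervalIntegrable (fun q : ℝ => beamKernel g τ (p - q * I) * oblateGradP e f a p q)
      volume (-a) a := (intervalIntegrable_oblateGradP e f ha p).continuousOn_mul hch
  have hm2 : IntervalIntegrable
      (fun q : ℝ => oblateMean e a f p q * beamKernelDeriv g τ (p - q * I)) volume (-a) a :=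
    (((continuous_oblateMean_snd e f p).continuousOn.mul
      (continuousOn_beamKernelDeriv_snd hg hτ hp.ne')).mono hU.le).intervalIntegrable
  have hm3 : IntervalIntegrable (fun q : ℝ => oblateGradQ e f a p q * beamKernel g τ (p - q * I))
      volume (-a) a := (intervalIntegrable_oblateGradQ e f ha p).mul_continuousOn hch
  have hI : (∫ q in (-a)..a, (oblateMean e a f p q : ℂ) * (beamKernelDeriv g τ (p - q * I) * -I))
      = -I * ∫ q in (-a)..a, oblateMean e a f p q * beamKernelDeriv g τ (p - q * I) := by
    rw [← intervalIntegral.integral_const_mul]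
    exact intervalIntegral.integral_congr fun q _ => by ring
  have hR : (∫ q in (-a)..a, regularFluxDensity e f g τ a p q)
      = (∫ q in (-a)..a, beamKernel g τ (p - q * I) * oblateGradP e f a p q)
        + I * ∫ q in (-a)..a, oblateGradQ e f a p q * beamKernel g τ (p - q * I) := by
    rw [← intervalIntegral.integral_const_mul,
      ← intervalIntegral.integral_add hm1 (hm3.const_mul I)]
    exact intervalIntegral.integral_congr fun q _ => by rw [regularFluxDensity]; ring
  have hparts := integral_oblateMean_mul_beamKernelDeriv e f ha hg hτ hp
  rw [hI] at hparts
  rw [oblateFlux, intervalIntegral.integral_sub hm1 hm2, regularFlux, hR]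
  linear_combination (-I) * hparts
    - (∫ q in (-a)..a, (oblateMean e a f p q : ℂ) * beamKernelDeriv g τ (p - q * I)) * I_sq

end FluxParts

/-! ### Removing the cutoff -/

section Cutoff

/-- A smooth function vanishing on `s ≤ 1` and equal to `1` on `s ≥ 2`. -/
noncomputable def cutoff (s : ℝ) : ℝ := Real.smoothTransition (s - 1)

theorem contDiff_cutoff : ContDiff ℝ ∞ cutoff :=
  Real.smoothTransition.contDiff.comp (contDiff_id.sub contDiff_const)

theorem cutoff_of_le_one {s : ℝ} (hs : s ≤ 1) : cutoff s = 0 :=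
  Real.smoothTransition.zero_of_nonpos (by linarith)

theorem cutoff_of_two_le {s : ℝ} (hs : 2 ≤ s) : cutoff s = 1 :=
  Real.smoothTransition.one_of_one_le (by linarith)

theorem abs_cutoff_le (s : ℝ) : |cutoff s| ≤ 1 := by
  rw [cutoff, abs_of_nonneg (Real.smoothTransition.nonneg _)]
  exact Real.smoothTransition.le_one _

theorem continuous_deriv_cutoff : Continuous (deriv cutoff) :=
  contDiff_cutoff.continuous_deriv (by simp)

theorem deriv_cutoff_of_two_lt {s : ℝ} (hs : 2 < s) : deriv cutoff s = 0 := by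
  have : cutoff =ᶠ[𝓝 s] fun _ => 1 :=
    (eventually_gt_nhds hs).mono fun s' hs' => cutoff_of_two_le hs'.le
  rw [this.deriv_eq, deriv_const]

theorem integral_deriv_cutoff : ∫ s in (0 : ℝ)..2, deriv cutoff s = 1 := by
  rw [intervalIntegral.integral_deriv_eq_sub
    (fun s _ => (contDiff_cutoff.differentiable (by simp)) s)
    (continuous_deriv_cutoff.intervalIntegrable _ _), cutoff_of_two_le le_rfl,
    cutoff_of_le_one zero_le_one, sub_zero]

theorem deriv_cutoff_div (δ p : ℝ) :
    deriv (fun s => cutoff (s / δ)) p = δ⁻¹ * deriv cutoff (p / δ) := by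
  simp only [div_eq_mul_inv, mul_comm _ δ⁻¹]
  exact deriv_comp_mul_left δ⁻¹ cutoff p

theorem integral_deriv_cutoff_mul {δ : ℝ} (hδ : 0 < δ) (k : ℝ → ℂ) :
    ∫ p in Ioi (0 : ℝ), ((deriv (fun s => cutoff (s / δ)) p : ℝ) : ℂ) * k p
      = ∫ s in (0 : ℝ)..2, ((deriv cutoff s : ℝ) : ℂ) * k (max (δ * s) 0) := by
  have h := integral_comp_mul_left_Ioi
    (fun p => ((deriv (fun s => cutoff (s / δ)) p : ℝ) : ℂ) * k p) 0 hδ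
  -- after `p = δ s` the derivative of the cutoff lives on `1 ≤ s ≤ 2`, for every `δ`
  rw [mul_zero, eq_inv_smul_iff₀ hδ.ne', ← integral_smul] at h
  rw [← h, intervalIntegral.integral_of_le zero_le_two]
  rw [setIntegral_eq_of_subset_of_forall_sdiff_eq_zero measurableSet_Ioi
    (Ioc_subset_Ioi_self : Ioc (0 : ℝ) 2 ⊆ Ioi 0)]
  · refine setIntegral_congr_fun measurableSet_Ioc fun s hs => ?_
    have hs0 : 0 < δ * s := mul_pos hδ hs.1
    rw [deriv_cutoff_div, mul_div_cancel_left₀ _ hδ.ne', max_eq_left hs0.le, real_smul]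
    have : (δ : ℂ) ≠ 0 := ofReal_ne_zero.2 hδ.ne'
    push_cast
    field_simp
  · rintro s ⟨hs, hs'⟩
    have hs2 : 2 < s := by
      by_contra hcon
      exact hs' ⟨hs, not_lt.1 hcon⟩
    rw [deriv_cutoff_div, mul_div_cancel_left₀ _ hδ.ne', deriv_cutoff_of_two_lt hs2]
    simp

/-- The derivatives of the dilated cutoffs concentrate at `0`. -/
theorem tendsto_integral_deriv_cutoff_mul {k : ℝ → ℂ} (hk : ContinuousOn k (Ici 0)) :
    Tendsto (fun δ : ℝ => ∫ p in Ioi (0 : ℝ),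
      ((deriv (fun s => cutoff (s / δ)) p : ℝ) : ℂ) * k p) (𝓝[>] 0) (𝓝 (k 0)) := by
  have hk' : Continuous fun z : ℝ × ℝ => k (max (z.1 * z.2) 0) :=
    hk.comp_continuous (by fun_prop) fun z => mem_Ici.2 (le_max_right _ _)
  have hc : Continuous fun δ : ℝ =>
      ∫ s in (0 : ℝ)..2, ((deriv cutoff s : ℝ) : ℂ) * k (max (δ * s) 0) :=
    intervalIntegral.continuous_parametric_intervalIntegral_of_continuous'
      ((continuous_ofReal.comp (continuous_deriv_cutoff.comp continuous_snd)).mul hk') _ _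
  have h0 : ∫ s in (0 : ℝ)..2, ((deriv cutoff s : ℝ) : ℂ) * k (max (0 * s) 0) = k 0 := by
    simp only [zero_mul, max_self]
    rw [intervalIntegral.integral_mul_const, intervalIntegral.integral_ofReal,
      integral_deriv_cutoff, ofReal_one, one_mul]
  have ht := (hc.tendsto 0).mono_left (nhdsWithin_le_nhds (s := Ioi 0))
  rw [h0] at ht
  refine ht.congr' ?_
  filter_upwards [self_mem_nhdsWithin] with δ hδ
  exact (integral_deriv_cutoff_mul hδ k).symm

end Cutoff

section Source

variable {g : ℂ → ℂ} {y : Space} {u : ℝ}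

theorem tendsto_cutoff_div {p : ℝ} (hp : 0 < p) :
    Tendsto (fun δ : ℝ => cutoff (p / δ)) (𝓝[>] 0) (𝓝 1) := by
  refine tendsto_const_nhds.congr' ?_
  filter_upwards [Ioo_mem_nhdsGT (half_pos hp)] with δ hδ
  rw [cutoff_of_two_le]
  rw [le_div_iff₀ hδ.1]
  linarith [hδ.2]

/-- The integrand of Green's identity for the beam kernel is, on the support of the cutoff, the
integrand of the source. The factor `4π` comes from the normalization of the beam. -/
theorem cutoff_mul_wave (t δ : ℝ) (f : SpaceTest) (x : Space) (hδ : 0 < δ) :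
    (cutoff ((complexDist y x).re / δ) : ℂ)
        * (beamKernel g (t - u * I) (complexDist y x) * testLaplacian f x
          - f x * (beamKernelDeriv₂ g (t - u * I) (complexDist y x)
            + 2 * beamKernelDeriv g (t - u * I) (complexDist y x) / complexDist y x))
      = (cutoff ((complexDist y x).re / δ) : ℂ)
        * (4 * Real.pi * (testLaplacian f x • shieldedBeam g y u 0 (x, t)
          - f x • shieldedBeam (deriv (deriv g)) y u 0 (x, t))) := by
  by_cases hp : 0 < (complexDist y x).re
  · have hne : complexDist y x ≠ 0 := fun h => by simp [h] at hp
    have hpi : (Real.pi : ℂ) ≠ 0 := ofReal_ne_zero.2 Real.pi_ne_zero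
    rw [beamKernelDeriv₂_add hne]
    simp only [shieldedBeam, zero_mul, hp, if_true, beam, beamKernel, real_smul]
    field_simp
  · rw [cutoff_of_le_one (by
      rw [div_le_one hδ]; exact (not_lt.1 hp).trans hδ.le)]
    simp

theorem tendsto_integral_cutoff_mul_wave (hy : y ≠ 0) (hu : ‖y‖ < |u|)
    (hg : DifferentiableOn ℂ g {τ | τ.im ≠ 0}) (t : ℝ) (f : SpaceTest) :
    Tendsto (fun δ : ℝ => ∫ x, (cutoff ((complexDist y x).re / δ) : ℂ)
        * (beamKernel g (t - u * I) (complexDist y x) * testLaplacian f x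
          - f x * (beamKernelDeriv₂ g (t - u * I) (complexDist y x)
            + 2 * beamKernelDeriv g (t - u * I) (complexDist y x) / complexDist y x)))
      (𝓝[>] 0) (𝓝 (-(4 * Real.pi * shieldedSourceAt g y u 0 t f))) := by
  have hg'' := differentiableOn_deriv_im_ne_zero (differentiableOn_deriv_im_ne_zero hg)
  have hi1 := integrable_test_smul_slice hy hu hg 0 t (testLaplacian f)
  have hi2 := integrable_test_smul_slice hy hu hg'' 0 t f
  have hi : Integrable fun x => 4 * (Real.pi : ℂ) * (testLaplacian f x • shieldedBeam g y u 0 (x, t)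
      - f x • shieldedBeam (deriv (deriv g)) y u 0 (x, t)) := (hi1.sub hi2).const_mul _
  have hval : -(4 * Real.pi * shieldedSourceAt g y u 0 t f)
      = ∫ x, 4 * (Real.pi : ℂ) * (testLaplacian f x • shieldedBeam g y u 0 (x, t)
        - f x • shieldedBeam (deriv (deriv g)) y u 0 (x, t)) := by
    rw [integral_const_mul, integral_sub hi1 hi2, shieldedSourceAt_apply hy hu hg]
    ring
  rw [hval]
  have hcut : ∀ δ : ℝ, Continuous fun x : Space => ((cutoff ((complexDist y x).re / δ) : ℝ) : ℂ) :=
    fun δ => continuous_ofReal.comp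
      (contDiff_cutoff.continuous.comp ((continuous_complexDist_re y).div_const δ))
  have hlim : Tendsto (fun δ : ℝ => ∫ x, (cutoff ((complexDist y x).re / δ) : ℂ)
        * (4 * Real.pi * (testLaplacian f x • shieldedBeam g y u 0 (x, t)
          - f x • shieldedBeam (deriv (deriv g)) y u 0 (x, t)))) (𝓝[>] 0)
      (𝓝 (∫ x, 4 * (Real.pi : ℂ) * (testLaplacian f x • shieldedBeam g y u 0 (x, t)
        - f x • shieldedBeam (deriv (deriv g)) y u 0 (x, t)))) := by
    refine tendsto_integral_filter_of_dominated_convergence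
      (fun x => ‖4 * (Real.pi : ℂ) * (testLaplacian f x • shieldedBeam g y u 0 (x, t)
        - f x • shieldedBeam (deriv (deriv g)) y u 0 (x, t))‖)
      (Eventually.of_forall fun δ => (hcut δ).aestronglyMeasurable.mul hi.aestronglyMeasurable)
      (Eventually.of_forall fun δ => Eventually.of_forall fun x => ?_) hi.norm
      (Eventually.of_forall fun x => ?_)
    · rw [norm_mul, norm_real]
      exact mul_le_of_le_one_left (norm_nonneg _) (abs_cutoff_le _)
    · by_cases hp : 0 < (complexDist y x).re
      · have h1 := (continuous_ofReal.tendsto 1).comp (tendsto_cutoff_div hp)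
        simpa using h1.mul_const (4 * (Real.pi : ℂ) *
          (testLaplacian f x • shieldedBeam g y u 0 (x, t)
            - f x • shieldedBeam (deriv (deriv g)) y u 0 (x, t)))
      · simp [shieldedBeam, hp]
  refine hlim.congr' ?_
  filter_upwards [self_mem_nhdsWithin] with δ hδ
  exact integral_congr_ae (Eventually.of_forall fun x => (cutoff_mul_wave t δ f x hδ).symm)

/-- The unshielded source is the limit of the flux through the spheroids collapsing to the branch
disk. -/
theorem shieldedSourceAt_zero_eq_regularFlux (e : OrthonormalBasis (Fin 3) ℝ Space) (hy : y ≠ 0)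
    (he : y = ‖y‖ • e 2) (hu : ‖y‖ < |u|) (hg : DifferentiableOn ℂ g {τ | τ.im ≠ 0}) (t : ℝ)
    (f : SpaceTest) :
    shieldedSourceAt g y u 0 t f = ‖y‖ / 2 * regularFlux e f g (t - u * I) ‖y‖ 0 := by
  have ha : 0 < ‖y‖ := norm_pos_iff.2 hy
  have hτ : ‖y‖ < |((t : ℂ) - u * I).im| := by simpa using hu
  have hne : ∀ z : ℂ, 0 < z.re → z ≠ 0 := fun z hz h => by simp [h] at hz
  have hflux : ∀ δ : ℝ, 0 < δ → ∫ x, (cutoff ((complexDist y x).re / δ) : ℂ)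
        * (beamKernel g (t - u * I) (complexDist y x) * testLaplacian f x
          - f x * (beamKernelDeriv₂ g (t - u * I) (complexDist y x)
            + 2 * beamKernelDeriv g (t - u * I) (complexDist y x) / complexDist y x))
      = -(2 * Real.pi / ‖y‖ * ∫ p in Ioi (0 : ℝ),
          ((deriv (fun s => cutoff (s / δ)) p : ℝ) : ℂ)
            * ((p ^ 2 + ‖y‖ ^ 2 : ℝ) * regularFlux e f g (t - u * I) ‖y‖ p)) := by
    intro δ hδ
    have hη : ContDiff ℝ ∞ fun s => cutoff (s / δ) :=
      contDiff_cutoff.comp (contDiff_id.div_const δ)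
    have hη0 : ∀ s ≤ δ, cutoff (s / δ) = 0 := fun s hs =>
      cutoff_of_le_one ((div_le_one hδ).2 hs)
    have hh : ∀ z : ℂ, 0 < z.re → |z.im| ≤ ‖y‖ → HasDerivAt (beamKernel g (t - u * I))
        (beamKernelDeriv g (t - u * I) z) z := fun z hz hz' =>
      hasDerivAt_beamKernel hg (im_sub_ne_zero_of_abs_le hτ hz') (hne z hz)
    have hh₁ : ∀ z : ℂ, 0 < z.re → |z.im| ≤ ‖y‖ → HasDerivAt (beamKernelDeriv g (t - u * I))
        (beamKernelDeriv₂ g (t - u * I) z) z := fun z hz hz' =>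
      hasDerivAt_beamKernelDeriv hg (im_sub_ne_zero_of_abs_le hτ hz') (hne z hz)
    rw [green_cutoff hδ hη hη0 hh hh₁ (fun z hz hz' =>
      continuousAt_beamKernelDeriv₂ hg (im_sub_ne_zero_of_abs_le hτ hz') (hne z hz)) f,
      integral_cutoff_flux e hy he hδ hη hη0 (fun z hz hz' => (hh z hz hz').continuousAt)
        (fun z hz hz' => (hh₁ z hz hz').continuousAt) f]
    congr 2
    refine setIntegral_congr_fun measurableSet_Ioi fun p hp => ?_
    rw [oblateFlux_eq_regularFlux e f ha hg hτ hp, mul_assoc]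
  have hk : ContinuousOn (fun p : ℝ => ((p ^ 2 + ‖y‖ ^ 2 : ℝ) : ℂ)
      * regularFlux e f g (t - u * I) ‖y‖ p) (Ici 0) :=
    (Continuous.continuousOn (by fun_prop)).mul (continuousOn_regularFlux e f ha hg hτ)
  have h1 := tendsto_integral_cutoff_mul_wave hy hu hg t f
  have h2 := ((tendsto_integral_deriv_cutoff_mul hk).const_mul (2 * Real.pi / ‖y‖ : ℂ)).neg
  have h3 := tendsto_nhds_unique (h1.congr' (by
    filter_upwards [self_mem_nhdsWithin] with δ hδ
    exact hflux δ hδ)) h2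
  have hpi : (Real.pi : ℂ) ≠ 0 := ofReal_ne_zero.2 Real.pi_ne_zero
  have ha' : (‖y‖ : ℂ) ≠ 0 := ofReal_ne_zero.2 ha.ne'
  push_cast at h3
  field_simp at h3
  refine mul_left_cancel₀ ha' ?_
  linear_combination (-1 / 4) * h3

end Source

/-! ### The source in oblate spheroidal coordinates -/

section Disk

variable {g : ℂ → ℂ} {τ : ℂ} {y : Space} {u : ℝ} {a : ℝ} (e : OrthonormalBasis (Fin 3) ℝ Space)
  (f : SpaceTest)

/-- The density of the source in the coordinate `q ∈ (0, a)` of the branch disk. -/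
noncomputable def diskDensity (g : ℂ → ℂ) (τ : ℂ) (a q : ℝ) : ℂ :=
  avg g τ q * (I / a * meanAxialDeriv e f √(a ^ 2 - q ^ 2) 0
    + meanRadialDeriv e f √(a ^ 2 - q ^ 2) 0 / (√(a ^ 2 - q ^ 2) : ℝ))

/-- On the branch disk `p = 0` the factor `q` of the gradient cancels the kernel's `1 / q`. -/
theorem regularFluxDensity_zero (ha : 0 < a) {q : ℝ} (hq : q ≠ 0) :
    regularFluxDensity e f g τ a 0 q = g (τ + I * q)
      * (I / a * meanAxialDeriv e f √(a ^ 2 - q ^ 2) 0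
        + meanRadialDeriv e f √(a ^ 2 - q ^ 2) 0 / (√(a ^ 2 - q ^ 2) : ℝ)) := by
  have hq' : (q : ℂ) ≠ 0 := ofReal_ne_zero.2 hq
  rw [regularFluxDensity, oblateGradP_zero e f ha, oblateGradQ_zero e f ha, beamKernel, ofReal_zero,
    zero_sub, sub_neg_eq_add, mul_comm (q : ℂ) I]
  push_cast
  generalize (√(a ^ 2 - q ^ 2) : ℂ) = r
  have h1 : g (τ + I * q) / -(I * q) = g (τ + I * q) * I / q := by
    field_simp
    rw [I_sq]
    ring
  rw [h1]
  field_simp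
  linear_combination
    (-g (τ + I * q) * (meanRadialDeriv e f √(a ^ 2 - q ^ 2) 0 : ℂ) / r) * I_sq

/-- The two sides `±q` of the branch disk combine into the average of `g`. -/
theorem regularFluxDensity_add_neg (ha : 0 < a) {q : ℝ} (hq : q ≠ 0) :
    regularFluxDensity e f g τ a 0 q + regularFluxDensity e f g τ a 0 (-q)
      = 2 * diskDensity e f g τ a q := by
  rw [regularFluxDensity_zero e f ha hq, regularFluxDensity_zero e f ha (neg_ne_zero.2 hq),
    diskDensity, avg, neg_sq, ofReal_neg, mul_neg, ← sub_eq_add_neg]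
  ring

theorem oblateMean_zero_left : oblateMean e a f 0 a = f 0 := by
  simp [oblateMean, cylMean_zero_zero]

theorem oblateMean_zero_left_neg : oblateMean e a f 0 (-a) = f 0 := by
  simp [oblateMean, cylMean_zero_zero]

/-- The boundary terms of the integration by parts come from the centre `q = ±a` of the disk; they
produce the point source. -/
theorem beamKernel_boundary (ha : 0 < a) :
    -I * (beamKernel g τ (0 - a * I) - beamKernel g τ (0 + a * I)) = 2 / a * avg g τ a := by
  have ha' : (a : ℂ) ≠ 0 := ofReal_ne_zero.2 ha.ne'
  rw [beamKernel, beamKernel, avg, zero_sub, zero_add, sub_neg_eq_add, mul_comm (a : ℂ) I]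
  field_simp
  ring

theorem ae_uIoc_add_neg (ha : 0 < a) : ∀ᵐ q : ℝ, q ∈ uIoc 0 a →
    regularFluxDensity e f g τ a 0 q + regularFluxDensity e f g τ a 0 (-q)
      = 2 * diskDensity e f g τ a q := by
  refine Eventually.of_forall fun q hq => regularFluxDensity_add_neg e f ha ?_
  rw [uIoc_of_le ha.le] at hq
  exact hq.1.ne'

theorem intervalIntegrable_regularFluxDensity_half (ha : 0 < a)
    (hg : DifferentiableOn ℂ g {τ | τ.im ≠ 0}) (hτ : a < |τ.im|) :
    IntervalIntegrable (fun q => regularFluxDensity e f g τ a 0 q) volume 0 a ∧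
      IntervalIntegrable (fun q => regularFluxDensity e f g τ a 0 (-q)) volume 0 a := by
  have h := intervalIntegrable_regularFluxDensity e f ha hg hτ le_rfl
  constructor
  · refine h.mono_set ?_
    rw [uIcc_of_le ha.le, uIcc_of_le (by linarith)]
    exact Icc_subset_Icc (by linarith) le_rfl
  · have h' : IntervalIntegrable (fun q => regularFluxDensity e f g τ a 0 q) volume (-0) (-a) := by
      refine h.mono_set ?_
      rw [neg_zero, uIcc_of_ge (by linarith), uIcc_of_le (by linarith)]
      exact Icc_subset_Icc le_rfl (by linarith)
    simpa using IntervalIntegrable.comp_sub_left h' 0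

theorem intervalIntegrable_diskDensity (ha : 0 < a)
    (hg : DifferentiableOn ℂ g {τ | τ.im ≠ 0}) (hτ : a < |τ.im|) :
    IntervalIntegrable (diskDensity e f g τ a) volume 0 a := by
  obtain ⟨h1, h2⟩ := intervalIntegrable_regularFluxDensity_half e f ha hg hτ
  have h3 := (h1.add h2).const_mul (1 / 2 : ℂ)
  refine h3.congr_ae ?_
  rw [EventuallyEq, ae_restrict_iff' measurableSet_uIoc]
  filter_upwards [ae_uIoc_add_neg (g := g) (τ := τ) e f ha] with q hq hq'
  rw [hq hq']
  ring

theorem integral_regularFluxDensity_zero (ha : 0 < a)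
    (hg : DifferentiableOn ℂ g {τ | τ.im ≠ 0}) (hτ : a < |τ.im|) :
    ∫ q in (-a)..a, regularFluxDensity e f g τ a 0 q
      = 2 * ∫ q in (0 : ℝ)..a, diskDensity e f g τ a q := by
  obtain ⟨h1, h2⟩ := intervalIntegrable_regularFluxDensity_half e f ha hg hτ
  have h := intervalIntegrable_regularFluxDensity e f ha hg hτ le_rfl
  have h3 : IntervalIntegrable (fun q => regularFluxDensity e f g τ a 0 q) volume (-a) 0 := by
    refine h.mono_set ?_
    rw [uIcc_of_le (by linarith), uIcc_of_le (by linarith)]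
    exact Icc_subset_Icc le_rfl ha.le
  have hneg := intervalIntegral.integral_comp_neg (a := 0) (b := a)
    fun q => regularFluxDensity e f g τ a 0 q
  rw [neg_zero] at hneg
  rw [← intervalIntegral.integral_add_adjacent_intervals h3 h1, ← hneg, add_comm,
    ← intervalIntegral.integral_add h1 h2, ← intervalIntegral.integral_const_mul]
  exact intervalIntegral.integral_congr_ae (ae_uIoc_add_neg e f ha)

/-- The unshielded source as a point source plus an integral over the disk. -/
theorem shieldedSourceAt_zero_eq_diskDensity (hy : y ≠ 0)
    (he : y = ‖y‖ • e 2) (hu : ‖y‖ < |u|) (hg : DifferentiableOn ℂ g {τ | τ.im ≠ 0}) (t : ℝ) :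
    shieldedSourceAt g y u 0 t f = avg g (t - u * I) ‖y‖ * f 0
      + ‖y‖ * ∫ q in (0 : ℝ)..‖y‖, diskDensity e f g (t - u * I) ‖y‖ q := by
  have ha : 0 < ‖y‖ := norm_pos_iff.2 hy
  have hτ : ‖y‖ < |((t : ℂ) - u * I).im| := by simpa using hu
  have ha' : (‖y‖ : ℂ) ≠ 0 := ofReal_ne_zero.2 ha.ne'
  rw [shieldedSourceAt_zero_eq_regularFlux e hy he hu hg, regularFlux,
    integral_regularFluxDensity_zero e f ha hg hτ, oblateMean_zero_left e f,
    oblateMean_zero_left_neg e f, ofReal_zero, ← mul_sub, mul_left_comm,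
    beamKernel_boundary ha]
  field_simp

/-! ### The derivatives of the mean on the disk -/

theorem hasDerivAt_oblateMean_zero_fst (ha : 0 < a) {q : ℝ} (hq : |q| < a) :
    HasDerivAt (fun p => oblateMean e a f p q) (q / a * cylMeanXi e f √(a ^ 2 - q ^ 2) 0) 0 := by
  rw [cylMeanXi_eq, ← oblateGradP_zero e f ha]
  exact hasDerivAt_oblateMean_fst e f ha hq

theorem hasDerivAt_oblateMean_zero_snd (ha : 0 < a) {q : ℝ} (hq : |q| < a) :
    HasDerivAt (fun q' => oblateMean e a f 0 q')
      (-(q / √(a ^ 2 - q ^ 2)) * cylMeanRho e f √(a ^ 2 - q ^ 2) 0) q := by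
  rw [cylMeanRho_eq, ← oblateGradQ_zero e f ha]
  exact hasDerivAt_oblateMean_snd e f ha hq

theorem exists_abs_oblateMean_deriv_le (ha : 0 < a) : ∃ C : ℝ, ∀ q ∈ Ioo 0 a,
    |oblateMeanP e a f 0 q| ≤ C * q ∧ |oblateMeanQ e a f 0 q| ≤ C * q := by
  obtain ⟨C, -, hC⟩ := exists_abs_oblateGrad_le e f ha 0
  refine ⟨C, fun q hq => ?_⟩
  have hq' : |q| < a := by rw [abs_of_pos hq.1]; exact hq.2
  have h := hC 0 q (by simp) hq'
  rw [abs_zero, zero_add, abs_of_pos hq.1] at h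
  rwa [oblateMeanP, oblateMeanQ, (hasDerivAt_oblateMean_fst e f ha hq').deriv,
    (hasDerivAt_oblateMean_snd e f ha hq').deriv]

theorem oblate_density_eq (ha : 0 < a) {q : ℝ} (hq : q ∈ Ioo 0 a) :
    avg g τ q / q * (oblateMeanP e a f 0 q + I * oblateMeanQ e a f 0 q)
      = -I * diskDensity e f g τ a q := by
  have hq' : |q| < a := by rw [abs_of_pos hq.1]; exact hq.2
  have hq0 : (q : ℂ) ≠ 0 := ofReal_ne_zero.2 hq.1.ne'
  rw [oblateMeanP, oblateMeanQ, (hasDerivAt_oblateMean_fst e f ha hq').deriv,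
    (hasDerivAt_oblateMean_snd e f ha hq').deriv, oblateGradP_zero e f ha,
    oblateGradQ_zero e f ha, diskDensity]
  push_cast
  generalize (√(a ^ 2 - q ^ 2) : ℂ) = r
  field_simp
  linear_combination (avg g τ q * meanAxialDeriv e f √(a ^ 2 - q ^ 2) 0 / a) * I_sq

theorem oblate_formula (hy : y ≠ 0)
    (he : y = ‖y‖ • e 2) (hu : ‖y‖ < |u|) (hg : DifferentiableOn ℂ g {τ | τ.im ≠ 0}) (t : ℝ) :
    IntervalIntegrable (fun q : ℝ => avg g (t - u * I) q / q *
        (oblateMeanP e ‖y‖ f 0 q + I * oblateMeanQ e ‖y‖ f 0 q)) volume 0 ‖y‖ ∧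
      shieldedSourceAt g y u 0 t f = avg g (t - u * I) ‖y‖ * f 0
        + I * ‖y‖ * ∫ q in (0 : ℝ)..‖y‖, avg g (t - u * I) q / q *
          (oblateMeanP e ‖y‖ f 0 q + I * oblateMeanQ e ‖y‖ f 0 q) := by
  have ha : 0 < ‖y‖ := norm_pos_iff.2 hy
  have hτ : ‖y‖ < |((t : ℂ) - u * I).im| := by simpa using hu
  have hEq : ∀ q ∈ Ioo 0 ‖y‖, avg g (t - u * I) q / q *
      (oblateMeanP e ‖y‖ f 0 q + I * oblateMeanQ e ‖y‖ f 0 q)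
        = -I * diskDensity e f g (t - u * I) ‖y‖ q := fun q hq => oblate_density_eq e f ha hq
  constructor
  · rw [intervalIntegrable_iff_integrableOn_Ioo_of_le ha.le]
    refine IntegrableOn.congr_fun ?_ (fun q hq => (hEq q hq).symm) measurableSet_Ioo
    rw [← intervalIntegrable_iff_integrableOn_Ioo_of_le ha.le]
    exact (intervalIntegrable_diskDensity e f ha hg hτ).const_mul _
  · rw [intervalIntegral.integral_of_le ha.le, integral_Ioc_eq_integral_Ioo,
      setIntegral_congr_fun measurableSet_Ioo hEq, ← integral_Ioc_eq_integral_Ioo,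
      ← intervalIntegral.integral_of_le ha.le, intervalIntegral.integral_const_mul,
      shieldedSourceAt_zero_eq_diskDensity e f hy he hu hg]
    linear_combination (‖y‖ * ∫ q in (0 : ℝ)..‖y‖, diskDensity e f g (t - u * I) ‖y‖ q) * I_sq

end Disk

/-! ### The source in cylindrical and Cartesian coordinates -/

section Cylindrical

variable {g : ℂ → ℂ} {τ : ℂ} {y : Space} {u : ℝ} {a : ℝ} (e : OrthonormalBasis (Fin 3) ℝ Space)
  (f : SpaceTest)

theorem sqrt_sq_sub_sq_mem_Ioo {q : ℝ} (hq : q ∈ Ioo 0 a) : √(a ^ 2 - q ^ 2) ∈ Ioo 0 a := by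
  have ha : 0 < a := hq.1.trans hq.2
  have h := pow_lt_pow_left₀ hq.2 hq.1.le two_ne_zero
  have h2 := pow_pos hq.1 2
  refine ⟨Real.sqrt_pos.2 (by linarith), ?_⟩
  rw [Real.sqrt_lt' ha]
  linarith

theorem sqrt_sq_sub_sqrt_sq {q : ℝ} (hq : q ∈ Ioo 0 a) : √(a ^ 2 - √(a ^ 2 - q ^ 2) ^ 2) = q := by
  have h := pow_lt_pow_left₀ hq.2 hq.1.le two_ne_zero
  rw [Real.sq_sqrt (by linarith), sub_sub_cancel, Real.sqrt_sq hq.1.le]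

theorem image_sqrt_sq_sub_sq : (fun q : ℝ => √(a ^ 2 - q ^ 2)) '' Ioo 0 a = Ioo 0 a :=
  Subset.antisymm (image_subset_iff.2 fun _ hq => sqrt_sq_sub_sq_mem_Ioo hq) fun _ hq =>
    ⟨_, sqrt_sq_sub_sq_mem_Ioo hq, sqrt_sq_sub_sqrt_sq hq⟩

theorem injOn_sqrt_sq_sub_sq : InjOn (fun q : ℝ => √(a ^ 2 - q ^ 2)) (Ioo 0 a) :=
  fun q hq q' hq' h => by
    rw [← sqrt_sq_sub_sqrt_sq hq, ← sqrt_sq_sub_sqrt_sq hq']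
    exact congrArg (fun r => √(a ^ 2 - r ^ 2)) h

theorem hasDerivAt_sqrt_sq_sub_sq {q : ℝ} (hq : q ∈ Ioo 0 a) :
    HasDerivAt (fun q : ℝ => √(a ^ 2 - q ^ 2)) (-(q / √(a ^ 2 - q ^ 2))) q := by
  have h := Real.sqrt_pos.1 (sqrt_sq_sub_sq_mem_Ioo hq).1
  refine ((((hasDerivAt_id q).pow 2).const_sub (a ^ 2)).sqrt h.ne').congr_deriv ?_
  simp only [id_eq, Pi.pow_apply]
  have := Real.sqrt_pos.2 h
  field_simp
  norm_num

/-- The density of the source in the radial coordinate `ρ ∈ (0, a)` of the branch disk. -/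
noncomputable def radialDensity (g : ℂ → ℂ) (τ : ℂ) (a ρ : ℝ) : ℂ :=
  avg g τ √(a ^ 2 - ρ ^ 2) / (√(a ^ 2 - ρ ^ 2) : ℝ) *
    (a * meanRadialDeriv e f ρ 0 + I * ρ * meanAxialDeriv e f ρ 0)

/-- The densities in `q` and in `ρ` agree under `ρ = √(a² - q²)`. -/
theorem abs_deriv_smul_radialDensity {q : ℝ} (hq : q ∈ Ioo 0 a) :
    |(-(q / √(a ^ 2 - q ^ 2)))| • radialDensity e f g τ a √(a ^ 2 - q ^ 2)
      = a * diskDensity e f g τ a q := by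
  have ha : 0 < a := hq.1.trans hq.2
  have hr := (sqrt_sq_sub_sq_mem_Ioo hq).1
  rw [abs_neg, abs_of_pos (div_pos hq.1 hr), radialDensity, sqrt_sq_sub_sqrt_sq hq, diskDensity]
  have h1 : (a : ℂ) ≠ 0 := ofReal_ne_zero.2 ha.ne'
  have h2 : (q : ℂ) ≠ 0 := ofReal_ne_zero.2 hq.1.ne'
  generalize √(a ^ 2 - q ^ 2) = r at *
  have h3 : (r : ℂ) ≠ 0 := ofReal_ne_zero.2 hr.ne'
  rw [real_smul]
  push_cast
  field_simp
  ring

theorem integrableOn_radialDensity (ha : 0 < a)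
    (hg : DifferentiableOn ℂ g {τ | τ.im ≠ 0}) (hτ : a < |τ.im|) :
    IntegrableOn (radialDensity e f g τ a) (Ioo 0 a) := by
  have h := (intervalIntegrable_iff_integrableOn_Ioo_of_le ha.le).1
    (intervalIntegrable_diskDensity e f ha hg hτ)
  rw [← image_sqrt_sq_sub_sq, integrableOn_image_iff_integrableOn_abs_deriv_smul measurableSet_Ioo
    (fun q hq => (hasDerivAt_sqrt_sq_sub_sq hq).hasDerivWithinAt) injOn_sqrt_sq_sub_sq]
  exact IntegrableOn.congr_fun (h.const_mul (a : ℂ))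
    (fun q hq => (abs_deriv_smul_radialDensity e f hq).symm) measurableSet_Ioo

theorem integral_radialDensity (ha : 0 < a) :
    ∫ ρ in Ioo 0 a, radialDensity e f g τ a ρ
      = a * ∫ q in (0 : ℝ)..a, diskDensity e f g τ a q := by
  rw [intervalIntegral.integral_of_le ha.le, integral_Ioc_eq_integral_Ioo, ← integral_const_mul]
  conv_lhs => rw [← image_sqrt_sq_sub_sq]
  rw [integral_image_eq_integral_abs_deriv_smul measurableSet_Ioo
    (fun q hq => (hasDerivAt_sqrt_sq_sub_sq hq).hasDerivWithinAt) injOn_sqrt_sq_sub_sq]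
  exact setIntegral_congr_fun measurableSet_Ioo fun q hq => abs_deriv_smul_radialDensity e f hq

theorem shieldedSourceAt_zero_eq_radialDensity (hy : y ≠ 0)
    (he : y = ‖y‖ • e 2) (hu : ‖y‖ < |u|) (hg : DifferentiableOn ℂ g {τ | τ.im ≠ 0}) (t : ℝ) :
    shieldedSourceAt g y u 0 t f = avg g (t - u * I) ‖y‖ * f 0
      + ∫ ρ in Ioo 0 ‖y‖, radialDensity e f g (t - u * I) ‖y‖ ρ := by
  rw [shieldedSourceAt_zero_eq_diskDensity e f hy he hu hg,
    integral_radialDensity e f (norm_pos_iff.2 hy)]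

theorem cylindrical_formula (hy : y ≠ 0)
    (he : y = ‖y‖ • e 2) (hu : ‖y‖ < |u|) (hg : DifferentiableOn ℂ g {τ | τ.im ≠ 0}) (t : ℝ) :
    IntervalIntegrable (fun ρ : ℝ =>
        avg g (t - u * I) √(‖y‖ ^ 2 - ρ ^ 2) / (√(‖y‖ ^ 2 - ρ ^ 2) : ℝ) *
        (‖y‖ * cylMeanRho e f ρ 0 + I * ρ * cylMeanXi e f ρ 0)) volume 0 ‖y‖ ∧
      shieldedSourceAt g y u 0 t f = avg g (t - u * I) ‖y‖ * f 0
        + ∫ ρ in (0 : ℝ)..‖y‖,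
          avg g (t - u * I) √(‖y‖ ^ 2 - ρ ^ 2) / (√(‖y‖ ^ 2 - ρ ^ 2) : ℝ) *
          (‖y‖ * cylMeanRho e f ρ 0 + I * ρ * cylMeanXi e f ρ 0) := by
  have ha : 0 < ‖y‖ := norm_pos_iff.2 hy
  have hτ : ‖y‖ < |((t : ℂ) - u * I).im| := by simpa using hu
  simp only [cylMeanRho_eq, cylMeanXi_eq]
  rw [intervalIntegrable_iff_integrableOn_Ioo_of_le ha.le, intervalIntegral.integral_of_le ha.le,
    integral_Ioc_eq_integral_Ioo]
  exact ⟨integrableOn_radialDensity e f ha hg hτ,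
    shieldedSourceAt_zero_eq_radialDensity e f hy he hu hg t⟩

end Cylindrical

section Cartesian

variable {g : ℂ → ℂ} {τ : ℂ} {y : Space} {u : ℝ} {a : ℝ} (e : OrthonormalBasis (Fin 3) ℝ Space)
  (f : SpaceTest)

theorem planeRadius_polarCoord_symm {z : ℝ × ℝ} (hz : 0 < z.1) :
    planeRadius (polarCoord.symm z) = z.1 := by
  rw [polarCoord_symm_apply, planeRadius]
  simp only
  rw [mul_pow, mul_pow, ← mul_add, Real.cos_sq_add_sin_sq, mul_one, Real.sqrt_sq hz.le]

theorem planePoint_polarCoord_symm (z : ℝ × ℝ) :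
    planePoint e (polarCoord.symm z) = z.1 • cylNormal e z.2 := by
  rw [polarCoord_symm_apply, planePoint, cylNormal, smul_add, smul_smul, smul_smul]

/-- The radial flow and the double layer in polar coordinates. -/
theorem flowAndLayer_polarCoord_symm {z : ℝ × ℝ} (hz : 0 < z.1) :
    flowAndLayer e a f (polarCoord.symm z)
      = a * (fderiv ℝ f (cylPoint e z.1 z.2 0) (cylNormal e z.2) : ℝ)
        + I * z.1 * (fderiv ℝ f (cylPoint e z.1 z.2 0) (e 2) : ℝ) := by
  rw [flowAndLayer, planeRadius_polarCoord_symm hz, planePoint_polarCoord_symm, smul_smul,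
    inv_mul_cancel₀ hz.ne', one_smul, cylPoint_eq, zero_smul, add_zero]

theorem polar_image_disk : polarCoord.symm '' (Ioo 0 a ×ˢ Ioo (-Real.pi) Real.pi)
    = {v | planeRadius v < a} ∩ polarCoord.source := by
  ext v
  constructor
  · rintro ⟨z, ⟨hz1, hz2⟩, rfl⟩
    refine ⟨?_, polarCoord.map_target ⟨hz1.1, hz2⟩⟩
    rw [mem_ofPred_eq, planeRadius_polarCoord_symm hz1.1]
    exact hz1.2
  · rintro ⟨hv, hs⟩
    have ht := polarCoord.map_source hs
    exact ⟨polarCoord v, ⟨⟨ht.1, hv⟩, ht.2⟩, polarCoord.left_inv hs⟩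

theorem polar_image_disk_ae_eq :
    (polarCoord.symm '' (Ioo 0 a ×ˢ Ioo (-Real.pi) Real.pi) : Set (ℝ × ℝ))
      =ᵐ[volume] {v | planeRadius v < a} := by
  rw [polar_image_disk]
  have h := (ae_eq_refl {v : ℝ × ℝ | planeRadius v < a}).inter polarCoord_source_ae_eq_univ
  rwa [inter_univ] at h

theorem injOn_polarCoord_symm :
    InjOn polarCoord.symm (Ioo 0 a ×ˢ Ioo (-Real.pi) Real.pi) :=
  polarCoord.symm.injOn.mono fun _ hz =>
    (⟨hz.1.1, hz.2⟩ : _ ∈ Ioi (0 : ℝ) ×ˢ Ioo (-Real.pi) Real.pi)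

theorem integrableOn_disk_iff {H : ℝ × ℝ → ℂ} :
    IntegrableOn H {v | planeRadius v < a} ↔
      IntegrableOn (fun z : ℝ × ℝ => z.1 • H (polarCoord.symm z))
        (Ioo 0 a ×ˢ Ioo (-Real.pi) Real.pi) := by
  rw [← integrableOn_congr_set_ae polar_image_disk_ae_eq,
    integrableOn_image_iff_integrableOn_abs_det_fderiv_smul volume
      (measurableSet_Ioo.prod measurableSet_Ioo)
      (fun z _ => (hasFDerivAt_polarCoord_symm z).hasFDerivWithinAt) injOn_polarCoord_symm]
  refine integrableOn_congr_fun (fun z hz => ?_) (measurableSet_Ioo.prod measurableSet_Ioo)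
  rw [det_fderivPolarCoordSymm, abs_of_pos hz.1.1]

theorem integral_disk {H : ℝ × ℝ → ℂ} :
    ∫ v in {v | planeRadius v < a}, H v
      = ∫ z in Ioo 0 a ×ˢ Ioo (-Real.pi) Real.pi, z.1 • H (polarCoord.symm z) := by
  rw [← setIntegral_congr_set polar_image_disk_ae_eq,
    integral_image_eq_integral_abs_det_fderiv_smul volume
      (measurableSet_Ioo.prod measurableSet_Ioo)
      (fun z _ => (hasFDerivAt_polarCoord_symm z).hasFDerivWithinAt) injOn_polarCoord_symm]
  refine setIntegral_congr_fun (measurableSet_Ioo.prod measurableSet_Ioo) fun z hz => ?_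
  rw [det_fderivPolarCoordSymm, abs_of_pos hz.1.1]

/-- The density has an integrable singularity at the rim: `1 / √(a² - ρ²)` is the derivative of
`arcsin (ρ / a)`. -/
theorem integrableOn_inv_sqrt_sq_sub_sq (ha : 0 < a) :
    IntegrableOn (fun ρ : ℝ => (√(a ^ 2 - ρ ^ 2))⁻¹) (Ioo 0 a) := by
  refine (intervalIntegral.integrableOn_deriv_of_nonneg (g := fun ρ => Real.arcsin (ρ / a))
    (by fun_prop) (fun ρ hρ => ?_) (fun ρ _ => by positivity)).mono_set Ioo_subset_Ioc_self
  have h1 : ρ / a < 1 := (div_lt_one ha).2 hρ.2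
  have h0 : 0 < ρ / a := div_pos hρ.1 ha
  have h2 : HasDerivAt (fun ρ : ℝ => ρ / a) (1 / a) ρ := (hasDerivAt_id ρ).div_const a
  refine ((Real.hasDerivAt_arcsin (by linarith) h1.ne).comp ρ h2).congr_deriv ?_
  have h3 : 1 - (ρ / a) ^ 2 = (a ^ 2 - ρ ^ 2) / a ^ 2 := by field_simp
  rw [h3, Real.sqrt_div' _ (by positivity), Real.sqrt_sq ha.le]
  field_simp

theorem continuous_avg_sqrt (ha : 0 < a) (hg : DifferentiableOn ℂ g {τ | τ.im ≠ 0})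
    (hτ : a < |τ.im|) : Continuous fun ρ : ℝ => avg g τ √(a ^ 2 - ρ ^ 2) := by
  have hle : ∀ ρ : ℝ, √(a ^ 2 - ρ ^ 2) ≤ a := fun ρ =>
    (Real.sqrt_le_left ha.le).2 (by nlinarith [sq_nonneg ρ])
  have hgc : ∀ w : ℂ, |w.im| ≤ a → ContinuousAt g (τ - w) := fun w hw =>
    (hg.differentiableAt (isOpen_im_ne_zero.mem_nhds (im_sub_ne_zero_of_abs_le hτ hw))).continuousAt
  have h1 : Continuous fun ρ : ℝ => g (τ + I * √(a ^ 2 - ρ ^ 2)) :=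
    continuous_iff_continuousAt.2 fun ρ => by
      have h := hgc (-(I * √(a ^ 2 - ρ ^ 2)))
        (by simpa [abs_of_nonneg (Real.sqrt_nonneg _)] using hle ρ)
      rw [sub_neg_eq_add] at h
      exact h.comp (f := fun ρ : ℝ => τ + I * √(a ^ 2 - ρ ^ 2)) (by fun_prop)
  have h2 : Continuous fun ρ : ℝ => g (τ - I * √(a ^ 2 - ρ ^ 2)) :=
    continuous_iff_continuousAt.2 fun ρ => by
      have h := hgc (I * √(a ^ 2 - ρ ^ 2))
        (by simpa [abs_of_nonneg (Real.sqrt_nonneg _)] using hle ρ)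
      exact h.comp (f := fun ρ : ℝ => τ - I * √(a ^ 2 - ρ ^ 2)) (by fun_prop)
  exact continuous_const.mul (h1.add h2)

/-- The radial flow and the double layer in polar coordinates, as a continuous function. -/
noncomputable def polarFlow (a : ℝ) (z : ℝ × ℝ) : ℂ :=
  a * (fderiv ℝ f (cylPoint e z.1 z.2 0) (cylNormal e z.2) : ℝ)
    + I * z.1 * (fderiv ℝ f (cylPoint e z.1 z.2 0) (e 2) : ℝ)

theorem continuous_fderiv_cylPoint :
    Continuous fun z : ℝ × ℝ => fderiv ℝ f (cylPoint e z.1 z.2 0) :=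
  (continuous_fderiv_test f).comp ((continuous_cylPoint e).comp
    (by fun_prop : Continuous fun z : ℝ × ℝ => (((z.1, 0), z.2) : (ℝ × ℝ) × ℝ)))

theorem continuous_polarFlow (a : ℝ) : Continuous (polarFlow e f a) := by
  have h := continuous_fderiv_cylPoint e f
  have h1 : Continuous fun z : ℝ × ℝ => fderiv ℝ f (cylPoint e z.1 z.2 0) (cylNormal e z.2) :=
    h.clm_apply (by fun_prop)
  have h2 : Continuous fun z : ℝ × ℝ => fderiv ℝ f (cylPoint e z.1 z.2 0) (e 2) :=
    h.clm_apply continuous_const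
  unfold polarFlow
  fun_prop

theorem integral_polarFlow (a ρ : ℝ) :
    ∫ θ in Ioo (-Real.pi) Real.pi, polarFlow e f a (ρ, θ)
      = 2 * Real.pi * (a * meanRadialDeriv e f ρ 0 + I * ρ * meanAxialDeriv e f ρ 0) := by
  have h := (continuous_fderiv_cylPoint e f).comp
    (continuous_const.prodMk continuous_id : Continuous fun θ : ℝ => (ρ, θ))
  have h1 : Continuous fun θ : ℝ => fderiv ℝ f (cylPoint e ρ θ 0) (cylNormal e θ) :=
    h.clm_apply (continuous_cylNormal e)
  have h2 : Continuous fun θ : ℝ => fderiv ℝ f (cylPoint e ρ θ 0) (e 2) :=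
    h.clm_apply continuous_const
  have hper : ∀ θ, cylPoint e ρ (θ + 2 * Real.pi) 0 = cylPoint e ρ θ 0 := fun θ => by
    simp [cylPoint]
  have hi : ∀ {k : ℝ → ℝ}, Continuous k →
      IntegrableOn (fun θ => ((k θ : ℝ) : ℂ)) (Ioo (-Real.pi) Real.pi) := fun hk =>
    ((continuous_ofReal.comp hk).integrableOn_Icc).mono_set Ioo_subset_Icc_self
  simp only [polarFlow]
  rw [integral_add ((hi h1).const_mul _) ((hi h2).const_mul _), integral_const_mul,
    integral_const_mul, integral_complex_ofReal, integral_complex_ofReal,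
    integral_Ioo_neg_pi_pi (fun θ => by simp only [hper, periodic_cylNormal e θ]),
    integral_Ioo_neg_pi_pi (fun θ => by simp only [hper]), meanRadialDeriv, meanAxialDeriv]
  have hpi : (Real.pi : ℂ) ≠ 0 := ofReal_ne_zero.2 Real.pi_ne_zero
  push_cast
  field_simp

/-- The Jacobian `ρ` of polar coordinates cancels the `1 / ρ` of the density in the plane. -/
theorem cartesian_density_polar {z : ℝ × ℝ} (hz : 0 < z.1) :
    z.1 • (avg g τ √(a ^ 2 - planeRadius (polarCoord.symm z) ^ 2) /
          (2 * Real.pi * (√(a ^ 2 - planeRadius (polarCoord.symm z) ^ 2) : ℝ) *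
            planeRadius (polarCoord.symm z)) * flowAndLayer e a f (polarCoord.symm z))
      = avg g τ √(a ^ 2 - z.1 ^ 2) * ((√(a ^ 2 - z.1 ^ 2))⁻¹ : ℝ)
        * ((2 * Real.pi : ℂ)⁻¹ * polarFlow e f a z) := by
  have hz' : (z.1 : ℂ) ≠ 0 := ofReal_ne_zero.2 hz.ne'
  rw [planeRadius_polarCoord_symm hz, flowAndLayer_polarCoord_symm e f hz, polarFlow, real_smul,
    div_eq_mul_inv, mul_inv, mul_inv]
  push_cast
  field_simp

theorem integrableOn_polar_density (ha : 0 < a) (hg : DifferentiableOn ℂ g {τ | τ.im ≠ 0})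
    (hτ : a < |τ.im|) :
    IntegrableOn (fun z : ℝ × ℝ => avg g τ √(a ^ 2 - z.1 ^ 2) * ((√(a ^ 2 - z.1 ^ 2))⁻¹ : ℝ)
      * ((2 * Real.pi : ℂ)⁻¹ * polarFlow e f a z)) (Ioo 0 a ×ˢ Ioo (-Real.pi) Real.pi) := by
  have hc1 := continuous_avg_sqrt ha hg hτ
  obtain ⟨M, hM⟩ := isCompact_Icc.exists_bound_of_continuousOn (s := Icc 0 a) hc1.continuousOn
  have h1 : IntegrableOn (fun ρ : ℝ => avg g τ √(a ^ 2 - ρ ^ 2) * ((√(a ^ 2 - ρ ^ 2))⁻¹ : ℝ))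
      (Ioo 0 a) := by
    refine Integrable.bdd_mul (integrableOn_inv_sqrt_sq_sub_sq ha).ofReal
      hc1.aestronglyMeasurable (c := M) ?_
    filter_upwards [ae_restrict_mem measurableSet_Ioo] with ρ hρ
    exact hM ρ (Ioo_subset_Icc_self hρ)
  have hc2 : Continuous fun z : ℝ × ℝ => (2 * Real.pi : ℂ)⁻¹ * polarFlow e f a z :=
    continuous_const.mul (continuous_polarFlow e f a)
  obtain ⟨N, hN⟩ := (isCompact_Icc.prod isCompact_Icc).exists_bound_of_continuousOn
    (s := Icc 0 a ×ˢ Icc (-Real.pi) Real.pi) hc2.continuousOn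
  rw [IntegrableOn, Measure.volume_eq_prod, ← Measure.prod_restrict]
  refine (Integrable.comp_fst h1 _).mul_bdd (c := N) hc2.aestronglyMeasurable ?_
  rw [Measure.prod_restrict]
  filter_upwards [ae_restrict_mem (measurableSet_Ioo.prod measurableSet_Ioo)] with z hz
  exact hN z (prod_mono Ioo_subset_Icc_self Ioo_subset_Icc_self hz)

/-- Integrating out the angle turns the density in polar coordinates into the radial density. -/
theorem integral_polar_density (ha : 0 < a) (hg : DifferentiableOn ℂ g {τ | τ.im ≠ 0})
    (hτ : a < |τ.im|) :
    ∫ z in Ioo 0 a ×ˢ Ioo (-Real.pi) Real.pi,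
        avg g τ √(a ^ 2 - z.1 ^ 2) * ((√(a ^ 2 - z.1 ^ 2))⁻¹ : ℝ)
          * ((2 * Real.pi : ℂ)⁻¹ * polarFlow e f a z)
      = ∫ ρ in Ioo 0 a, radialDensity e f g τ a ρ := by
  have hint := integrableOn_polar_density e f ha hg hτ
  rw [Measure.volume_eq_prod] at hint ⊢
  rw [setIntegral_prod _ hint]
  refine setIntegral_congr_fun measurableSet_Ioo fun ρ _ => ?_
  have hpi : (Real.pi : ℂ) ≠ 0 := ofReal_ne_zero.2 Real.pi_ne_zero
  simp only
  rw [integral_const_mul, integral_const_mul, integral_polarFlow, radialDensity, ofReal_inv]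
  field_simp

theorem cartesian_formula (hy : y ≠ 0)
    (he : y = ‖y‖ • e 2) (hu : ‖y‖ < |u|) (hg : DifferentiableOn ℂ g {τ | τ.im ≠ 0}) (t : ℝ) :
    IntegrableOn (fun v : ℝ × ℝ => avg g (t - u * I) √(‖y‖ ^ 2 - planeRadius v ^ 2) /
          (2 * Real.pi * (√(‖y‖ ^ 2 - planeRadius v ^ 2) : ℝ) * planeRadius v) *
        flowAndLayer e ‖y‖ f v) {v | planeRadius v < ‖y‖} ∧
      shieldedSourceAt g y u 0 t f = avg g (t - u * I) ‖y‖ * f 0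
        + ∫ v in {v : ℝ × ℝ | planeRadius v < ‖y‖},
          avg g (t - u * I) √(‖y‖ ^ 2 - planeRadius v ^ 2) /
            (2 * Real.pi * (√(‖y‖ ^ 2 - planeRadius v ^ 2) : ℝ) * planeRadius v) *
          flowAndLayer e ‖y‖ f v := by
  have ha : 0 < ‖y‖ := norm_pos_iff.2 hy
  have hτ : ‖y‖ < |((t : ℂ) - u * I).im| := by simpa using hu
  have hm : MeasurableSet (Ioo 0 ‖y‖ ×ˢ Ioo (-Real.pi) Real.pi) :=
    measurableSet_Ioo.prod measurableSet_Ioo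
  constructor
  · rw [integrableOn_disk_iff]
    exact IntegrableOn.congr_fun (integrableOn_polar_density e f ha hg hτ)
      (fun z hz => (cartesian_density_polar e f hz.1.1).symm) hm
  · rw [integral_disk, setIntegral_congr_fun hm fun z hz => cartesian_density_polar e f hz.1.1,
      integral_polar_density e f ha hg hτ]
    exact shieldedSourceAt_zero_eq_radialDensity e f hy he hu hg t

end Cartesian

/-! ### Analytic signals -/

section AnalyticSignal

variable {g₀ : ℝ → ℂ} {τ : ℂ}

theorem ofReal_sub_ne_zero_of_im {τ : ℂ} (hτ : τ.im ≠ 0) (s : ℝ) : τ - s ≠ 0 := fun h =>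
  hτ (by simpa using congrArg Complex.im h)

/-- Off the real axis the Cauchy kernel decays like `1 / (1 + |s|)`, locally uniformly. -/
theorem one_add_abs_le_mul_norm_sub {d M : ℝ} (hd : 0 < d) {τ : ℂ} (hτ : d ≤ |τ.im|)
    (hM : ‖τ‖ ≤ M) (s : ℝ) : 1 + |s| ≤ ((1 + M) / d + 1) * ‖τ - s‖ := by
  have h1 : d ≤ ‖τ - s‖ := by
    have := abs_im_le_norm (τ - s)
    rw [sub_im, ofReal_im, sub_zero] at this
    exact hτ.trans this
  have h2 : |s| ≤ ‖τ‖ + ‖τ - s‖ := by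
    have := norm_sub_le τ (τ - s)
    rwa [sub_sub_cancel, norm_real, Real.norm_eq_abs] at this
  have hM0 : 0 ≤ M := (norm_nonneg _).trans hM
  have h3 : 1 + M ≤ (1 + M) / d * ‖τ - s‖ := by
    rw [div_mul_eq_mul_div, le_div_iff₀ hd]
    gcongr
  linarith

theorem norm_div_le_of_one_add_abs_le {C : ℝ} {w : ℂ} {s : ℝ} (c : ℂ) (hw : w ≠ 0)
    (h : 1 + |s| ≤ C * ‖w‖) : ‖c / w‖ ≤ C * ‖c / ((1 + |s| : ℝ) : ℂ)‖ := by
  have h1 : 0 < 1 + |s| := by positivity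
  rw [norm_div, norm_div, norm_real, Real.norm_eq_abs, abs_of_pos h1, ← mul_div_assoc,
    div_le_div_iff₀ (norm_pos_iff.2 hw) h1]
  nlinarith [norm_nonneg c]

theorem aestronglyMeasurable_of_integrable_div
    (h : Integrable fun s : ℝ => g₀ s / ((1 + |s| : ℝ) : ℂ)) : AEStronglyMeasurable g₀ := by
  have h1 : Continuous fun s : ℝ => ((1 + |s| : ℝ) : ℂ) := by fun_prop
  refine (h.aestronglyMeasurable.mul h1.aestronglyMeasurable).congr
    (Eventually.of_forall fun s => ?_)
  have : ((1 + |s| : ℝ) : ℂ) ≠ 0 := ofReal_ne_zero.2 (by positivity)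
  exact div_mul_cancel₀ _ this

theorem measurable_sub_ofReal (τ : ℂ) : Measurable fun s : ℝ => τ - s := by fun_prop

theorem differentiableOn_analyticSignal (h : Integrable fun s : ℝ => g₀ s / ((1 + |s| : ℝ) : ℂ)) :
    DifferentiableOn ℂ (analyticSignal g₀) {τ | τ.im ≠ 0} := by
  intro τ₀ hτ₀
  have hτ₀ : 0 < |τ₀.im| := abs_pos.2 hτ₀
  have hg := aestronglyMeasurable_of_integrable_div h
  have hmeas : ∀ τ : ℂ, AEStronglyMeasurable (fun s : ℝ => g₀ s / (τ - s)) := fun τ => by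
    simp only [div_eq_mul_inv]
    exact hg.mul (measurable_sub_ofReal τ).inv.aestronglyMeasurable
  set d := |τ₀.im| / 2 with hd
  have hd0 : 0 < d := half_pos hτ₀
  set C := (1 + (‖τ₀‖ + d)) / d + 1 with hC
  have hball : ∀ τ ∈ Metric.ball τ₀ d, d ≤ |τ.im| ∧ ‖τ‖ ≤ ‖τ₀‖ + d := fun τ hτ => by
    have hτ' : ‖τ - τ₀‖ < d := by simpa [dist_eq_norm] using hτ
    have h1 := abs_im_le_norm (τ - τ₀)
    rw [sub_im] at h1
    have h2 := abs_sub_abs_le_abs_sub τ₀.im τ.im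
    rw [abs_sub_comm] at h2
    have h3 := norm_sub_norm_le τ τ₀
    constructor <;> linarith
  have hne : ∀ τ ∈ Metric.ball τ₀ d, ∀ s : ℝ, τ - s ≠ 0 := fun τ hτ s =>
    ofReal_sub_ne_zero_of_im (abs_pos.1 (hd0.trans_le (hball τ hτ).1)) s
  have hlow : ∀ τ ∈ Metric.ball τ₀ d, ∀ s : ℝ, 1 + |s| ≤ C * ‖τ - s‖ := fun τ hτ s =>
    one_add_abs_le_mul_norm_sub hd0 (hball τ hτ).1 (hball τ hτ).2 s
  have hτ₀b : τ₀ ∈ Metric.ball τ₀ d := Metric.mem_ball_self hd0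
  have key := hasDerivAt_integral_of_dominated_loc_of_deriv_le
    (F := fun (τ : ℂ) (s : ℝ) => g₀ s / (τ - s)) (F' := fun τ s => -(g₀ s / (τ - s) / (τ - s)))
    (x₀ := τ₀) (bound := fun s => d⁻¹ * (C * ‖g₀ s / ((1 + |s| : ℝ) : ℂ)‖))
    (Metric.ball_mem_nhds τ₀ hd0) (Eventually.of_forall hmeas)
    (Integrable.mono' (h.norm.const_mul C) (hmeas τ₀) (Eventually.of_forall fun s =>
      norm_div_le_of_one_add_abs_le _ (hne τ₀ hτ₀b s) (hlow τ₀ hτ₀b s))) ?_ ?_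
    ((h.norm.const_mul C).const_mul d⁻¹) ?_
  · exact (key.2.differentiableAt.const_mul _).differentiableWithinAt
  · simp only [div_eq_mul_inv]
    exact ((hg.mul (measurable_sub_ofReal τ₀).inv.aestronglyMeasurable).mul
      (measurable_sub_ofReal τ₀).inv.aestronglyMeasurable).neg
  · refine Eventually.of_forall fun s τ hτ => ?_
    have h1 := norm_div_le_of_one_add_abs_le (g₀ s) (hne τ hτ s) (hlow τ hτ s)
    have h2 : d ≤ ‖τ - s‖ := by
      have := abs_im_le_norm (τ - s)
      rw [sub_im, ofReal_im, sub_zero] at this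
      exact (hball τ hτ).1.trans this
    rw [norm_neg, norm_div, div_eq_inv_mul]
    exact mul_le_mul (inv_anti₀ hd0 h2) h1 (norm_nonneg _) (by positivity)
  · refine Eventually.of_forall fun s τ hτ => ?_
    have h1 := ((hasDerivAt_const τ (g₀ s)).div ((hasDerivAt_id τ).sub_const (s : ℂ)) (hne τ hτ s))
    refine h1.congr_deriv ?_
    have := hne τ hτ s
    simp only [id_eq]
    field_simp
    ring

/-- The wave radiated by the driven source is the beam of its analytic signal. -/
theorem beam_analyticSignal (y x : Space) (τ : ℂ) :
    beam (analyticSignal g₀) y x τ = ∫ s : ℝ, retardedPropagator y x (τ - s) * g₀ s := by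
  have h : ∀ s : ℝ, retardedPropagator y x (τ - s) * g₀ s
      = 1 / (8 * I * Real.pi ^ 2 * complexDist y x)
        * (g₀ s / (τ - complexDist y x - s)) := fun s => by
    rw [retardedPropagator, sub_right_comm, one_div, one_div, mul_inv _ (_ - _), div_eq_mul_inv]
    ring
  simp only [h]
  rw [integral_const_mul, beam, analyticSignal]
  generalize complexDist y x = r
  generalize ∫ s : ℝ, g₀ s / (τ - r - s) = J
  rw [div_eq_mul_inv, one_div, one_div, mul_inv _ r, mul_inv _ r]
  have hpi : (Real.pi : ℂ) ≠ 0 := ofReal_ne_zero.2 Real.pi_ne_zero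
  field_simp
  ring

end AnalyticSignal

end ComplexSource

theorem theoremT (y : ComplexSource.Space) (hy : y ≠ 0) (u : ℝ) (hu : ‖y‖ < |u|) :
    -- the analytic signal of a driving signal is holomorphic off the real axis, and the wave
    -- radiated by the driven source is the beam which it defines
    (∀ g₀ : ℝ → ℂ, Integrable (fun s => g₀ s / ((1 + |s| : ℝ) : ℂ)) →
      DifferentiableOn ℂ (ComplexSource.analyticSignal g₀) {τ | τ.im ≠ 0} ∧
      ∀ (x : ComplexSource.Space) (t : ℝ),
        ComplexSource.beam (ComplexSource.analyticSignal g₀) y x (t - u * I) =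
          ∫ s : ℝ, ComplexSource.retardedPropagator y x (t - u * I - s) * g₀ s) ∧
    -- the unshielded source of the beam defined by any function holomorphic off the real axis
    (∀ g : ℂ → ℂ, DifferentiableOn ℂ g {τ | τ.im ≠ 0} →
      -- the shielded sources are distributions, regular in `t`
      (∀ ε : ℝ, 0 < ε →
        LocallyIntegrable (ComplexSource.shieldedBeam g y u ε) ∧
        (∀ t : ℝ, LocallyIntegrable (fun x => ComplexSource.shieldedBeam g y u ε (x, t)) ∧
          LocallyIntegrable (fun x =>
            iteratedDeriv 2 (fun s => ComplexSource.shieldedBeam g y u ε (x, s)) t)) ∧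
        ComplexSource.IsRegularInTime (ComplexSource.shieldedSource g y u ε)
          (ComplexSource.shieldedSourceAt g y u ε)) ∧
      ∃ (S : ComplexSource.SpacetimeDistribution) (σ : ℝ → ComplexSource.SpaceDistribution),
        -- `S` is their weak limit, with and without smearing in time, and it is regular in `t`
        (∀ φ : ComplexSource.SpacetimeTest,
          Tendsto (fun ε => ComplexSource.shieldedSource g y u ε φ) (𝓝[>] 0) (𝓝 (S φ))) ∧
        (∀ (t : ℝ) (f : ComplexSource.SpaceTest),
          Tendsto (fun ε => ComplexSource.shieldedSourceAt g y u ε t f) (𝓝[>] 0)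
            (𝓝 (σ t f))) ∧
        ComplexSource.IsRegularInTime S σ ∧
        -- the action of `S` at time `t` on a spatial test function `f`
        ∀ e : OrthonormalBasis (Fin 3) ℝ ComplexSource.Space, y = ‖y‖ • e 2 →
        ∀ (t : ℝ) (f : ComplexSource.SpaceTest) (a : ℝ) (τ : ℂ), a = ‖y‖ → τ = t - u * I →
          -- in oblate spheroidal coordinates
          (IntervalIntegrable (fun q : ℝ => ComplexSource.avg g τ q / q *
              (ComplexSource.oblateMeanP e a f 0 q + I * ComplexSource.oblateMeanQ e a f 0 q))
              volume 0 a ∧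
            σ t f = ComplexSource.avg g τ a * f 0 +
              I * a * ∫ q in (0 : ℝ)..a, ComplexSource.avg g τ q / q *
                (ComplexSource.oblateMeanP e a f 0 q
                  + I * ComplexSource.oblateMeanQ e a f 0 q)) ∧
          -- the partial derivatives of the mean of `f` on the disk, which are `O(q)`
          (∀ q ∈ Ioo 0 a,
            HasDerivAt (fun p => ComplexSource.oblateMean e a f p q)
              (q / a * ComplexSource.cylMeanXi e f √(a ^ 2 - q ^ 2) 0) 0 ∧
            HasDerivAt (fun q' => ComplexSource.oblateMean e a f 0 q')
              (-(q / √(a ^ 2 - q ^ 2)) * ComplexSource.cylMeanRho e f √(a ^ 2 - q ^ 2) 0) q) ∧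
          (∃ C : ℝ, ∀ q ∈ Ioo 0 a, |ComplexSource.oblateMeanP e a f 0 q| ≤ C * q ∧
            |ComplexSource.oblateMeanQ e a f 0 q| ≤ C * q) ∧
          -- in cylindrical coordinates
          (IntervalIntegrable (fun ρ : ℝ =>
              ComplexSource.avg g τ √(a ^ 2 - ρ ^ 2) / (√(a ^ 2 - ρ ^ 2) : ℝ) *
              (a * ComplexSource.cylMeanRho e f ρ 0 + I * ρ * ComplexSource.cylMeanXi e f ρ 0))
              volume 0 a ∧
            σ t f = ComplexSource.avg g τ a * f 0 +
              ∫ ρ in (0 : ℝ)..a,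
                ComplexSource.avg g τ √(a ^ 2 - ρ ^ 2) / (√(a ^ 2 - ρ ^ 2) : ℝ) *
                (a * ComplexSource.cylMeanRho e f ρ 0
                  + I * ρ * ComplexSource.cylMeanXi e f ρ 0)) ∧
          -- as a point source at the origin plus a radial flow and a double layer on the disk
          (IntegrableOn (fun v : ℝ × ℝ =>
              ComplexSource.avg g τ √(a ^ 2 - ComplexSource.planeRadius v ^ 2) /
                (2 * Real.pi * (√(a ^ 2 - ComplexSource.planeRadius v ^ 2) : ℝ) *
                  ComplexSource.planeRadius v) *
              ComplexSource.flowAndLayer e a f v) {v | ComplexSource.planeRadius v < a} ∧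
            σ t f = ComplexSource.avg g τ a * f 0 +
              ∫ v in {v : ℝ × ℝ | ComplexSource.planeRadius v < a},
                ComplexSource.avg g τ √(a ^ 2 - ComplexSource.planeRadius v ^ 2) /
                  (2 * Real.pi * (√(a ^ 2 - ComplexSource.planeRadius v ^ 2) : ℝ) *
                    ComplexSource.planeRadius v) *
                ComplexSource.flowAndLayer e a f v)) := by
  refine ⟨fun g₀ h₀ => ⟨ComplexSource.differentiableOn_analyticSignal h₀, fun x t =>
    ComplexSource.beam_analyticSignal y x _⟩, fun g hg => ?_⟩
  have ha : 0 < ‖y‖ := norm_pos_iff.2 hy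
  have hg'' := ComplexSource.differentiableOn_deriv_im_ne_zero
    (ComplexSource.differentiableOn_deriv_im_ne_zero hg)
  refine ⟨fun ε _ => ⟨ComplexSource.locallyIntegrable_shieldedBeam hy hu hg ε, fun t =>
    ⟨ComplexSource.locallyIntegrable_shieldedBeam_slice hy hu hg ε t, ?_⟩,
    ComplexSource.isRegularInTime_shieldedSource hy hu hg ε⟩,
    ComplexSource.shieldedSource g y u 0, ComplexSource.shieldedSourceAt g y u 0,
    ComplexSource.tendsto_shieldedSource hy hu hg,
    ComplexSource.tendsto_shieldedSourceAt hy hu hg,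
    ComplexSource.isRegularInTime_shieldedSource hy hu hg 0, ?_⟩
  · simp only [ComplexSource.iteratedDeriv_two_shieldedBeam hu hg]
    exact ComplexSource.locallyIntegrable_shieldedBeam_slice hy hu hg'' ε t
  · rintro e he t f a τ rfl rfl
    refine ⟨ComplexSource.oblate_formula e f hy he hu hg t, fun q hq => ?_,
      ComplexSource.exists_abs_oblateMean_deriv_le e f ha,
      ComplexSource.cylindrical_formula e f hy he hu hg t,
      ComplexSource.cartesian_formula e f hy he hu hg t⟩
    have hq' : |q| < ‖y‖ := by rw [abs_of_pos hq.1]; exact hq.2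
    exact ⟨ComplexSource.hasDerivAt_oblateMean_zero_fst e f ha hq',
      ComplexSource.hasDerivAt_oblateMean_zero_snd e f ha hq'⟩
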